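/- Let $G$ be a connected planar graph on $N$ vertices with a fixed plane embedding and with non-negative edge lengths, and let $\mathcal K\uplus\mathcal R\subseteq V(G)$ be a non-empty set of $n$ terminals, where $\mathcal K$ is the set of the terminals that lie on the outer face; let $k=|\mathcal K|$. Let $d(u,v)$ be the length of a shortest path from $u$ to $v$. A Steiner minimal tree (SMT) for $\mathcal K\uplus\mathcal R$ is a connected subgraph of $G$ that contains all the terminals and has minimum length (sum of the lengths of its edges) among all such subgraphs. The terminals in $\mathcal K$ are given in their counterclockwise order along the boundary walk of the outer face (a vertex that the walk visits more than once is placed at any one of its visits). For $a,b$ in $\mathcal K$, $[a,b)$ denotes the cyclic interval of $\mathcal K$ from $a$ (included) to $b$ (excluded) in this order. Empty intervals and the whole of $\mathcal K$ are also intervals; the whole of $\mathcal K$ may be listed from any of its elements on. Algorithm. Compute all the shortest distances and shortest paths. Choose a root $v_0\in\mathcal R$ (if $\mathcal R=\emptyset$, choose $v_0\in\mathcal K$). Set $C(\{u\})=0$ and $C(\{u\}\cup\{a\})=d(u,a)$ for all $u\in V(G)$ and all terminals $a\ne v_0$ (if $\mathcal R=\emptyset$: for all terminals $a$). Then, for the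 sets $\mathcal L\subseteq\mathcal R\setminus\{v_0\}$ by increasing size, and for each of them for the intervals $[a,b)$ of $\mathcal K$ by increasing size, where $|\mathcal L|+|[a,b)|\ge 2$, compute first $B(v,\mathcal L,[a,b))$ for all $v\in V(G)\setminus(\mathcal L\cup[a,b))$ and then $C(\{v\}\cup\mathcal L\cup[a,b))$ for all these $v$, by $$B(v,\mathcal L,[a,b))=\min\{\,C(\{v\}\cup\mathcal L'\cup[a,x))+C(\{v\}\cup(\mathcal L\setminus\mathcal L')\cup[x,b))\,\},$$ where the minimum is over all $\mathcal L'\subseteq\mathcal L$ and all cuts of $[a,b)$ into successive intervals $[a,x)$, $[x,b)$ such that $\emptyset\ne\mathcal L'\cup[a,x)\ne\mathcal L\cup[a,b)$; $$C(\{v\}\cup\mathcal L\cup[a,b))=\min\{\,A(v,\mathcal L_1,[a,c))+A(v,\mathcal L_2,[c,d))+A(v,\mathcal L_3,[d,b))\,\},$$ where the minimum is over all partitions of $\mathcal L$ into three possibly empty sets $\mathcal L_1,\mathcal L_2,\mathcal L_3$ and all cuts of $[a,b)$ into three possibly empty successive intervals. Here $A(v,\emptyset,\emptyset)=0$ and otherwise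 $$A(v,\mathcal L',[p,q))=\min\Big\{\min_{u\notin\mathcal L'\cup[p,q)}\big(B(u,\mathcal L',[p,q))+d(u,v)\big),\ \min_{u\in\mathcal L'\cup[p,q)}\big(C(\mathcal L'\cup[p,q))+d(u,v)\big)\Big\}.$$ In the last term, $C(\mathcal L'\cup[p,q))$ is read off as $C(\{u\}\cup(\mathcal L'\setminus\{u\})\cup[p,q))$ if $u\in\mathcal L'$, and as $C(\{p\}\cup\mathcal L'\cup([p,q)\setminus\{p\}))$ if $u\in[p,q)$. If $[a,b)$ is all of $\mathcal K$, the minima for $B$ and $C$ are also over the element from which $\mathcal K$ is listed. A minimum over no choices is $\infty$. Every entry is stored together with the edge set that realizes it (a sum of lengths stands for the union of the edge sets), and the algorithm returns the entry $C(\{v_0\}\cup(\mathcal R\setminus\{v_0\})\cup\mathcal K)$: its length, and the list of its edges. Theorem. The edges in the list that the algorithm returns are exactly the edges of an SMT for $\mathcal K\uplus\mathcal R$ in $G$, and the length that it returns is the length of this SMT. Moreover, if $k\ge1$, the algorithm takes $\mathcal O(N^2k^44^{n-k}+Nk^33^{n-k}+N^3)$ time, with an absolute constant. Time is counted on a unit-cost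 random access machine, in which a table access, a loop iteration, an addition or comparison of lengths, and an arithmetic or bit operation on a word (an index, or a subset of $\mathcal R$ stored as a bit mask) take constant time. -/

import Mathlib

open scoped NNReal ENNReal

/-! ### Plane graphs and Steiner minimal trees -/

/-- The permutation `d ↦ rot d.symm` of the darts (oriented edges): follow an edge to its head and
turn to the next edge there. -/
def facePerm {V : Type} {G : SimpleGraph V} (rot : Equiv.Perm G.Dart) : Equiv.Perm G.Dart :=
  (Function.Involutive.toPerm SimpleGraph.Dart.symm SimpleGraph.Dart.symm_involutive).trans rot

/-- A combinatorial plane embedding (rotation system of genus zero) of a connected graph, together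
with a choice of its outer face. The dart `d` starts at its tail `d.fst`; `rot` sends a dart to the
next one, in counterclockwise order, with the same tail. So `facePerm rot` follows the boundaries of
the faces, keeping the face on the right-hand side. -/
structure PlaneEmbedding {V : Type} (G : SimpleGraph V) where
  rot : Equiv.Perm G.Dart
  rot_fst : ∀ d, (rot d).fst = d.fst
  rot_cyclic : ∀ d d' : G.Dart, d.fst = d'.fst → rot.SameCycle d d'
  /-- Euler's formula `|V| + |F| = |E| + 2`, where the faces are the orbits of `facePerm rot`. (A
  connected graph without edges is one vertex, and needs no condition.) -/
  euler : Nonempty G.Dart →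
    Nat.card V + Nat.card (Quotient (Equiv.Perm.SameCycle.setoid (facePerm rot)))
      = Nat.card G.edgeSet + 2
  /-- The darts that have the outer face on their right-hand side: they form one face. -/
  outer : Set G.Dart
  outer_nonempty : Nonempty G.Dart → outer.Nonempty
  outer_face : ∀ d ∈ outer, ∀ d', d' ∈ outer ↔ (facePerm rot).SameCycle d d'

namespace PlaneEmbedding

variable {V : Type} {G : SimpleGraph V}

/-- `W` lists the vertices met when the boundary of the outer face is traversed once,
counterclockwise, from some starting point (a cut vertex may occur several times). In a connected
graph without edges, the boundary is the only vertex. -/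
def IsOuterWalk (E : PlaneEmbedding G) (W : List V) : Prop :=
  (∃ d ∈ E.outer,
    W = (List.iterate (facePerm E.rot) d
      (Function.minimalPeriod (facePerm E.rot) d)).map fun e => e.fst) ∨
  (IsEmpty G.Dart ∧ ∃ v, W = [v])

end PlaneEmbedding

open Classical in
/-- The length of a subgraph: the sum of the lengths of its edges. -/
noncomputable def subgraphLength {V : Type} [Fintype V] {G : SimpleGraph V} (w : Sym2 V → ℝ≥0)
    (T : G.Subgraph) : ℝ≥0 :=
  ∑ e : Sym2 V with e ∈ T.edgeSet, w e

/-- `T` is a Steiner minimal tree in `G` for the terminal set `P`: a connected subgraph of minimum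
length among those that contain all of `P`. -/
def IsSteinerMinimalTree {V : Type} [Fintype V] (G : SimpleGraph V) (w : Sym2 V → ℝ≥0)
    (P : Set V) (T : G.Subgraph) : Prop :=
  T.Connected ∧ P ⊆ T.verts ∧
    ∀ T' : G.Subgraph, T'.Connected → P ⊆ T'.verts → subgraphLength w T ≤ subgraphLength w T'

/-! ### The machine model

A unit-cost random access machine with tables. Every loop iteration, table access, addition or
comparison of lengths, and constant-size piece of index arithmetic costs a step. A subset of the
inner terminals is stored in one word, as a bit mask. -/

namespace SteinerDP

/-- A pointer structure that stands for a union of edges; a union is formed in one step. -/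
inductive Rope (N : ℕ) where
  | nil : Rope N
  | edge (u v : Fin N) : Rope N
  | join (s t : Rope N) : Rope N

/-- A table entry: a partial solution together with its length. -/
structure Entry (N : ℕ) where
  len : ℝ≥0∞
  tree : Rope N

/-- The entry "no solution known". -/
noncomputable def Entry.inf (N : ℕ) : Entry N := ⟨⊤, Rope.nil⟩

/-- The entry of a one-vertex tree. -/
noncomputable def Entry.zero (N : ℕ) : Entry N := ⟨0, Rope.nil⟩

/-- The memory, with the step counter. The tables `tabB` and `tabC` are indexed by a root vertex,
the bit mask of a set of inner terminals, and an interval (first position, number of elements) of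
the cyclic sequence of outer terminals. `posK` and `posS` hold the position of a vertex in the list
of outer terminals and in the list of inner terminals. -/
structure Mem (N : ℕ) where
  steps : ℕ
  posK : Fin N → Option ℕ
  posS : Fin N → Option ℕ
  dist : Fin N → Fin N → Entry N
  tabB : Fin N → ℕ → ℕ × ℕ → Entry N
  tabC : Fin N → ℕ → ℕ × ℕ → Entry N

noncomputable def Mem.init (N : ℕ) : Mem N where
  steps := 0
  posK := fun _ => none
  posS := fun _ => none
  dist := fun _ _ => Entry.inf N
  tabB := fun _ _ _ => Entry.inf N
  tabC := fun _ _ _ => Entry.inf N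

/-- Programs of the machine. -/
abbrev Prog (N : ℕ) (α : Type) : Type := StateM (Mem N) α

variable {N : ℕ}

/-- One elementary step. -/
def tick : Prog N Unit := modify fun m => { m with steps := m.steps + 1 }

def readPosK (u : Fin N) : Prog N (Option ℕ) := do
  tick
  return (← get).posK u

def readPosS (u : Fin N) : Prog N (Option ℕ) := do
  tick
  return (← get).posS u

def readDist (u v : Fin N) : Prog N (Entry N) := do
  tick
  return (← get).dist u v

def readB (v : Fin N) (L : ℕ) (I : ℕ × ℕ) : Prog N (Entry N) := do
  tick
  return (← get).tabB v L I

def readC (v : Fin N) (L : ℕ) (I : ℕ × ℕ) : Prog N (Entry N) := do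
  tick
  return (← get).tabC v L I

def writePosK (u : Fin N) (i : ℕ) : Prog N Unit := do
  tick
  modify fun m => { m with posK := fun u' => if u' = u then some i else m.posK u' }

def writePosS (u : Fin N) (i : ℕ) : Prog N Unit := do
  tick
  modify fun m => { m with posS := fun u' => if u' = u then some i else m.posS u' }

def writeDist (u v : Fin N) (x : Entry N) : Prog N Unit := do
  tick
  modify fun m =>
    { m with dist := fun u' v' => if u' = u ∧ v' = v then x else m.dist u' v' }

def writeB (v : Fin N) (L : ℕ) (I : ℕ × ℕ) (x : Entry N) : Prog N Unit := do
  tick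
  modify fun m =>
    { m with tabB := fun v' L' I' => if v' = v ∧ L' = L ∧ I' = I then x else m.tabB v' L' I' }

def writeC (v : Fin N) (L : ℕ) (I : ℕ × ℕ) (x : Entry N) : Prog N Unit := do
  tick
  modify fun m =>
    { m with tabC := fun v' L' I' => if v' = v ∧ L' = L ∧ I' = I then x else m.tabC v' L' I' }

/-- Union of two partial solutions; their lengths are added. -/
noncomputable def plus (x y : Entry N) : Prog N (Entry N) := do
  tick
  return ⟨x.len + y.len, Rope.join x.tree y.tree⟩

/-- The shorter one of two partial solutions. -/
noncomputable def better (x y : Entry N) : Prog N (Entry N) := do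
  tick
  return if y.len < x.len then y else x

/-- Execute `f i` for all `i` of a list, one after the other. -/
def forEach {ι : Type} : List ι → (ι → Prog N Unit) → Prog N Unit
  | [], _ => return ()
  | i :: l, f => do
    tick
    f i
    forEach l f

/-- The shortest one of the partial solutions `f i`, for all `i` of a list. -/
noncomputable def minimum {ι : Type} : List ι → (ι → Prog N (Entry N)) → Prog N (Entry N)
  | [], _ => return Entry.inf N
  | i :: l, f => do
    tick
    let x ← f i
    let y ← minimum l f
    better x y

/-- All submasks of the lowest `s` bits of `L`. -/
def submasks : ℕ → ℕ → Prog N (List ℕ)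
  | 0, _ => return [0]
  | s + 1, L => do
    tick
    let l ← submasks s L
    if L.testBit s then
      forEach l fun _ => tick
      return l ++ l.map fun M => M + 2 ^ s
    else
      return l

/-- The number of ones among the lowest `s` bits of `L`. -/
def popcount : ℕ → ℕ → Prog N ℕ
  | 0, _ => return 0
  | s + 1, L => do
    tick
    let c ← popcount s L
    return if L.testBit s then c + 1 else c

/-- Append the edges of a pointer structure to a list. -/
def flatten : Rope N → List (Sym2 (Fin N)) → Prog N (List (Sym2 (Fin N)))
  | Rope.nil, acc => do
    tick
    return acc
  | Rope.edge u v, acc => do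
    tick
    return s(u, v) :: acc
  | Rope.join x y, acc => do
    tick
    let acc' ← flatten y acc
    flatten x acc'

/-! ### The algorithm

The outer terminals `K = [K₀, …, K_{k-1}]` are listed counterclockwise along the outer boundary. The
interval `[a, b)` is given by the position of `a` and its number of elements. `S` is the list of the
inner terminals other than the root. -/

/-- The interval of `l` elements from position `a` on, in normal form: the empty interval and
the whole of `K` start, by convention, at position `0`. -/
def ival (k a l : ℕ) : ℕ × ℕ := if l = 0 ∨ l = k then (0, l) else (a % k, l)

/-- The starting positions of all different intervals of `l` elements. -/
def starts (k l : ℕ) : List ℕ := if l = 0 ∨ l = k then [0] else List.range k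

/-- The positions where the listing of an interval may begin: its first element; any position
if the interval is all of `K`. -/
def origins (k : ℕ) (I : ℕ × ℕ) : List ℕ :=
  if 0 < I.2 ∧ I.2 = k then List.range k else [I.1]

/-- Is `u` in the set of inner terminals with mask `L`? -/
def memL (u : Fin N) (L : ℕ) : Prog N Bool := do
  return match ← readPosS u with
    | some i => L.testBit i
    | none => false

/-- Is `u` in the interval `I` of outer terminals? -/
def memI (k : ℕ) (u : Fin N) (I : ℕ × ℕ) : Prog N Bool := do
  return match ← readPosK u with
    | some p => decide ((p + k - I.1) % k < I.2)
    | none => false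

/-- The shortest distances, with shortest paths, between all pairs of vertices (Floyd-Warshall). -/
noncomputable def allPairs (G : SimpleGraph (Fin N)) [DecidableRel G.Adj]
    (w : Sym2 (Fin N) → ℝ≥0) : Prog N Unit := do
  forEach (List.finRange N) fun u =>
    forEach (List.finRange N) fun v =>
      writeDist u v
        (if u = v then Entry.zero N
         else if G.Adj u v then ⟨(w s(u, v) : ℝ≥0∞), Rope.edge u v⟩
         else Entry.inf N)
  forEach (List.finRange N) fun x =>
    forEach (List.finRange N) fun u =>
      forEach (List.finRange N) fun v => do
        let new ← plus (← readDist u x) (← readDist x v)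
        let best ← better (← readDist u v) new
        writeDist u v best

/-- `A(v, L, I)`: the minimum over all vertices `u` of `d(u, v)` plus `B(u, L, I)` if `u` is not in
`L ∪ I`, and plus `C(L ∪ I)` if it is. The value `C(L ∪ I)` is looked up as `C({u} ∪ (L \ {u}) ∪ I)`
if `u ∈ L`, and as `C({a} ∪ L ∪ (I \ {a}))` with the first element `a` of `I` if `u ∈ I`. If
`L ∪ I` is empty, the tree consists of `v` only. -/
noncomputable def valueA (K : List (Fin N)) (v : Fin N) (L : ℕ) (I : ℕ × ℕ) :
    Prog N (Entry N) := do
  tick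
  if L = 0 ∧ I.2 = 0 then
    return Entry.zero N
  else
    minimum (List.finRange N) fun u => do
      let d ← readDist u v
      if ← memL u L then
        let i := (← readPosS u).getD 0
        plus (← readC u (L ^^^ 2 ^ i) I) d
      else if ← memI K.length u I then
        plus (← readC (K.getD I.1 u) L (ival K.length (I.1 + 1) (I.2 - 1))) d
      else
        plus (← readB u L I) d

/-- `B(v, L, I)`: the minimum of `C({v} ∪ L' ∪ [a, x)) + C({v} ∪ (L \ L') ∪ [x, b))` over all
`L' ⊆ L` and all ways to cut `I = [a, b)` into `[a, x)` and `[x, b)`, where neither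
`L' ∪ [a, x)` nor `(L \ L') ∪ [x, b)` is empty. -/
noncomputable def valueB (k s : ℕ) (v : Fin N) (L : ℕ) (I : ℕ × ℕ) : Prog N (Entry N) := do
  let subs ← submasks s L
  minimum (origins k I) fun a =>
    minimum subs fun L' =>
      minimum (List.range (I.2 + 1)) fun x => do
        tick
        if (L' = 0 ∧ x = 0) ∨ (L' = L ∧ x = I.2) then
          return Entry.inf N
        else
          plus (← readC v L' (ival k a x)) (← readC v (L ^^^ L') (ival k (a + x) (I.2 - x)))

/-- `C({v} ∪ L ∪ I)`: the minimum of `A(v, L₁, [a, c)) + A(v, L₂, [c, d)) + A(v, L₃, [d, b))` over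
all partitions of `L` into three sets and of `I = [a, b)` into three successive intervals, any of
which may be empty. -/
noncomputable def valueC (K : List (Fin N)) (s : ℕ) (v : Fin N) (L : ℕ) (I : ℕ × ℕ) :
    Prog N (Entry N) := do
  let subs₁ ← submasks s L
  minimum (origins K.length I) fun a =>
    minimum subs₁ fun L₁ => do
      let subs₂ ← submasks s (L ^^^ L₁)
      minimum subs₂ fun L₂ =>
        minimum (List.range (I.2 + 1)) fun c =>
          minimum (List.range (I.2 - c + 1)) fun d => do
            let A₁ ← valueA K v L₁ (ival K.length a c)
            let A₂ ← valueA K v L₂ (ival K.length (a + c) d)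
            let A₃ ← valueA K v ((L ^^^ L₁) ^^^ L₂) (ival K.length (a + c + d) (I.2 - c - d))
            plus A₁ (← plus A₂ A₃)

/-- Positions of the terminals, and the entries of `tabC` for at most one terminal besides the
root: `C({u} ∪ {a}) = d(u, a)` and `C({u}) = 0`. -/
noncomputable def baseCases (K S : List (Fin N)) : Prog N Unit := do
  forEach K.zipIdx fun p => writePosK p.1 p.2
  forEach S.zipIdx fun p => writePosS p.1 p.2
  forEach (List.finRange N) fun u => do
    writeC u 0 (0, 0) (Entry.zero N)
    forEach K.zipIdx fun p => do
      let d ← readDist u p.1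
      writeC u 0 (ival K.length p.2 1) d
    forEach S.zipIdx fun p => do
      let d ← readDist u p.1
      writeC u (2 ^ p.2) (0, 0) d

/-- Compute `B(v, L, I)`, and then `C({v} ∪ L ∪ I)`, for all vertices `v` outside `L ∪ I`. -/
noncomputable def fillEntries (K : List (Fin N)) (s L : ℕ) (I : ℕ × ℕ) : Prog N Unit := do
  forEach (List.finRange N) fun v => do
    if (← memL v L) || (← memI K.length v I) then
      return ()
    else
      let x ← valueB K.length s v L I
      writeB v L I x
  forEach (List.finRange N) fun v => do
    if (← memL v L) || (← memI K.length v I) then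
      return ()
    else
      let x ← valueC K s v L I
      writeC v L I x

/-- The dynamic program: subsets `L` of `S` by increasing size, then intervals of `K` by increasing
size. -/
noncomputable def fillTables (K : List (Fin N)) (s : ℕ) : Prog N Unit :=
  forEach (List.range (s + 1)) fun i =>
    forEach (List.range (2 ^ s)) fun L => do
      let c ← popcount s L
      if c = i then
        forEach (List.range (K.length + 1)) fun j =>
          if 2 ≤ i + j then
            forEach (starts K.length j) fun a =>
              fillEntries K s L (ival K.length a j)
          else
            return ()
      else
        return ()

/-- Look up the entry for all terminals. The root is an inner terminal, if there is one, and an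
outer terminal otherwise. -/
noncomputable def finalEntry (K R : List (Fin N)) : Prog N (Entry N) :=
  match R, K with
  | v :: S, _ => readC v (2 ^ S.length - 1) (ival K.length 0 K.length)
  | [], v :: _ => readC v 0 (ival K.length 1 (K.length - 1))
  | [], [] => return Entry.inf N

/-- The algorithm, for a graph `G` with edge lengths `w`, outer terminals `K` and inner terminals
`R`. The output is the length of the tree and the list of its edges. -/
noncomputable def algorithm (G : SimpleGraph (Fin N)) [DecidableRel G.Adj]
    (w : Sym2 (Fin N) → ℝ≥0) (K R : List (Fin N)) : Prog N (ℝ≥0∞ × List (Sym2 (Fin N))) := do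
  allPairs G w
  baseCases K R.tail
  fillTables K R.tail.length
  let res ← finalEntry K R
  let edges ← flatten res.tree []
  return (res.len, edges)

/-- The output of the algorithm. -/
noncomputable def output (G : SimpleGraph (Fin N)) [DecidableRel G.Adj]
    (w : Sym2 (Fin N) → ℝ≥0) (K R : List (Fin N)) : ℝ≥0∞ × List (Sym2 (Fin N)) :=
  ((algorithm G w K R).run (Mem.init N)).1

/-- The number of steps that the algorithm takes. -/
noncomputable def runningTime (G : SimpleGraph (Fin N)) [DecidableRel G.Adj]
    (w : Sym2 (Fin N) → ℝ≥0) (K R : List (Fin N)) : ℕ :=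
  ((algorithm G w K R).run (Mem.init N)).2.steps

end SteinerDP

/-! ### Noncrossing of disjoint connected sets along the outer face -/

/-! Every table entry is bounded from two sides. It is sound: unless its length is infinite, its
edges are those of a connected subgraph through the required vertices, of at most the stored length
(`Entry.Sound`). Unions preserve this, because the parts share a vertex. And it becomes good: its
length is at most that of every tree that the induction has to consider (`EntryOpt`, `treeDist`).
For the final entry the two bounds meet, since every connected subgraph contains a tree on its
vertices that is no longer (`exists_spansTree`).

Goodness rests on `le_treeDist_of_recurrence`. Cut a tree at an edge of its root `v` into the branch
`Y` with the first terminal of the interval and the rest `X₀`, which keeps `v`. If `Y` has all the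
terminals, descend into `Y`; otherwise the two parts are a candidate for `B` at `v`. The tables only
know sets whose outer terminals form an interval, so `Y` has to take an initial segment of it
(`Noncrossing.exists_cut`). Here planarity enters: two disjoint connected sets cannot alternate
around the outer face, so `Y` cannot be left and entered again within the interval, provided that
the side of `X₀` also reaches a terminal beyond the end of the interval. The invariant `Anchored`
supplies such a terminal, joined to the root outside the tree, and both parts inherit the invariant.
If the interval is all of `K`, the free choice of the element from which `K` is listed takes its
place.

Noncrossing is proved with chains modulo two. By Euler's formula the sequence faces, edges, vertices
is exact at the edges (`ker_boundary_le`). A path in `A` from `a` to `a'`, closed up by the stretch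
of the outer walk between them, is therefore the boundary of a set of faces. This yields a
two-colouring of the darts that is constant along any connected set avoiding the path, whereas on
the outer walk the colour changes exactly at the chosen visits to `a` and `a'`. So `b` and `b'`
would have both equal and different colours.

The running time comes from using the binomial theorem twice: `L` has `3 ^ |L|` ordered partitions
into three sets, and these numbers add up to `4 ^ s` over all `L`. There are `O(k ^ 2)` pairs of an
interval and a start of its listing, `O(k ^ 2)` cuts into three, `N` roots, and `N` candidates in
each value `A`. Writing out the answer is cheap, because the pointer structures grow only linearly
in the number of terminals; this uses that the stored shortest paths are simple. -/

/-- Any two elements of `A` are joined by a walk of `G` that stays in `A`. -/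
def WalkConnected {V : Type} (G : SimpleGraph V) (A : Set V) : Prop :=
  ∀ u ∈ A, ∀ v ∈ A, ∃ p : G.Walk u v, ∀ y ∈ p.support, y ∈ A

namespace PlaneEmbedding

/-! ### Homology modulo two of a plane graph. -/

section Homology

set_option linter.unusedSectionVars false

variable {V : Type} {G : SimpleGraph V}

theorem exists_dart_edge (e : G.edgeSet) : ∃ d : G.Dart, d.edge = e := by
  obtain ⟨e, he⟩ := e
  induction e with
  | h u v => exact ⟨⟨(u, v), he⟩, rfl⟩

/-- A dart with a given edge. -/
noncomputable def dartOf (e : G.edgeSet) : G.Dart := (exists_dart_edge e).choose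

theorem dartOf_edge (e : G.edgeSet) : (dartOf e).edge = e := (exists_dart_edge e).choose_spec

/-- The edge chain of a dart chain. -/
noncomputable def edgeSum (G : SimpleGraph V) :
    (G.Dart → ZMod 2) →ₗ[ZMod 2] (G.edgeSet → ZMod 2) where
  toFun h e := h (dartOf e) + h (dartOf e).symm
  map_add' h h' := by ext e; simp only [Pi.add_apply]; ring
  map_smul' c h := by ext e; simp [mul_add]

theorem edgeSum_apply (h : G.Dart → ZMod 2) (d : G.Dart) :
    edgeSum G h ⟨d.edge, d.edge_mem⟩ = h d + h d.symm := by
  have := dartOf_edge ⟨d.edge, d.edge_mem⟩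
  rcases SimpleGraph.dart_edge_eq_iff _ _ |>.1 this with h1 | h1
  · simp [edgeSum, h1]
  · simp [edgeSum, h1, add_comm]

variable [Fintype V] [DecidableEq V] [Fintype G.Dart]

/-- The boundary of an edge chain. -/
noncomputable def boundary (G : SimpleGraph V) [Fintype G.Dart] :
    (G.edgeSet → ZMod 2) →ₗ[ZMod 2] (V → ZMod 2) where
  toFun g v := ∑ d : G.Dart with d.fst = v, g ⟨d.edge, d.edge_mem⟩
  map_add' g g' := by ext v; simp [Finset.sum_add_distrib]
  map_smul' c g := by ext v; simp [Finset.mul_sum]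

theorem boundary_edgeSum (h : G.Dart → ZMod 2) (v : V) :
    boundary G (edgeSum G h) v = ∑ d : G.Dart with d.fst = v, (h d + h d.symm) := by
  simp [boundary, edgeSum_apply]

theorem sum_symm (h : G.Dart → ZMod 2) (v : V) :
    ∑ d : G.Dart with d.fst = v, h d.symm = ∑ d : G.Dart with d.snd = v, h d :=
  Finset.sum_bij' (fun d _ => d.symm) (fun d _ => d.symm) (by simp) (by simp) (by simp) (by simp)
    (by simp)

/-- `facePerm` maps the darts that enter `v` bijectively to those that leave it. So the boundary at
`v` only sees how `h` changes from one dart of a face to the next, and a chain that is constant on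
faces has boundary zero. -/
theorem boundary_edgeSum_face (E : PlaneEmbedding G) (h : G.Dart → ZMod 2) (v : V) :
    boundary G (edgeSum G h) v =
      ∑ d : G.Dart with d.snd = v, (h (facePerm E.rot d) + h d) := by
  rw [boundary_edgeSum, Finset.sum_add_distrib, sum_symm, Finset.sum_add_distrib]
  congr 1
  rw [← sum_symm (fun d => h (facePerm E.rot d)) v]
  symm
  refine Finset.sum_bij' (fun d _ => E.rot d) (fun d _ => E.rot.symm d) ?_ ?_ (by simp) (by simp) ?_
  · intro d hd; simpa [E.rot_fst] using hd
  · intro d hd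
    have := E.rot_fst (E.rot.symm d)
    simp only [Equiv.apply_symm_apply] at this
    simpa [← this] using hd
  · intro d hd
    simp [facePerm]

theorem facePerm_fst (E : PlaneEmbedding G) (d : G.Dart) : (facePerm E.rot d).fst = d.snd := by
  simp [facePerm, E.rot_fst]

theorem rot_eq (E : PlaneEmbedding G) (d : G.Dart) : E.rot d = facePerm E.rot d.symm := by
  simp [facePerm]

theorem boundary_single [DecidableEq G.Dart] (d : G.Dart) :
    boundary G (edgeSum G (Pi.single d 1)) = Pi.single d.fst 1 + Pi.single d.snd 1 := by
  ext v
  rw [boundary_edgeSum, Finset.sum_add_distrib, sum_symm]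
  simp only [Pi.add_apply, Pi.single_apply]
  congr 1 <;> simp [eq_comm]

/-- The number of times that a walk uses a dart, modulo two. -/
noncomputable def walkChain [DecidableEq G.Dart] : {u v : V} → G.Walk u v → G.Dart → ZMod 2
  | _, _, .nil => 0
  | _, _, .cons h p => Pi.single ⟨(_, _), h⟩ 1 + walkChain p

theorem boundary_walkChain [DecidableEq G.Dart] {u v : V} (p : G.Walk u v) :
    boundary G (edgeSum G (walkChain p)) = Pi.single u 1 + Pi.single v 1 := by
  induction p with
  | nil =>
    ext x
    simp only [walkChain, map_zero, Pi.zero_apply, Pi.add_apply]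
    exact (CharTwo.add_self_eq_zero _).symm
  | @cons a b c h p ih =>
    rw [walkChain, map_add, map_add, ih, boundary_single]
    simp only
    rw [add_add_add_comm, add_comm, ← add_assoc]
    have : (Pi.single b 1 + Pi.single c 1 : V → ZMod 2) = Pi.single c 1 + Pi.single b 1 :=
      add_comm _ _
    ext x
    simp only [Pi.add_apply]
    have h2 := CharTwo.add_self_eq_zero ((Pi.single b 1 : V → ZMod 2) x)
    linear_combination h2

theorem walkChain_eq_zero [DecidableEq G.Dart] {u v : V} (p : G.Walk u v) (d : G.Dart)
    (hd : d.fst ∉ p.support ∨ d.snd ∉ p.support) : walkChain p d = 0 := by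
  induction p with
  | nil => simp [walkChain]
  | @cons a b c h p ih =>
    simp only [walkChain, Pi.add_apply, Pi.single_apply]
    rw [ih (by simp only [SimpleGraph.Walk.support_cons, List.mem_cons, not_or] at hd; tauto)]
    rw [if_neg, add_zero]
    rintro rfl
    simp at hd

/-- `rot` is transitive on the darts at a vertex, so by `h1` the value of `x` depends only on the
tail; by `h2` an edge inside `S` carries this value to its other end. The lemma serves twice: with
all vertices, for the kernel of `faceSum`, and with `S = B`, for noncrossing. -/
theorem propagate (E : PlaneEmbedding G) (x : G.Dart → ZMod 2) (S : Set V)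
    (h1 : ∀ d : G.Dart, d.fst ∈ S → x (E.rot d) = x d)
    (h2 : ∀ d : G.Dart, d.fst ∈ S → d.snd ∈ S → x d.symm = x d)
    {u v : V} (p : G.Walk u v) (hp : ∀ y ∈ p.support, y ∈ S) :
    ∀ d d' : G.Dart, d.fst = u → d'.fst = v → x d = x d' := by
  have key : ∀ d d' : G.Dart, d.fst ∈ S → d.fst = d'.fst → x d = x d' := by
    intro d d' hd hdd
    obtain ⟨n, rfl⟩ := (E.rot_cyclic d d' hdd).exists_nat_pow_eq
    clear hdd
    suffices (((E.rot ^ n) d).fst = d.fst) ∧ x d = x ((E.rot ^ n) d) from this.2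
    induction n with
    | zero => simp
    | succ n ih =>
      rw [pow_succ', Equiv.Perm.mul_apply, E.rot_fst]
      exact ⟨ih.1, by rw [h1 _ (by rw [ih.1]; exact hd)]; exact ih.2⟩
  induction p with
  | nil =>
    intro d d' hd hd'
    exact key d d' (by rw [hd]; exact hp _ (by simp)) (hd.trans hd'.symm)
  | @cons a b c h p ih =>
    intro d d' hd hd'
    have ha : a ∈ S := hp _ (by simp)
    have hb : b ∈ S := hp _ (by simp)
    rw [key d ⟨(a, b), h⟩ (by rw [hd]; exact ha) hd, ← h2 ⟨(a, b), h⟩ ha hb]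
    exact ih (fun y hy => hp _ (by simp [hy])) _ _ rfl hd'

/-- The set of faces. -/
abbrev Face (E : PlaneEmbedding G) : Type :=
  Quotient (Equiv.Perm.SameCycle.setoid (facePerm E.rot))

/-- The coboundary of a chain of faces. -/
noncomputable def faceSum (E : PlaneEmbedding G) :
    (E.Face → ZMod 2) →ₗ[ZMod 2] (G.edgeSet → ZMod 2) :=
  edgeSum G ∘ₗ LinearMap.funLeft (ZMod 2) (ZMod 2) (fun d => (⟦d⟧ : E.Face))

theorem face_facePerm (E : PlaneEmbedding G) (d : G.Dart) :
    (⟦facePerm E.rot d⟧ : E.Face) = ⟦d⟧ :=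
  Quotient.sound (Equiv.Perm.sameCycle_apply_left.2 Equiv.Perm.SameCycle.rfl)

theorem boundary_faceSum (E : PlaneEmbedding G) (f : E.Face → ZMod 2) :
    boundary G (E.faceSum f) = 0 := by
  ext v
  rw [faceSum, LinearMap.comp_apply, boundary_edgeSum_face E]
  simp [LinearMap.funLeft_apply, face_facePerm, CharTwo.add_self_eq_zero]

/-- A vanishing coboundary means equal values on the two sides of every edge. Turning around a
vertex only crosses edges, so in a connected graph all faces have the same value. -/
theorem ker_faceSum_le (E : PlaneEmbedding G) (hG : G.Connected) :
    LinearMap.ker E.faceSum ≤ Submodule.span (ZMod 2) {fun _ => 1} := by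
  intro f hf
  rw [LinearMap.mem_ker] at hf
  have h2 : ∀ d : G.Dart, f ⟦d.symm⟧ = f ⟦d⟧ := by
    intro d
    have := congrFun hf ⟨d.edge, d.edge_mem⟩
    rw [faceSum, LinearMap.comp_apply, edgeSum_apply] at this
    simp only [LinearMap.funLeft_apply, Pi.zero_apply] at this
    exact (CharTwo.add_eq_zero.1 this).symm
  have hc : ∀ d d' : G.Dart, f ⟦d⟧ = f ⟦d'⟧ := by
    intro d d'
    obtain ⟨p⟩ := hG.preconnected d.fst d'.fst
    refine propagate E (fun d => f ⟦d⟧) Set.univ ?_ (fun d _ _ => h2 d) p (by simp) d d' rfl rfl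
    intro d _
    rw [rot_eq, face_facePerm, h2]
  rw [Submodule.mem_span_singleton]
  by_cases hD : Nonempty G.Dart
  · obtain ⟨d⟩ := hD
    refine ⟨f ⟦d⟧, ?_⟩
    ext q
    induction q using Quotient.inductionOn with
    | h d' => simp [hc d' d]
  · refine ⟨0, ?_⟩
    ext q
    induction q using Quotient.inductionOn with
    | h d' => exact (hD ⟨d'⟩).elim

/-- The boundary of a path is the sum of its two ends. Hence the image of the boundary map together
with a single point mass spans all vertex chains. -/
theorem finrank_range_boundary (hG : G.Connected) :
    Fintype.card V ≤ Module.finrank (ZMod 2) (LinearMap.range (boundary G)) + 1 := by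
  classical
  obtain ⟨v₀⟩ := hG.nonempty
  have htop : LinearMap.range (boundary G) ⊔
      Submodule.span (ZMod 2) {(Pi.single v₀ 1 : V → ZMod 2)} = ⊤ := by
    rw [eq_top_iff, ← (Pi.basisFun (ZMod 2) V).span_eq, Submodule.span_le]
    rintro _ ⟨u, rfl⟩
    obtain ⟨p⟩ := hG.preconnected u v₀
    have h1 : (Pi.single u 1 + Pi.single v₀ 1 : V → ZMod 2) ∈ LinearMap.range (boundary G) :=
      ⟨_, boundary_walkChain p⟩
    have h2 := Submodule.add_mem_sup h1 (Submodule.mem_span_singleton_self (R := ZMod 2)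
      (Pi.single v₀ 1 : V → ZMod 2))
    rw [add_assoc, show (Pi.single v₀ 1 + Pi.single v₀ 1 : V → ZMod 2) = 0 from
      funext fun _ => CharTwo.add_self_eq_zero _, add_zero] at h2
    simpa using h2
  have h1 := Submodule.finrank_add_le_finrank_add_finrank (LinearMap.range (boundary G))
    (Submodule.span (ZMod 2) {(Pi.single v₀ 1 : V → ZMod 2)})
  rw [htop, finrank_top, Module.finrank_fintype_fun_eq_card] at h1
  have h2 := finrank_span_le_card (R := ZMod 2) {(Pi.single v₀ 1 : V → ZMod 2)}
  simp only [Set.toFinset_singleton, Finset.card_singleton] at h2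
  omega

/-- Exactness by counting dimensions, and the only use of Euler's formula. The image of `faceSum`
has dimension at least `|F| - 1`, the cycle space has dimension at most `|E| - |V| + 1`, and these
numbers agree. As the image consists of cycles, the two spaces coincide. -/
theorem ker_boundary_le (E : PlaneEmbedding G) (hG : G.Connected) (hD : Nonempty G.Dart) :
    LinearMap.ker (boundary G) ≤ LinearMap.range E.faceSum := by
  classical
  have : Finite G.edgeSet := Finite.of_surjective (fun d : G.Dart => ⟨d.edge, d.edge_mem⟩)
    fun e => by obtain ⟨d, hd⟩ := exists_dart_edge e; exact ⟨d, Subtype.ext hd⟩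
  have : Fintype G.edgeSet := Fintype.ofFinite _
  have : Finite E.Face := Quotient.finite _
  have : Fintype E.Face := Fintype.ofFinite _
  have hle : LinearMap.range E.faceSum ≤ LinearMap.ker (boundary G) := by
    rintro _ ⟨f, rfl⟩
    exact boundary_faceSum E f
  refine (Submodule.eq_of_le_of_finrank_le hle ?_).ge
  have h1 := LinearMap.finrank_range_add_finrank_ker E.faceSum
  have h2 := LinearMap.finrank_range_add_finrank_ker (boundary G)
  rw [Module.finrank_fintype_fun_eq_card] at h1 h2
  have h3 := finrank_range_boundary hG
  have h4 := (Submodule.finrank_mono (ker_faceSum_le E hG)).trans (finrank_span_le_card _)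
  simp only [Set.toFinset_singleton, Finset.card_singleton] at h4
  have h5 := E.euler hD
  rw [Nat.card_eq_fintype_card, Nat.card_eq_fintype_card, Nat.card_eq_fintype_card] at h5
  change _ + Fintype.card E.Face = _ at h5
  omega

end Homology

/-- Disjoint connected sets do not cross along the outer face. -/
theorem noncrossing {V : Type} [Fintype V] {G : SimpleGraph V} (E : PlaneEmbedding G)
    (hG : G.Connected) {W : List V} (hW : E.IsOuterWalk W) {A B : Set V}
    (hA : WalkConnected G A) (hB : WalkConnected G B) (hAB : Disjoint A B) {i₀ i₁ i₂ i₃ : ℕ}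
    (h01 : i₀ < i₁) (h12 : i₁ < i₂) (h23 : i₂ < i₃) {a b a' b' : V}
    (ha : W[i₀]? = some a) (hb : W[i₁]? = some b) (ha' : W[i₂]? = some a')
    (hb' : W[i₃]? = some b') (haA : a ∈ A) (hbB : b ∈ B) (haA' : a' ∈ A) (hbB' : b' ∈ B) :
    False := by
  classical
  have : Fintype G.Dart := Fintype.ofFinite _
  rcases hW with ⟨d₀, -, rfl⟩ | ⟨-, v, rfl⟩
  swap
  · rw [List.getElem?_eq_some_iff] at hb
    simp at hb; omega
  set φ := facePerm E.rot with hφ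
  set per := Function.minimalPeriod φ d₀ with hper
  have hget : ∀ i v, (List.map (fun e : G.Dart => e.fst) (List.iterate φ d₀ per))[i]? = some v →
      i < per ∧ (φ^[i] d₀).fst = v := by
    intro i v h
    rw [List.getElem?_eq_some_iff] at h
    obtain ⟨h1, h2⟩ := h
    simp at h1 h2
    exact ⟨h1, h2⟩
  obtain ⟨l0, e0⟩ := hget _ _ ha
  obtain ⟨l1, e1⟩ := hget _ _ hb
  obtain ⟨l2, e2⟩ := hget _ _ ha'
  obtain ⟨l3, e3⟩ := hget _ _ hb'
  have hinj : ∀ i j, i < per → j < per → φ^[i] d₀ = φ^[j] d₀ → i = j := fun i j hi hj h =>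
    (Function.iterate_eq_iterate_iff_of_lt_minimalPeriod hi hj).1 h
  obtain ⟨p, hp⟩ := hA a haA a' haA'
  obtain ⟨q, hq⟩ := hB b hbB b' hbB'
  -- The stretch of the outer walk from `a` to `a'`; together with the path `p` in `A` it closes up
  -- to a cycle.
  let x₀ : G.Dart → ZMod 2 := fun d => ∑ j ∈ Finset.Ico i₀ i₂, if d = φ^[j] d₀ then 1 else 0
  have hx₀ : ∀ d, x₀ (φ d) + x₀ d =
      (if φ d = φ^[i₀] d₀ then 1 else 0) + (if φ d = φ^[i₂] d₀ then 1 else 0) := by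
    intro d
    have h1 : x₀ d = ∑ j ∈ Finset.Ico i₀ i₂, if φ d = φ^[j + 1] d₀ then 1 else 0 := by
      refine Finset.sum_congr rfl fun j _ => ?_
      rw [Function.iterate_succ_apply']
      simp
    have h2 := Finset.sum_Ico_sub (fun j => if φ d = φ^[j] d₀ then (1 : ZMod 2) else 0)
      (h01.trans h12).le
    rw [Finset.sum_sub_distrib] at h2
    rw [h1]
    simp only [x₀, CharTwo.sub_eq_add] at h2 ⊢
    rw [add_comm, h2, add_comm]
  have hker : edgeSum G (walkChain p + x₀) ∈ LinearMap.ker (boundary G) := by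
    rw [LinearMap.mem_ker, map_add, map_add, boundary_walkChain]
    ext v
    rw [Pi.add_apply, boundary_edgeSum_face E]
    simp only [← hφ, hx₀, Finset.sum_add_distrib]
    have h3 : ∀ i, ∑ d : G.Dart with d.snd = v, (if φ d = φ^[i] d₀ then (1 : ZMod 2) else 0)
        = (Pi.single (φ^[i] d₀).fst 1 : V → ZMod 2) v := by
      intro i
      have h4 : ∀ d, (φ d = φ^[i] d₀) = (d = φ.symm (φ^[i] d₀)) := by
        intro d; rw [Equiv.eq_symm_apply]
      simp only [h4, Finset.sum_ite_eq', Finset.mem_filter, Finset.mem_univ, true_and]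
      rw [← facePerm_fst E, ← hφ, Equiv.apply_symm_apply, Pi.single_apply]
      simp [eq_comm]
    rw [h3, h3, e0, e2]
    exact CharTwo.add_self_eq_zero _
  obtain ⟨f, hf⟩ := ker_boundary_le E hG ⟨d₀⟩ hker
  -- The two-colouring of the darts. By `hf`, its edge chain equals that of `p` alone, so off `p`
  -- the two darts of an edge have the same colour.
  let x : G.Dart → ZMod 2 := fun d => x₀ d + f ⟦d⟧
  have hxs : ∀ d : G.Dart, d.fst ∈ B → x d.symm = x d := by
    intro d hd
    have h1 := congrFun hf ⟨d.edge, d.edge_mem⟩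
    rw [faceSum, LinearMap.comp_apply, edgeSum_apply, edgeSum_apply] at h1
    simp only [LinearMap.funLeft_apply, Pi.add_apply] at h1
    have hn : d.fst ∉ p.support := fun h => Set.disjoint_left.1 hAB (hp _ h) hd
    rw [walkChain_eq_zero p d (Or.inl hn), walkChain_eq_zero p d.symm (Or.inr hn)] at h1
    simp only [x]
    have h2 := CharTwo.add_self_eq_zero (x₀ d)
    have h3 := CharTwo.add_self_eq_zero (f ⟦d.symm⟧)
    linear_combination h3 - h1 - h2
  -- A rotation is a reversal followed by a step along a face. That step changes `x₀` only when it
  -- reaches the dart number `i₀` or `i₂` of the walk, and these start at `a` and `a'`, outside `B`.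
  have hxr : ∀ d : G.Dart, d.fst ∈ B → x (E.rot d) = x d := by
    intro d hd
    rw [← hxs d hd, rot_eq]
    have h1 := hx₀ d.symm
    rw [if_neg, if_neg] at h1
    · simp only [x, ← hφ]
      rw [face_facePerm]
      have h2 := CharTwo.add_self_eq_zero (x₀ d.symm)
      linear_combination h1 - h2
    · intro h
      rw [hφ, ← rot_eq] at h
      have := congrArg (fun d : G.Dart => d.fst) h
      simp only [E.rot_fst, ← hφ, e2] at this
      exact Set.disjoint_left.1 hAB haA' (this ▸ hd)
    · intro h
      rw [hφ, ← rot_eq] at h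
      have := congrArg (fun d : G.Dart => d.fst) h
      simp only [E.rot_fst, ← hφ, e0] at this
      exact Set.disjoint_left.1 hAB haA (this ▸ hd)
  have hend := propagate E x B hxr (fun d h _ => hxs d h) q hq _ _ e1 e3
  have hface : ∀ i, (⟦φ^[i] d₀⟧ : E.Face) = ⟦d₀⟧ := by
    intro i
    induction i with
    | zero => rfl
    | succ i ih => rw [Function.iterate_succ_apply', hφ, face_facePerm, ← hφ, ih]
  have hv : ∀ i, i < per → x₀ (φ^[i] d₀) = if i₀ ≤ i ∧ i < i₂ then 1 else 0 := by
    intro i hi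
    simp only [x₀]
    have h1 : ∀ j ∈ Finset.Ico i₀ i₂, (if φ^[i] d₀ = φ^[j] d₀ then (1 : ZMod 2) else 0)
        = if i = j then 1 else 0 := by
      intro j hj
      rw [Finset.mem_Ico] at hj
      congr 1
      exact propext ⟨hinj i j hi (by omega), fun h => by rw [h]⟩
    rw [Finset.sum_congr rfl h1]
    simp
  -- Both darts lie on the outer face, so `f` contributes equally and `x₀` alone decides: it is `1`
  -- at `i₁` and `0` at `i₃`.
  simp only [x, hface, hv _ l1, hv _ l3] at hend
  rw [if_pos ⟨h01.le, h12⟩, if_neg (by omega)] at hend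
  simp at hend

end PlaneEmbedding

/-! ### Trees and distances -/

section Trees

variable {V : Type} {G : SimpleGraph V}

/-- The length of a walk. -/
noncomputable def walkLength (w : Sym2 V → ℝ≥0) {u v : V} (p : G.Walk u v) : ℝ≥0 :=
  (p.edges.map w).sum

@[simp] theorem walkLength_nil (w : Sym2 V → ℝ≥0) (u : V) :
    walkLength w (SimpleGraph.Walk.nil : G.Walk u u) = 0 := by simp [walkLength]

@[simp] theorem walkLength_cons (w : Sym2 V → ℝ≥0) {u v x : V} (h : G.Adj u v) (p : G.Walk v x) :
    walkLength w (SimpleGraph.Walk.cons h p) = w s(u, v) + walkLength w p := by simp [walkLength]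

@[simp] theorem walkLength_append (w : Sym2 V → ℝ≥0) {u v x : V} (p : G.Walk u v)
    (q : G.Walk v x) : walkLength w (p.append q) = walkLength w p + walkLength w q := by
  simp [walkLength]

@[simp] theorem walkLength_reverse (w : Sym2 V → ℝ≥0) {u v : V} (p : G.Walk u v) :
    walkLength w p.reverse = walkLength w p := by
  simp [walkLength, List.sum_reverse]

/-- The distance with respect to edge lengths. -/
noncomputable def lengthDist (G : SimpleGraph V) (w : Sym2 V → ℝ≥0) (u v : V) : ℝ≥0∞ :=
  ⨅ p : G.Walk u v, (walkLength w p : ℝ≥0∞)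

theorem lengthDist_le (w : Sym2 V → ℝ≥0) {u v : V} (p : G.Walk u v) :
    lengthDist G w u v ≤ walkLength w p := iInf_le _ p

theorem lengthDist_self (w : Sym2 V → ℝ≥0) (u : V) : lengthDist G w u u = 0 := by
  have := lengthDist_le (G := G) w (SimpleGraph.Walk.nil : G.Walk u u)
  simpa using this

theorem lengthDist_comm (w : Sym2 V → ℝ≥0) (u v : V) :
    lengthDist G w u v = lengthDist G w v u := by
  have h : ∀ u v, lengthDist G w u v ≤ lengthDist G w v u := fun u v =>
    le_iInf fun p => (lengthDist_le w p.reverse).trans (by simp)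
  exact le_antisymm (h u v) (h v u)

theorem lengthDist_triangle (w : Sym2 V → ℝ≥0) (u v x : V) :
    lengthDist G w u x ≤ lengthDist G w u v + lengthDist G w v x := by
  refine ENNReal.le_iInf_add_iInf fun p q => (lengthDist_le w (p.append q)).trans ?_
  simp

theorem WalkConnected.union_adj {A B : Set V} (hA : WalkConnected G A) (hB : WalkConnected G B)
    {x y : V} (hx : x ∈ A) (hy : y ∈ B) (h : G.Adj x y) : WalkConnected G (A ∪ B) := by
  have key : ∀ u ∈ A, ∀ v ∈ B, ∃ p : G.Walk u v, ∀ z ∈ p.support, z ∈ A ∪ B := by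
    intro u hu v hv
    obtain ⟨p, hp⟩ := hA u hu x hx
    obtain ⟨q, hq⟩ := hB y hy v hv
    refine ⟨p.append (.cons h q), fun z hz => ?_⟩
    rw [SimpleGraph.Walk.mem_support_append_iff, SimpleGraph.Walk.support_cons,
      List.mem_cons] at hz
    rcases hz with hz | rfl | hz
    exacts [Or.inl (hp z hz), Or.inl hx, Or.inr (hq z hz)]
  rintro u (hu | hu) v (hv | hv)
  · obtain ⟨p, hp⟩ := hA u hu v hv
    exact ⟨p, fun z hz => Or.inl (hp z hz)⟩
  · exact key u hu v hv
  · obtain ⟨p, hp⟩ := key v hv u hu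
    exact ⟨p.reverse, fun z hz => hp z (by simpa using hz)⟩
  · obtain ⟨p, hp⟩ := hB u hu v hv
    exact ⟨p, fun z hz => Or.inr (hp z hz)⟩

theorem WalkConnected.singleton (v : V) : WalkConnected G {v} := by
  rintro u rfl v rfl
  exact ⟨.nil, by simp⟩

theorem WalkConnected.union {A B : Set V} (hA : WalkConnected G A) (hB : WalkConnected G B)
    {x : V} (hx : x ∈ A) (hx' : x ∈ B) : WalkConnected G (A ∪ B) := by
  have key : ∀ u ∈ A, ∀ v ∈ B, ∃ p : G.Walk u v, ∀ z ∈ p.support, z ∈ A ∪ B := by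
    intro u hu v hv
    obtain ⟨p, hp⟩ := hA u hu x hx
    obtain ⟨q, hq⟩ := hB x hx' v hv
    refine ⟨p.append q, fun z hz => ?_⟩
    rw [SimpleGraph.Walk.mem_support_append_iff] at hz
    exact hz.imp (hp z) (hq z)
  rintro u (hu | hu) v (hv | hv)
  · obtain ⟨p, hp⟩ := hA u hu v hv
    exact ⟨p, fun z hz => Or.inl (hp z hz)⟩
  · exact key u hu v hv
  · obtain ⟨p, hp⟩ := key v hv u hu
    exact ⟨p.reverse, fun z hz => hp z (by simpa using hz)⟩
  · obtain ⟨p, hp⟩ := hB u hu v hv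
    exact ⟨p, fun z hz => Or.inr (hp z hz)⟩

variable [DecidableEq V]

/-- `X` is the vertex set of a tree of length `c` in `G`. -/
inductive SpansTree (G : SimpleGraph V) (w : Sym2 V → ℝ≥0) : Finset V → ℝ≥0 → Prop
  | single (v : V) : SpansTree G w {v} 0
  | graft {X Y : Finset V} {c c' : ℝ≥0} {x y : V} : SpansTree G w X c → SpansTree G w Y c' →
      Disjoint X Y → x ∈ X → y ∈ Y → G.Adj x y → SpansTree G w (X ∪ Y) (c + w s(x, y) + c')

namespace SpansTree

variable {w : Sym2 V → ℝ≥0} {X : Finset V} {c : ℝ≥0}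

theorem walkConnected (h : SpansTree G w X c) : WalkConnected G (X : Set V) := by
  induction h with
  | single v => rw [Finset.coe_singleton]; exact .singleton v
  | graft _ _ _ hx hy hxy ih ih' =>
    rw [Finset.coe_union]
    exact ih.union_adj ih' (Finset.mem_coe.2 hx) (Finset.mem_coe.2 hy) hxy

theorem exists_walk (h : SpansTree G w X c) :
    ∀ u ∈ X, ∀ v ∈ X, ∃ p : G.Walk u v, walkLength w p ≤ c := by
  induction h with
  | single v =>
    intro u hu v' hv
    rw [Finset.mem_singleton] at hu hv
    subst hu; subst hv
    exact ⟨.nil, by simp⟩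
  | @graft X Y c c' x y _ _ _ hx hy hxy ih ih' =>
    have key : ∀ u ∈ X, ∀ v ∈ Y, ∃ p : G.Walk u v, walkLength w p ≤ c + w s(x, y) + c' := by
      intro u hu v hv
      obtain ⟨p, hp⟩ := ih u hu x hx
      obtain ⟨q, hq⟩ := ih' y hy v hv
      refine ⟨p.append (.cons hxy q), ?_⟩
      rw [walkLength_append, walkLength_cons, ← add_assoc]
      gcongr
    intro u hu v hv
    rcases Finset.mem_union.1 hu with hu | hu <;> rcases Finset.mem_union.1 hv with hv | hv
    · obtain ⟨p, hp⟩ := ih u hu v hv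
      exact ⟨p, hp.trans (by rw [add_assoc]; exact le_self_add)⟩
    · exact key u hu v hv
    · obtain ⟨p, hp⟩ := key v hv u hu
      exact ⟨p.reverse, by simpa using hp⟩
    · obtain ⟨p, hp⟩ := ih' u hu v hv
      exact ⟨p, hp.trans le_add_self⟩

theorem lengthDist_le (h : SpansTree G w X c) {u v : V} (hu : u ∈ X) (hv : v ∈ X) :
    lengthDist G w u v ≤ c := by
  obtain ⟨p, hp⟩ := h.exists_walk u hu v hv
  exact (_root_.lengthDist_le w p).trans (by exact_mod_cast hp)

/-- A tree splits at an edge incident to `v` into a part with `v` and a part with `a`. -/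
theorem exists_split (h : SpansTree G w X c) :
    ∀ v ∈ X, ∀ a ∈ X, a ≠ v → ∃ X₀ Y : Finset V, ∃ c₀ c₁ : ℝ≥0, ∃ u : V, X = X₀ ∪ Y ∧
      Disjoint X₀ Y ∧ v ∈ X₀ ∧ a ∈ Y ∧ u ∈ Y ∧ G.Adj v u ∧ SpansTree G w X₀ c₀ ∧
      SpansTree G w Y c₁ ∧ c = c₀ + w s(v, u) + c₁ := by
  induction h with
  | single x =>
    intro v hv a ha hav
    rw [Finset.mem_singleton] at hv ha
    exact (hav (ha.trans hv.symm)).elim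
  | @graft X Y c c' x y hX hY hd hx hy hxy ih ih' =>
    -- the part that contains `v` comes first
    have key : ∀ (X Y : Finset V) (c c' : ℝ≥0) (x y : V), SpansTree G w X c → SpansTree G w Y c' →
        Disjoint X Y → x ∈ X → y ∈ Y → G.Adj x y →
        (∀ v ∈ X, ∀ a ∈ X, a ≠ v → ∃ X₀ Y : Finset V, ∃ c₀ c₁ : ℝ≥0, ∃ u : V, X = X₀ ∪ Y ∧
          Disjoint X₀ Y ∧ v ∈ X₀ ∧ a ∈ Y ∧ u ∈ Y ∧ G.Adj v u ∧ SpansTree G w X₀ c₀ ∧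
          SpansTree G w Y c₁ ∧ c = c₀ + w s(v, u) + c₁) →
        ∀ v ∈ X, ∀ a ∈ X ∪ Y, a ≠ v → ∃ X₀ Y' : Finset V, ∃ c₀ c₁ : ℝ≥0, ∃ u : V,
          X ∪ Y = X₀ ∪ Y' ∧
          Disjoint X₀ Y' ∧ v ∈ X₀ ∧ a ∈ Y' ∧ u ∈ Y' ∧ G.Adj v u ∧ SpansTree G w X₀ c₀ ∧
          SpansTree G w Y' c₁ ∧ c + w s(x, y) + c' = c₀ + w s(v, u) + c₁ := by
      intro X Y c c' x y hX hY hd hx hy hxy ih v hv a ha hav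
      -- Split `X` alone, with `b = a`, or with `b` the attachment vertex `x` if `a` lies in `Y`.
      -- Then hang `Y` back on whichever half contains `x`.
      have graftY : ∀ b ∈ X, b ≠ v → (a = b ∨ a ∈ Y ∧ b = x) → ∃ X₀ Y' : Finset V,
          ∃ c₀ c₁ : ℝ≥0, ∃ u : V, X ∪ Y = X₀ ∪ Y' ∧
          Disjoint X₀ Y' ∧ v ∈ X₀ ∧ a ∈ Y' ∧ u ∈ Y' ∧ G.Adj v u ∧ SpansTree G w X₀ c₀ ∧
          SpansTree G w Y' c₁ ∧ c + w s(x, y) + c' = c₀ + w s(v, u) + c₁ := by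
        intro b hb hbv hab
        obtain ⟨P, Q, c₀, c₁, u, rfl, hPQ, hvP, hbQ, huQ, hvu, hP, hQ, rfl⟩ := ih v hv b hb hbv
        rw [Finset.disjoint_union_left] at hd
        by_cases hxQ : x ∈ Q
        · refine ⟨P, Q ∪ Y, c₀, c₁ + w s(x, y) + c', u, by rw [Finset.union_assoc], ?_, hvP, ?_,
            Finset.mem_union_left _ huQ, hvu, hP, .graft hQ hY hd.2 hxQ hy hxy, by ring⟩
          · exact Finset.disjoint_union_right.2 ⟨hPQ, hd.1⟩
          · rcases hab with rfl | hab
            exacts [Finset.mem_union_left _ hbQ, Finset.mem_union_right _ hab.1]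
        · have hxP : x ∈ P := (Finset.mem_union.1 hx).resolve_right hxQ
          have hab' : a = b := hab.resolve_right fun h => hxQ (h.2 ▸ hbQ)
          refine ⟨P ∪ Y, Q, c₀ + w s(x, y) + c', c₁, u, by
            rw [Finset.union_assoc, Finset.union_assoc, Finset.union_comm Q], ?_,
            Finset.mem_union_left _ hvP, hab' ▸ hbQ, huQ, hvu, .graft hP hY hd.1 hxP hy hxy, hQ,
            by ring⟩
          exact Finset.disjoint_union_left.2 ⟨hPQ, hd.2.symm⟩
      rcases Finset.mem_union.1 ha with ha | ha
      · exact graftY a ha hav (Or.inl rfl)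
      -- If `v` is itself the attachment vertex, then the grafting edge is the one to cut.
      · by_cases hxv : x = v
        · subst hxv
          exact ⟨X, Y, c, c', y, rfl, hd, hv, ha, hy, hxy, hX, hY, rfl⟩
        · exact graftY x hx hxv (Or.inr ⟨ha, rfl⟩)
    intro v hv a ha hav
    rcases Finset.mem_union.1 hv with hv | hv
    · exact key X Y c c' x y hX hY hd hx hy hxy ih v hv a ha hav
    · obtain ⟨P, Q, c₀, c₁, u, h1, h2, h3, h4, h5, h6, h7, h8, h9⟩ :=
        key Y X c' c y x hY hX hd.symm hy hx hxy.symm ih' v hv a (by rwa [Finset.union_comm]) hav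
      refine ⟨P, Q, c₀, c₁, u, by rw [Finset.union_comm, h1], h2, h3, h4, h5, h6, h7, h8, ?_⟩
      rw [← h9, Sym2.eq_swap]; ring

end SpansTree

/-- A connected subgraph contains a spanning tree that is not longer. -/
theorem exists_spansTree [Fintype V] (w : Sym2 V → ℝ≥0) (T : G.Subgraph) (hT : T.Connected) :
    ∃ X c, SpansTree G w X c ∧ T.verts ⊆ X ∧ c ≤ subgraphLength w T := by
  classical
  -- Only edges of `T` with both ends in `X` pay for the tree. An edge of `T` that leaves `X` is
  -- then still unspent and pays for its own addition, so a maximal good set has to contain all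
  -- vertices of `T`.
  let good : Finset V → Prop := fun X => ↑X ⊆ T.verts ∧ ∃ c, SpansTree G w X c ∧
    c ≤ ∑ e : Sym2 V with e ∈ T.edgeSet ∧ (∀ v ∈ e, v ∈ X), w e
  obtain ⟨v₀, hv₀⟩ := hT.nonempty
  have h0 : good {v₀} := ⟨by simpa using hv₀, 0, .single v₀, zero_le⟩
  obtain ⟨X, hX, hmax⟩ := (Finset.univ.filter good).exists_max_image Finset.card
    ⟨{v₀}, by simp [h0]⟩
  simp only [Finset.mem_filter, Finset.mem_univ, true_and] at hX hmax
  obtain ⟨hXT, c, hc, hcle⟩ := hX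
  refine ⟨X, c, hc, ?_, hcle.trans ?_⟩
  · by_contra hne
    obtain ⟨z, hz, hzX⟩ := Set.not_subset.1 hne
    have hXne : X.Nonempty := by
      rw [Finset.nonempty_iff_ne_empty]
      rintro rfl
      have := hmax _ h0
      simp at this
    obtain ⟨x₀, hx₀⟩ := hXne
    obtain ⟨p⟩ := hT.coe.preconnected ⟨x₀, hXT hx₀⟩ ⟨z, hz⟩
    obtain ⟨d, hd, hd1, hd2⟩ := p.exists_boundary_dart {x | (x : V) ∈ X} hx₀ hzX
    have hadj : T.Adj d.fst d.snd := d.adj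
    set x : V := (d.fst : V)
    set y : V := (d.snd : V)
    have hd1' : x ∈ X := hd1
    have hd2' : y ∉ X := hd2
    have : good (X ∪ {y}) := by
      refine ⟨?_, _, .graft hc (.single y) (by simpa using hd2') hd1' (by simp) hadj.adj_sub, ?_⟩
      · rw [Finset.coe_union, Finset.coe_singleton]
        exact Set.union_subset hXT (by simpa using hadj.snd_mem)
      · rw [add_zero]
        have hsub : insert s(x, y) (Finset.univ.filter fun e : Sym2 V =>
            e ∈ T.edgeSet ∧ (∀ v ∈ e, v ∈ X)) ⊆
            Finset.univ.filter fun e : Sym2 V => e ∈ T.edgeSet ∧ (∀ v ∈ e, v ∈ X ∪ {y}) := by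
          intro e he
          rw [Finset.mem_insert] at he
          rcases he with rfl | he
          · simp [hadj, hd1']
          · simp only [Finset.mem_filter, Finset.mem_univ, true_and] at he ⊢
            exact ⟨he.1, fun v hv => Finset.mem_union_left _ (he.2 v hv)⟩
        refine le_trans ?_ (Finset.sum_le_sum_of_subset hsub)
        rw [Finset.sum_insert, add_comm]
        · gcongr
        · simp [hd2']
    have h1 := hmax _ this
    rw [Finset.card_union_of_disjoint (by simpa using hd2')] at h1
    simp at h1
  · unfold subgraphLength
    refine Finset.sum_le_sum_of_subset fun e he => ?_
    simp only [Finset.mem_filter, Finset.mem_univ, true_and] at he ⊢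
    exact he.1

end Trees

theorem subgraphLength_sup_le {V : Type} [Fintype V] {G : SimpleGraph V} (w : Sym2 V → ℝ≥0)
    (T T' : G.Subgraph) :
    subgraphLength w (T ⊔ T') ≤ subgraphLength w T + subgraphLength w T' := by
  classical
  unfold subgraphLength
  rw [← Finset.sum_union_inter]
  refine le_trans (Finset.sum_le_sum_of_subset ?_) le_self_add
  intro e he
  simpa [SimpleGraph.Subgraph.edgeSet_sup] using he

/-! ### Intervals of terminals and the values that the tables should hold -/

namespace SteinerDP

section Intervals

variable {V : Type}

/-- The terminals of `S` selected by a mask. -/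
def maskSet (S : List V) (L : ℕ) : Set V := {v | ∃ i, S[i]? = some v ∧ L.testBit i = true}

/-- The terminals in an interval of the cyclic sequence `K`. -/
def ivalSet (K : List V) (I : ℕ × ℕ) : Set V :=
  {v | ∃ i < I.2, K[(I.1 + i) % K.length]? = some v}

theorem ivalSet_subset (K : List V) (I : ℕ × ℕ) {v : V} (h : v ∈ ivalSet K I) : v ∈ K := by
  obtain ⟨i, -, hi⟩ := h
  exact List.mem_of_getElem? hi

theorem maskSet_subset (S : List V) (L : ℕ) {v : V} (h : v ∈ maskSet S L) : v ∈ S := by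
  obtain ⟨i, hi, -⟩ := h
  exact List.mem_of_getElem? hi

theorem exists_mod_eq {k p : ℕ} (a : ℕ) (hp : p < k) : ∃ i < k, (a + i) % k = p := by
  have hk : 0 < k := by omega
  have ha := Nat.mod_lt a hk
  refine ⟨(p + (k - a % k)) % k, Nat.mod_lt _ hk, ?_⟩
  rw [Nat.add_mod_mod, show a + (p + (k - a % k)) = p + k + (a - a % k) by
    have := Nat.mod_le a k; omega]
  obtain ⟨q, hq⟩ : k ∣ a - a % k := Nat.dvd_sub_mod a
  rw [hq, Nat.add_mul_mod_self_left, Nat.add_mod_right, Nat.mod_eq_of_lt hp]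

theorem ivalSet_length (K : List V) (a : ℕ) : ivalSet K (a, K.length) = {v | v ∈ K} := by
  ext v
  refine ⟨ivalSet_subset K _, fun hv => ?_⟩
  obtain ⟨p, hp, hpv⟩ := List.mem_iff_getElem.1 hv
  obtain ⟨i, hi, hip⟩ := exists_mod_eq a hp
  exact ⟨i, hi, by simp [hip, hpv, hp]⟩

theorem ivalSet_zero (K : List V) (a : ℕ) : ivalSet K (a, 0) = ∅ := by
  ext v; simp [ivalSet]

theorem ivalSet_ival (K : List V) {a l : ℕ} (hl : l ≤ K.length) :
    ivalSet K (ival K.length a l) = ivalSet K (a, l) := by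
  unfold ival
  split_ifs with h
  · rcases h with rfl | rfl
    · rw [ivalSet_zero, ivalSet_zero]
    · rw [ivalSet_length, ivalSet_length]
  · simp [ivalSet]

theorem ivalSet_add (K : List V) (a x y : ℕ) :
    ivalSet K (a, x + y) = ivalSet K (a, x) ∪ ivalSet K (a + x, y) := by
  ext v
  simp only [ivalSet, Set.mem_ofPred_eq, Set.mem_union]
  constructor
  · rintro ⟨i, hi, h⟩
    by_cases hix : i < x
    · exact Or.inl ⟨i, hix, h⟩
    · exact Or.inr ⟨i - x, by omega, by rw [← h]; congr 2; omega⟩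
  · rintro (⟨i, hi, h⟩ | ⟨i, hi, h⟩)
    · exact ⟨i, by omega, h⟩
    · exact ⟨x + i, by omega, by rw [← h]; congr 2; omega⟩

/-- Intervals in normal form. -/
def ValidIval (k : ℕ) (I : ℕ × ℕ) : Prop :=
  I.2 ≤ k ∧ (I.2 = 0 ∨ I.2 = k → I.1 = 0) ∧ (I.1 = 0 ∨ I.1 < k)

theorem validIval_ival {k a l : ℕ} (hl : l ≤ k) : ValidIval k (ival k a l) := by
  unfold ival ValidIval
  split_ifs with h
  · exact ⟨hl, fun _ => rfl, Or.inl rfl⟩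
  · exact ⟨hl, fun h' => (h h').elim, Or.inr (Nat.mod_lt _ (by omega))⟩

theorem ival_snd (k a l : ℕ) : (ival k a l).2 = l := by
  unfold ival; split_ifs <;> rfl

theorem ValidIval.ival_eq {k : ℕ} {I : ℕ × ℕ} (h : ValidIval k I) : ival k I.1 I.2 = I := by
  obtain ⟨h1, h2, h3⟩ := h
  unfold ival
  split_ifs with h
  · rw [← h2 h]
  · rw [Nat.mod_eq_of_lt (by omega)]

/-- The positions where the listing of an interval may begin list the interval. -/
theorem ivalSet_origin (K : List V) {I : ℕ × ℕ} {o : ℕ}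
    (ho : o ∈ origins K.length I) : ivalSet K (o, I.2) = ivalSet K I := by
  unfold origins at ho
  split_ifs at ho with h
  · obtain ⟨a, l⟩ := I
    obtain ⟨h1, rfl⟩ := h
    rw [ivalSet_length, ivalSet_length]
  · rw [List.mem_singleton] at ho
    rw [ho]

/-- `M` is a submask of `L`. -/
def Submask (M L : ℕ) : Prop := ∀ i, M.testBit i = true → L.testBit i = true

theorem exists_submask (L : ℕ) (p : ℕ → Prop) :
    ∃ M : ℕ, ∀ i, M.testBit i = true ↔ L.testBit i = true ∧ p i := by
  classical
  -- A set bit `i` of `L` satisfies `i < 2 ^ i ≤ L`, so `L` bits are enough.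
  refine ⟨Nat.ofBits (n := L) fun i => decide (L.testBit i ∧ p i), fun i => ?_⟩
  rw [Nat.testBit_ofBits]
  split_ifs with h
  · simp
  · simp only [false_iff, not_and]
    intro h1
    have := Nat.ge_two_pow_of_testBit h1
    have := Nat.lt_two_pow_self (n := i)
    omega

/-- For a submask, `^^^` is set difference. -/
theorem maskSet_xor (S : List V) {M L : ℕ} (h : Submask M L) :
    maskSet S L = maskSet S M ∪ maskSet S (L ^^^ M) := by
  ext v
  simp only [maskSet, Set.mem_ofPred_eq, Set.mem_union, Nat.testBit_xor]
  constructor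
  · rintro ⟨i, hi, hL⟩
    cases hM : M.testBit i
    · exact Or.inr ⟨i, hi, by simp [hL, hM]⟩
    · exact Or.inl ⟨i, hi, hM⟩
  · rintro (⟨i, hi, hM⟩ | ⟨i, hi, hM⟩)
    · exact ⟨i, hi, h i hM⟩
    · refine ⟨i, hi, ?_⟩
      have := h i
      cases hL : L.testBit i <;> cases hM' : M.testBit i <;> simp_all

end Intervals

/-! ### Noncrossing in the cyclic order of the outer terminals. -/

section Noncrossing

variable {V : Type} {G : SimpleGraph V}

/-- Disjoint connected sets do not cross in the sequence `K`. -/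
def Noncrossing (G : SimpleGraph V) (K : List V) : Prop :=
  ∀ A B : Set V, WalkConnected G A → WalkConnected G B → Disjoint A B →
    ∀ i₀ i₁ i₂ i₃ : ℕ, i₀ < i₁ → i₁ < i₂ → i₂ < i₃ → ∀ a b a' b' : V,
    K[i₀]? = some a → K[i₁]? = some b → K[i₂]? = some a' → K[i₃]? = some b' →
    a ∈ A → b ∈ B → a' ∈ A → b' ∈ B → False

theorem noncrossing_of_sublist [Fintype V] (E : PlaneEmbedding G) (hG : G.Connected)
    {W K : List V} (hW : E.IsOuterWalk W) (hK : K.Sublist W) : Noncrossing G K := by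
  obtain ⟨f, hf⟩ := List.sublist_iff_exists_orderEmbedding_getElem?_eq.1 hK
  intro A B hA hB hAB i₀ i₁ i₂ i₃ h01 h12 h23 a b a' b' ha hb ha' hb' haA hbB haA' hbB'
  rw [hf] at ha hb ha' hb'
  exact E.noncrossing hG hW hA hB hAB (f.lt_iff_lt.2 h01) (f.lt_iff_lt.2 h12)
    (f.lt_iff_lt.2 h23) ha hb ha' hb' haA hbB haA' hbB'

/-- The alternating pattern survives rotation, up to exchanging the roles of `A` and `B`. The cases
are how many of the four positions wrap around the end of `K`. -/
theorem Noncrossing.cyclic {K : List V} (h : Noncrossing G K) {A B : Set V}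
    (hA : WalkConnected G A) (hB : WalkConnected G B) (hAB : Disjoint A B) {o j₀ j₁ j₂ j₃ : ℕ}
    (h01 : j₀ < j₁) (h12 : j₁ < j₂) (h23 : j₂ < j₃) (h3 : j₃ < K.length) {a b a' b' : V}
    (ha : K[(o + j₀) % K.length]? = some a) (hb : K[(o + j₁) % K.length]? = some b)
    (ha' : K[(o + j₂) % K.length]? = some a') (hb' : K[(o + j₃) % K.length]? = some b')
    (haA : a ∈ A) (hbB : b ∈ B) (haA' : a' ∈ A) (hbB' : b' ∈ B) : False := by
  wlog ho : o < K.length generalizing o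
  · refine this (o := o % K.length) ?_ ?_ ?_ ?_ (Nat.mod_lt _ (by omega)) <;>
      rwa [Nat.mod_add_mod]
  have hmod : ∀ j, j < K.length → (o + j) % K.length = if o + j < K.length then o + j
      else o + j - K.length := by
    intro j hj
    split_ifs with h
    · exact Nat.mod_eq_of_lt h
    · rw [Nat.mod_eq_sub_mod (by omega), Nat.mod_eq_of_lt (by omega)]
  rw [hmod _ (by omega)] at ha hb ha' hb'
  by_cases c3 : o + j₃ < K.length
  · rw [if_pos (by omega)] at ha hb ha' hb'
    exact h A B hA hB hAB _ _ _ _ (by omega) (by omega) (by omega) a b a' b' ha hb ha' hb'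
      haA hbB haA' hbB'
  rw [if_neg c3] at hb'
  by_cases c2 : o + j₂ < K.length
  · rw [if_pos (by omega)] at ha hb ha'
    exact h B A hB hA hAB.symm _ _ _ _ (by omega) (by omega) (by omega) b' a b a' hb' ha hb ha'
      hbB' haA hbB haA'
  rw [if_neg c2] at ha'
  by_cases c1 : o + j₁ < K.length
  · rw [if_pos (by omega)] at ha hb
    exact h A B hA hB hAB _ _ _ _ (by omega) (by omega) (by omega) a' b' a b ha' hb' ha hb
      haA' hbB' haA hbB
  rw [if_neg c1] at hb
  by_cases c0 : o + j₀ < K.length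
  · rw [if_pos (by omega)] at ha
    exact h B A hB hA hAB.symm _ _ _ _ (by omega) (by omega) (by omega) b a' b' a hb ha' hb' ha
      hbB haA' hbB' haA
  rw [if_neg c0] at ha
  exact h A B hA hB hAB _ _ _ _ (by omega) (by omega) (by omega) a b a' b' ha hb ha' hb'
    haA hbB haA' hbB'

/-- The listing starts in `Y` at `b`. If it met `Y` again after a terminal `z` of `A`, then `b`,
`z`, this later terminal and `t` would alternate between `Y` and `A`. So the terminals of `Y` come
first, and `x` is the position of the first terminal outside `Y`. -/
theorem Noncrossing.exists_prefix {K : List V} (h : Noncrossing G K) {A Y : Set V}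
    (hA : WalkConnected G A) (hY : WalkConnected G Y) (hAY : Disjoint A Y) {o l j : ℕ}
    (hlj : l ≤ j + 1) (hj : j < K.length) {t : V}
    (ht : K[(o + j) % K.length]? = some t) (htA : t ∈ A) {b : V}
    (hb : K[o % K.length]? = some b) (hbY : b ∈ Y)
    (hAl : ∀ v ∈ ivalSet K (o, l), v ∈ A ∪ Y) :
    ∃ x ≤ l, ivalSet K (o, x) = ivalSet K (o, l) ∩ Y ∧
      ivalSet K (o + x, l - x) = ivalSet K (o, l) \ Y := by
  classical
  have hsome : ∀ i, ∃ v, K[(o + i) % K.length]? = some v := fun i =>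
    ⟨_, List.getElem?_eq_getElem (Nat.mod_lt _ (by omega))⟩
  have key : ∃ x ≤ l, (∀ i < x, ∀ v, K[(o + i) % K.length]? = some v → v ∈ Y) ∧
      ∀ i, x ≤ i → i < l → ∀ v, K[(o + i) % K.length]? = some v → v ∉ Y := by
    by_cases hex : ∃ i, i < l ∧ ∃ v, K[(o + i) % K.length]? = some v ∧ v ∉ Y
    · refine ⟨Nat.find hex, (Nat.find_spec hex).1.le, ?_, ?_⟩
      · intro i hi v hv
        by_contra hvY
        exact Nat.find_min hex hi ⟨hi.trans (Nat.find_spec hex).1, v, hv, hvY⟩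
      · obtain ⟨hxl, z, hz, hzY⟩ := Nat.find_spec hex
        have hzA : z ∈ A := (hAl z ⟨_, hxl, hz⟩).resolve_right hzY
        set x := Nat.find hex
        intro i hxi hil v hv hvY
        have hx0 : 0 < x := by
          rw [Nat.pos_iff_ne_zero]
          intro h0
          rw [h0, Nat.add_zero, hb] at hz
          exact hzY (Option.some.inj hz ▸ hbY)
        have hxi' : x ≠ i := by
          rintro h'
          rw [h', hv] at hz
          exact hzY (Option.some.inj hz ▸ hvY)
        -- The position of `t` may be the last one of the interval, `j = l - 1`, so `i < l` alone
        -- does not give `i < j`.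
        have hij : i ≠ j := by
          rintro rfl
          rw [hv] at ht
          exact Set.disjoint_left.1 hAY htA (Option.some.inj ht ▸ hvY)
        exact h.cyclic hY hA hAY.symm (j₀ := 0) (j₁ := x) (j₂ := i) (j₃ := j) hx0 (by omega)
          (by omega) hj hb hz hv ht hbY hzA hvY htA
    · push Not at hex
      exact ⟨l, le_rfl, fun i hi v hv => hex i hi v hv, fun i h1 h2 => by omega⟩
  obtain ⟨x, hx, h1, h2⟩ := key
  refine ⟨x, hx, ?_, ?_⟩
  · ext v
    constructor
    · rintro ⟨i, hi, hv⟩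
      exact ⟨⟨i, lt_of_lt_of_le hi hx, hv⟩, h1 i hi v hv⟩
    · rintro ⟨⟨i, hi, hv⟩, hvY⟩
      by_cases hix : i < x
      · exact ⟨i, hix, hv⟩
      · exact (h2 i (by omega) hi v hv hvY).elim
  · ext v
    constructor
    · rintro ⟨i, hi, hv⟩
      rw [Nat.add_assoc] at hv
      exact ⟨⟨x + i, by simp only at hi ⊢; omega, hv⟩,
        h2 (x + i) (by omega) (by simp only at hi ⊢; omega) v hv⟩
    · rintro ⟨⟨i, hi, hv⟩, hvY⟩
      by_cases hix : i < x
      · exact (hvY (h1 i hix v hv)).elim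
      · refine ⟨i - x, by simp only at hi ⊢; omega, ?_⟩
        rw [← hv]; congr 2; simp only; omega

end Noncrossing

/-! ### Anchored trees and the values to be reached. -/

section Values

variable {V : Type} [DecidableEq V] {G : SimpleGraph V}

/-- The tree `X` with root `v` meets the terminals of `K` in nothing, in all of them, or its root is
connected outside of the tree to a terminal that is not in `A`. -/
def Anchored (G : SimpleGraph V) (K : List V) (v : V) (X : Finset V) (A : Set V) : Prop :=
  A = ∅ ∨ (∀ t ∈ K, t ∈ A) ∨ ∃ (O : Set V) (t : V), WalkConnected G O ∧ v ∈ O ∧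
    (∀ y ∈ O, y ∈ X → y = v) ∧ t ∈ O ∧ t ∈ K ∧ t ∉ A

/-- Seen from `u`, everything behind the edge `vu` lies outside the branch: `X₀` together with the
old connection `O`, if there is one. Either this reaches a terminal not in `Y`, or all of `K` is in
the branch. -/
theorem Anchored.branch {K : List V} {v u : V} {X₀ Y : Finset V} {A : Set V}
    (h : Anchored G K v (X₀ ∪ Y) A) (hX₀ : WalkConnected G (X₀ : Set V)) (hd : Disjoint X₀ Y)
    (hv : v ∈ X₀) (hvu : G.Adj v u) (hA : A ⊆ ↑(X₀ ∪ Y)) :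
    Anchored G K u Y (A ∩ Y) := by
  have hXu : WalkConnected G ((X₀ : Set V) ∪ {u}) :=
    hX₀.union_adj (.singleton u) (Finset.mem_coe.2 hv) rfl hvu
  have hd' : ∀ y ∈ X₀, y ∈ Y → False := fun y h1 h2 => Finset.disjoint_left.1 hd h1 h2
  rcases h with rfl | h | ⟨O, t, hO, hvO, hOX, htO, htK, htA⟩
  · exact Or.inl (Set.empty_inter _)
  · by_cases hall : ∀ t ∈ K, t ∈ Y
    · exact Or.inr (Or.inl fun t ht => ⟨h t ht, hall t ht⟩)
    · push Not at hall
      obtain ⟨t, htK, htY⟩ := hall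
      have htX : t ∈ X₀ := (Finset.mem_union.1 (Finset.mem_coe.1 (hA (h t htK)))).resolve_right htY
      refine Or.inr (Or.inr ⟨_, t, hXu, Or.inr rfl, ?_, Or.inl htX, htK, fun h => htY h.2⟩)
      rintro y (hy | hy) hyY
      exacts [(hd' y hy hyY).elim, hy]
  · refine Or.inr (Or.inr ⟨O ∪ (X₀ ∪ {u}), t, hO.union hXu hvO (Or.inl hv), Or.inr (Or.inr rfl),
      ?_, Or.inl htO, htK, fun h => htA h.1⟩)
    rintro y (hy | hy | hy) hyY
    · have := hOX y hy (Finset.mem_union_right _ hyY)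
      subst this
      exact (hd' _ hv hyY).elim
    · exact (hd' y hy hyY).elim
    · exact hy

/-- A terminal lost to the branch can be reached from `v` through the branch, which now lies outside
the tree. An old connection `O` still works for the smaller tree. -/
theorem Anchored.rest {K : List V} {v u : V} {X₀ Y : Finset V} {A : Set V}
    (h : Anchored G K v (X₀ ∪ Y) A) (hY : WalkConnected G (Y : Set V)) (hd : Disjoint X₀ Y)
    (hvu : G.Adj v u) (hu : u ∈ Y) (hA : A ⊆ ↑(X₀ ∪ Y)) :
    Anchored G K v X₀ (A \ Y) := by
  have hYv : WalkConnected G ((Y : Set V) ∪ {v}) :=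
    hY.union_adj (.singleton v) (Finset.mem_coe.2 hu) rfl hvu.symm
  have hd' : ∀ y ∈ X₀, y ∈ Y → False := fun y h1 h2 => Finset.disjoint_left.1 hd h1 h2
  rcases h with rfl | h | ⟨O, t, hO, hvO, hOX, htO, htK, htA⟩
  · exact Or.inl (Set.empty_sdiff _)
  · by_cases hall : ∀ t ∈ K, t ∉ Y
    · exact Or.inr (Or.inl fun t ht => ⟨h t ht, hall t ht⟩)
    · push Not at hall
      obtain ⟨t, htK, htY⟩ := hall
      refine Or.inr (Or.inr ⟨_, t, hYv, Or.inr rfl, ?_, Or.inl htY, htK, fun h => h.2 htY⟩)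
      rintro y (hy | hy) hyX
      exacts [(hd' y hyX hy).elim, hy]
  · exact Or.inr (Or.inr ⟨O, t, hO, hvO, fun y hy hyX => hOX y hy (Finset.mem_union_left _ hyX),
      htO, htK, fun h => htA h.1⟩)

/-- The length of the best anchored tree for a set of terminals, connected to `w` by a path. -/
noncomputable def treeDist (G : SimpleGraph V) (len : Sym2 V → ℝ≥0) (K S : List V) (w : V) (L : ℕ)
    (I : ℕ × ℕ) : ℝ≥0∞ :=
  ⨅ (X : Finset V) (c : ℝ≥0) (v : V) (_ : SpansTree G len X c ∧ v ∈ X ∧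
    maskSet S L ⊆ X ∧ ivalSet K I ⊆ X ∧ Anchored G K v X (ivalSet K I)),
    (c : ℝ≥0∞) + lengthDist G len v w

variable {len : Sym2 V → ℝ≥0} {K S : List V}

theorem le_treeDist {w : V} {L : ℕ} {I : ℕ × ℕ} {b : ℝ≥0∞}
    (h : ∀ X c v, SpansTree G len X c → v ∈ X → maskSet S L ⊆ X → ivalSet K I ⊆ X →
      Anchored G K v X (ivalSet K I) → b ≤ c + lengthDist G len v w) :
    b ≤ treeDist G len K S w L I :=
  le_iInf fun X => le_iInf fun c => le_iInf fun v => le_iInf fun H =>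
    h X c v H.1 H.2.1 H.2.2.1 H.2.2.2.1 H.2.2.2.2

theorem treeDist_le {w : V} {L : ℕ} {I : ℕ × ℕ} {X : Finset V} {c : ℝ≥0} {v : V}
    (hX : SpansTree G len X c) (hv : v ∈ X) (hL : maskSet S L ⊆ X) (hI : ivalSet K I ⊆ X)
    (hA : Anchored G K v X (ivalSet K I)) :
    treeDist G len K S w L I ≤ c + lengthDist G len v w :=
  (iInf_le _ X).trans <| (iInf_le _ c).trans <| (iInf_le _ v).trans <|
    iInf_le (fun _ => (c : ℝ≥0∞) + lengthDist G len v w) ⟨hX, hv, hL, hI, hA⟩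

/-- A tree through `a` and its root `v` is at least as long as the distance from `a` to `v`; the
triangle inequality does the rest. This makes the base entries for one terminal good. -/
theorem lengthDist_le_treeDist {w a : V} {L : ℕ} {I : ℕ × ℕ}
    (ha : a ∈ maskSet S L ∪ ivalSet K I) : lengthDist G len w a ≤ treeDist G len K S w L I := by
  refine le_treeDist fun X c v hX hv hL hI _ => ?_
  have haX : a ∈ X := ha.elim (fun h => hL h) (fun h => hI h)
  rw [lengthDist_comm]
  refine (lengthDist_triangle len a v w).trans ?_
  gcongr
  exact hX.lengthDist_le haX hv

/-- At a vertex that is not a terminal, an interval is divided by a branch into two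
successive intervals. -/
theorem Noncrossing.exists_cut (hK : Noncrossing G K) (hnd : K.Nodup) {I : ℕ × ℕ} (hI : ValidIval K.length I)
    {v : V} {X₀ Y : Finset V} (hX₀ : WalkConnected G (X₀ : Set V))
    (hY : WalkConnected G (Y : Set V)) (hd : Disjoint X₀ Y) (hv : v ∈ X₀)
    (hsub : ivalSet K I ⊆ ↑(X₀ ∪ Y)) (hanch : Anchored G K v (X₀ ∪ Y) (ivalSet K I))
    (hfirst : 0 < I.2 → ∃ b ∈ Y, K[I.1]? = some b) :
    ∃ o ∈ origins K.length I, ∃ x ≤ I.2,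
      ivalSet K (o, x) = ivalSet K I ∩ Y ∧ ivalSet K (o + x, I.2 - x) = ivalSet K I \ Y := by
  obtain ⟨a, l⟩ := I
  obtain ⟨hlk, h0, ha⟩ := hI
  simp only at hlk h0 ha hfirst hsub hanch ⊢
  rcases Nat.eq_zero_or_pos l with rfl | hl
  · refine ⟨a, by simp [origins], 0, le_rfl, ?_, ?_⟩ <;> simp [ivalSet_zero]
  obtain ⟨b, hbY, hb⟩ := hfirst hl
  have hd' : Disjoint (X₀ : Set V) (Y : Set V) := by exact_mod_cast hd
  rw [Finset.coe_union] at hsub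
  by_cases hlK : l = K.length
  · subst hlK
    have horig : ∀ o, o < K.length → o ∈ origins K.length (a, K.length) := by
      intro o ho
      simp [origins, ho, hl]
    by_cases hall : ∀ t ∈ K, t ∈ Y
    · refine ⟨0, horig 0 hl, K.length, le_rfl, ?_, ?_⟩
      · rw [ivalSet_length, ivalSet_length]
        ext t; simpa using hall t
      · rw [Nat.sub_self, ivalSet_zero, ivalSet_length]
        ext t; simp; exact hall t
    push Not at hall
    obtain ⟨t, htK, htY⟩ := hall
    obtain ⟨p, hp, rfl⟩ := List.mem_iff_getElem.1 htK
    -- a position after `p` where the sequence enters `Y`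
    have hex : ∃ n, ∃ z, K[(p + n) % K.length]? = some z ∧ z ∈ Y := by
      obtain ⟨n, -, hn⟩ := exists_mod_eq p (show a < K.length by omega)
      exact ⟨n, b, by rw [hn, hb], hbY⟩
    classical
    obtain ⟨z, hz, hzY⟩ := Nat.find_spec hex
    have hmin := fun m => Nat.find_min hex (m := m)
    set n := Nat.find hex
    have hn0 : n ≠ 0 := by
      intro h
      rw [h, Nat.add_zero, Nat.mod_eq_of_lt hp, List.getElem?_eq_getElem hp] at hz
      exact htY (Option.some.inj hz ▸ hzY)
    have hlt : (p + n - 1) % K.length < K.length := Nat.mod_lt _ hl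
    have hs : K[(p + n - 1) % K.length]? = some (K[(p + n - 1) % K.length]) :=
      List.getElem?_eq_getElem hlt
    have hsY : K[(p + n - 1) % K.length] ∉ Y := fun h =>
      hmin (n - 1) (by omega) ⟨_, by rw [← hs]; congr 2; omega, h⟩
    have hsX : K[(p + n - 1) % K.length] ∈ X₀ := by
      have : K[(p + n - 1) % K.length] ∈ ivalSet K (a, K.length) := by
        rw [ivalSet_length]; exact List.getElem_mem _
      exact (hsub this).resolve_right hsY
    -- List `K` from a place where it passes from `X₀` to `Y`. The last element of this listing is
    -- then in `X₀` and plays the part of the terminal beyond the end.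
    obtain ⟨x, hx, h1, h2⟩ := hK.exists_prefix hX₀ hY hd' (o := (p + n) % K.length)
      (l := K.length) (j := K.length - 1) (by omega) (by omega)
      (t := K[(p + n - 1) % K.length]) (by
        rw [← hs, Nat.mod_add_mod, show p + n + (K.length - 1) = p + n - 1 + K.length by omega,
          Nat.add_mod_right])
      hsX (b := z) (by rw [Nat.mod_mod]; exact hz) hzY (fun v hv => hsub (by
        rw [ivalSet_length] at hv ⊢; exact hv))
    refine ⟨(p + n) % K.length, horig _ (Nat.mod_lt _ hl), x, hx, ?_, ?_⟩
    · rw [h1, ivalSet_length, ivalSet_length]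
    · rw [h2, ivalSet_length, ivalSet_length]
  · have hbI : b ∈ ivalSet K (a, l) := ⟨0, hl, by
      simp only [Nat.add_zero]; rw [Nat.mod_eq_of_lt (by omega), hb]⟩
    rcases hanch with h | h | ⟨O, t, hO, hvO, hOX, htO, htK, htI⟩
    · rw [h] at hbI; exact hbI.elim
    -- A proper interval cannot contain all of `K`: as `K` has no repetitions, the element just
    -- after its end is missing.
    · exfalso
      obtain ⟨i, hi, hiI⟩ := h (K[(a + l) % K.length]'(Nat.mod_lt _ (by omega)))
        (List.getElem_mem _)
      rw [List.getElem?_eq_getElem (Nat.mod_lt _ (by omega))] at hiI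
      have h1 : a + i ≡ a + l [MOD K.length] :=
        (hnd.getElem_inj_iff).1 (Option.some.inj hiI)
      have h2 := h1.add_left_cancel'
      simp only at hi
      have := h2.eq_of_lt_of_lt (by omega) (by omega)
      omega
    obtain ⟨p, hp, rfl⟩ := List.mem_iff_getElem.1 htK
    obtain ⟨j, hj, hjp⟩ := exists_mod_eq a hp
    have hlj : l ≤ j := by
      by_contra hlt
      exact htI ⟨j, by simp only; omega, by simp only [hjp]; exact List.getElem?_eq_getElem hp⟩
    have hdO : Disjoint (O ∪ X₀) (Y : Set V) := by
      rw [Set.disjoint_union_left]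
      refine ⟨Set.disjoint_left.2 fun y hy hyY => ?_, hd'⟩
      have := hOX y hy (Finset.mem_union_right _ hyY)
      subst this
      exact Finset.disjoint_left.1 hd hv hyY
    -- `O ∪ X₀` is connected through `v`, avoids `Y`, and reaches the terminal `t` beyond the end of
    -- the interval.
    obtain ⟨x, hx, h1, h2⟩ := hK.exists_prefix (hO.union hX₀ hvO hv) hY hdO (o := a)
      (l := l) (j := j) (by omega) hj (by rw [hjp]; exact List.getElem?_eq_getElem hp)
      (Or.inl htO) (b := b) (by rw [Nat.mod_eq_of_lt (by omega), hb]) hbY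
      (fun v hv => (hsub hv).imp Or.inr id)
    refine ⟨a, by simp [origins, hlK], x, hx, h1, h2⟩

end Values

/-! ### The recurrence reaches the best anchored tree. -/

section Recurrence

variable {V : Type} {G : SimpleGraph V} {len : Sym2 V → ℝ≥0} {K S : List V}

theorem ValidIval.fst_lt {k : ℕ} {I : ℕ × ℕ} (h : ValidIval k I) (hpos : 0 < I.2) : I.1 < k := by
  obtain ⟨h1, h2, h3⟩ := h
  omega

theorem ValidIval.ivalSet_eq_insert {I : ℕ × ℕ} (h : ValidIval K.length I) (hpos : 0 < I.2) {p : V}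
    (hp : K[I.1]? = some p) :
    ivalSet K I = insert p (ivalSet K (ival K.length (I.1 + 1) (I.2 - 1))) := by
  have h1 := h.fst_lt hpos
  rw [ivalSet_ival K (by have := h.1; omega)]
  have : I = (I.1, 1 + (I.2 - 1)) := by ext <;> simp; omega
  conv_lhs => rw [this, ivalSet_add]
  rw [Set.insert_eq]
  congr 1
  ext v
  simp only [ivalSet, Set.mem_ofPred_eq, Set.mem_singleton_iff, Nat.lt_one_iff, exists_eq_left,
    Nat.add_zero, Nat.mod_eq_of_lt h1, hp, Option.some.injEq]
  exact eq_comm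

theorem ValidIval.notMem_tail (hnd : K.Nodup) {I : ℕ × ℕ} (h : ValidIval K.length I)
    (hpos : 0 < I.2) {p : V} (hp : K[I.1]? = some p) :
    p ∉ ivalSet K (ival K.length (I.1 + 1) (I.2 - 1)) := by
  have h1 := h.fst_lt hpos
  have h0 := h.1
  rw [ivalSet_ival K (by omega)]
  rintro ⟨i, hi, hip⟩
  simp only at hi
  rw [List.getElem?_eq_getElem h1] at hp
  rw [List.getElem?_eq_getElem (Nat.mod_lt _ (by omega)), ← hp] at hip
  have h2 := (hnd.getElem_inj_iff).1 (Option.some.inj hip)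
  by_cases hlt : I.1 + 1 + i < K.length
  · rw [Nat.mod_eq_of_lt hlt] at h2; omega
  · rw [Nat.mod_eq_sub_mod (by omega), Nat.mod_eq_of_lt (by omega)] at h2; omega

variable [DecidableEq V]

theorem submask_two_pow {L i : ℕ} (h : L.testBit i = true) : Submask (2 ^ i) L := by
  intro j hj
  rw [Nat.testBit_two_pow] at hj
  simp only [decide_eq_true_eq] at hj
  exact hj ▸ h

/-- The core of the optimality proof, by induction on the vertex set of the tree. A root that is one
of the terminals ends the descent in a value `C(L ∪ I)`. Any other root either branches there, which
is a candidate for `B`, or leads to a smaller tree with all the terminals. The hypotheses are what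
the programs guarantee: `hB` bounds `B` by all cuts, and the other three bound the new value by the
alternatives in `A`. -/
theorem le_treeDist_of_recurrence (hK : Noncrossing G K) (hnd : K.Nodup) {I : ℕ × ℕ}
    (hI : ValidIval K.length I) {L : ℕ} (hne : (maskSet S L ∪ ivalSet K I).Nonempty) {w : V}
    {new : ℝ≥0∞} {valB : V → ℝ≥0∞}
    (hB : ∀ v, v ∉ maskSet S L → v ∉ ivalSet K I → ∀ o ∈ origins K.length I, ∀ M, Submask M L →
      ∀ x ≤ I.2, ¬ ((M = 0 ∧ x = 0) ∨ (M = L ∧ x = I.2)) →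
      valB v ≤ treeDist G len K S v M (ival K.length o x) +
        treeDist G len K S v (L ^^^ M) (ival K.length (o + x) (I.2 - x)))
    (hAB : ∀ u, u ∉ maskSet S L → u ∉ ivalSet K I → new ≤ valB u + lengthDist G len u w)
    (hAL : ∀ i u, S[i]? = some u → L.testBit i = true →
      new ≤ treeDist G len K S u (L ^^^ 2 ^ i) I + lengthDist G len u w)
    (hAI : 0 < I.2 → ∀ p, K[I.1]? = some p → ∀ u ∈ ivalSet K I,
      new ≤ treeDist G len K S p L (ival K.length (I.1 + 1) (I.2 - 1)) + lengthDist G len u w) :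
    new ≤ treeDist G len K S w L I := by
  refine le_treeDist fun X => ?_
  induction X using Finset.strongInduction with
  | H X IH =>
  intro c v hX hv hL hIX hanch
  by_cases hvL : v ∈ maskSet S L
  · obtain ⟨i, hi, hLi⟩ := hvL
    refine (hAL i v hi hLi).trans ?_
    gcongr
    refine (treeDist_le hX hv ?_ hIX hanch).trans (by rw [lengthDist_self, add_zero])
    refine subset_trans ?_ hL
    rw [maskSet_xor S (submask_two_pow hLi)]
    exact Set.subset_union_right
  by_cases hvI : v ∈ ivalSet K I
  · have hpos : 0 < I.2 := by obtain ⟨i, hi, -⟩ := hvI; omega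
    have hp : K[I.1]? = some (K[I.1]'(hI.fst_lt hpos)) := List.getElem?_eq_getElem (hI.fst_lt hpos)
    set p := K[I.1]'(hI.fst_lt hpos)
    have heq := hI.ivalSet_eq_insert hpos hp
    have hpX : p ∈ X := hIX (by rw [heq]; exact Set.mem_insert _ _)
    refine (hAI hpos p hp v hvI).trans ?_
    gcongr
    refine (treeDist_le hX hpX hL ?_ ?_).trans (by rw [lengthDist_self, add_zero])
    · refine subset_trans ?_ hIX
      rw [heq]
      exact Set.subset_insert _ _
    -- The tree is rerooted at `p`, the vertex from which the table is read. As `p` is a terminal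
    -- outside the shortened interval, `{p}` is an anchor.
    · exact Or.inr (Or.inr ⟨{p}, p, .singleton p, rfl, fun y hy _ => hy, rfl,
        List.mem_of_getElem? hp, hI.notMem_tail hnd hpos hp⟩)
  -- a branch at `v` that contains the first terminal
  obtain ⟨t, htX, htv, htT, hfirst⟩ : ∃ t ∈ X, t ≠ v ∧ t ∈ maskSet S L ∪ ivalSet K I ∧
      (0 < I.2 → K[I.1]? = some t) := by
    rcases Nat.eq_zero_or_pos I.2 with h0 | hpos
    · obtain ⟨t, ht⟩ := hne
      refine ⟨t, ht.elim (fun h => hL h) (fun h => hIX h), ?_, ht, fun h => by omega⟩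
      rintro rfl
      exact ht.elim hvL hvI
    · have hp : K[I.1]? = some (K[I.1]'(hI.fst_lt hpos)) := List.getElem?_eq_getElem (hI.fst_lt hpos)
      have hpI : K[I.1]'(hI.fst_lt hpos) ∈ ivalSet K I := by
        rw [hI.ivalSet_eq_insert hpos hp]; exact Set.mem_insert _ _
      exact ⟨_, hIX hpI, fun h => hvI (h ▸ hpI), Or.inr hpI, fun _ => hp⟩
  obtain ⟨X₀, Y, c₀, c₁, u, rfl, hd, hvX, htY, huY, hvu, hX₀, hY, rfl⟩ :=
    hX.exists_split v hv t htX htv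
  obtain ⟨o, ho, x, hx, hIY, hIX₀⟩ := hK.exists_cut hnd hI hX₀.walkConnected hY.walkConnected hd
    hvX hIX hanch (fun h => ⟨t, htY, hfirst h⟩)
  -- The inner terminals on the branch may be any subset, since all subsets are tabulated; only the
  -- outer ones need planarity.
  obtain ⟨M, hM⟩ := exists_submask L fun i => ∃ z ∈ Y, S[i]? = some z
  have hML : Submask M L := fun i hi => ((hM i).1 hi).1
  have hMY : maskSet S M ⊆ Y := by
    rintro z ⟨i, hi, hMi⟩
    obtain ⟨-, z', hz', h⟩ := (hM i).1 hMi
    rw [hi] at h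
    exact Option.some.inj h ▸ hz'
  have hLX₀ : maskSet S (L ^^^ M) ⊆ X₀ := by
    intro z hz
    have hzL : z ∈ maskSet S L := by rw [maskSet_xor S hML]; exact Or.inr hz
    refine (Finset.mem_union.1 (hL hzL)).resolve_right fun hzY => ?_
    obtain ⟨i, hi, hb⟩ := hz
    have h1 := hM i
    rw [Nat.testBit_xor] at hb
    have hLi : L.testBit i = true := by
      have := hML i
      cases hL : L.testBit i <;> cases hM' : M.testBit i <;> simp_all
    rw [h1.2 ⟨hLi, z, hzY, hi⟩, hLi] at hb
    simp at hb
  have hanchY := hanch.branch hX₀.walkConnected hd hvX hvu hIX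
  have hanchX := hanch.rest hY.walkConnected hd hvu huY hIX
  have hk := hI.1
  have hedge : lengthDist G len u v ≤ len s(v, u) := by
    refine (lengthDist_le len (.cons hvu.symm .nil)).trans ?_
    simp [Sym2.eq_swap]
  by_cases hall : M = L ∧ x = I.2
  -- No terminal is left on the side of `v`. The induction hypothesis applies to `Y` rooted at `u`,
  -- and the edge from `v` to `u` pays for the longer path to `w`.
  · obtain ⟨rfl, rfl⟩ := hall
    have hIY' : ivalSet K I = ivalSet K I ∩ Y := by rw [← hIY, ivalSet_origin K ho]
    have h1 := IH Y ?_ c₁ u hY huY hMY (by rw [hIY']; exact Set.inter_subset_right)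
      (by rw [hIY']; exact hanchY)
    · refine h1.trans ?_
      calc (c₁ : ℝ≥0∞) + lengthDist G len u w
          ≤ c₁ + (lengthDist G len u v + lengthDist G len v w) := by
            gcongr; exact lengthDist_triangle len u v w
        _ ≤ c₁ + (len s(v, u) + lengthDist G len v w) := by gcongr
        _ ≤ c₀ + (c₁ + (len s(v, u) + lengthDist G len v w)) := le_add_self
        _ = _ := by push_cast; ring
    · refine Finset.ssubset_iff_subset_ne.2 ⟨Finset.subset_union_right, fun h => ?_⟩
      exact Finset.disjoint_left.1 hd hvX (h ▸ hv)
  -- The branch was chosen to contain the terminal `t`, so its share is not empty.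
  · have hsome : ¬ (M = 0 ∧ x = 0) := by
      rintro ⟨rfl, rfl⟩
      rcases htT with ⟨i, hi, hLi⟩ | htI
      · have := (hM i).2 ⟨hLi, t, htY, hi⟩
        simp at this
      · rw [ivalSet_zero] at hIY
        have : t ∈ ivalSet K I ∩ Y := ⟨htI, htY⟩
        rw [← hIY] at this
        exact this
    refine (hAB v hvL hvI).trans ?_
    gcongr
    refine (hB v hvL hvI o ho M hML x hx (by tauto)).trans ?_
    have e1 := ivalSet_ival K (a := o) (l := x) (by omega)
    have e2 := ivalSet_ival K (a := o + x) (l := I.2 - x) (by omega)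
    have h1 : treeDist G len K S v M (ival K.length o x) ≤ c₁ + lengthDist G len u v :=
      treeDist_le hY huY hMY (by rw [e1, hIY]; exact Set.inter_subset_right)
        (by rw [e1, hIY]; exact hanchY)
    have h2 : treeDist G len K S v (L ^^^ M) (ival K.length (o + x) (I.2 - x)) ≤
        c₀ + lengthDist G len v v :=
      treeDist_le hX₀ hvX hLX₀ (by
        rw [e2, hIX₀]
        intro z hz
        exact (Finset.mem_union.1 (hIX hz.1)).resolve_right hz.2) (by rw [e2, hIX₀]; exact hanchX)
    rw [lengthDist_self, add_zero] at h2
    calc _ ≤ (c₁ + lengthDist G len u v) + c₀ := add_le_add h1 h2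
      _ ≤ (c₁ + len s(v, u)) + c₀ := by gcongr
      _ = _ := by push_cast; ring

end Recurrence

/-! ### Programs that only read the tables -/

section ReadOnly

variable {N : ℕ} {α β ι : Type}

/-- The memories agree except for the step counter. -/
def SameTables (m c : Mem N) : Prop :=
  m.posK = c.posK ∧ m.posS = c.posS ∧ m.dist = c.dist ∧ m.tabB = c.tabB ∧ m.tabC = c.tabC

theorem SameTables.refl (m : Mem N) : SameTables m m := ⟨rfl, rfl, rfl, rfl, rfl⟩

theorem SameTables.trans {m c e : Mem N} (h : SameTables m c) (h' : SameTables c e) :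
    SameTables m e :=
  ⟨h.1.trans h'.1, h.2.1.trans h'.2.1, h.2.2.1.trans h'.2.2.1, h.2.2.2.1.trans h'.2.2.2.1,
    h.2.2.2.2.trans h'.2.2.2.2⟩

/-- Run on the tables of `c`, the program `x` leaves the tables unchanged and its value
satisfies `Q`. -/
def Reads (c : Mem N) (x : Prog N α) (Q : α → Prop) : Prop :=
  ∀ m, SameTables m c → Q (x m).1 ∧ SameTables (x m).2 c

variable {c : Mem N}

theorem Reads.mono {x : Prog N α} {Q Q' : α → Prop} (h : Reads c x Q) (hQ : ∀ a, Q a → Q' a) :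
    Reads c x Q' := fun m hm => ⟨hQ _ (h m hm).1, (h m hm).2⟩

theorem reads_pure {a : α} {Q : α → Prop} (h : Q a) : Reads c (pure a : Prog N α) Q :=
  fun _ hm => ⟨h, hm⟩

theorem Reads.bind {x : Prog N α} {f : α → Prog N β} {Q : α → Prop} {Q' : β → Prop}
    (hx : Reads c x Q) (hf : ∀ a, Q a → Reads c (f a) Q') : Reads c (x >>= f) Q' :=
  fun m hm => hf _ (hx m hm).1 _ (hx m hm).2

theorem reads_tick : Reads c tick fun _ => True := fun _ hm => ⟨trivial, hm⟩

theorem reads_readPosK (u : Fin N) : Reads c (readPosK u) (· = c.posK u) :=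
  fun _ hm => ⟨congrFun hm.1 u, hm⟩

theorem reads_readPosS (u : Fin N) : Reads c (readPosS u) (· = c.posS u) :=
  fun _ hm => ⟨congrFun hm.2.1 u, hm⟩

theorem reads_readDist (u v : Fin N) : Reads c (readDist u v) (· = c.dist u v) :=
  fun _ hm => ⟨congrFun (congrFun hm.2.2.1 u) v, hm⟩

theorem reads_readB (v : Fin N) (L : ℕ) (I : ℕ × ℕ) : Reads c (readB v L I) (· = c.tabB v L I) :=
  fun _ hm => ⟨congrFun (congrFun (congrFun hm.2.2.2.1 v) L) I, hm⟩

theorem reads_readC (v : Fin N) (L : ℕ) (I : ℕ × ℕ) : Reads c (readC v L I) (· = c.tabC v L I) :=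
  fun _ hm => ⟨congrFun (congrFun (congrFun hm.2.2.2.2 v) L) I, hm⟩

theorem reads_plus (x y : Entry N) :
    Reads c (plus x y) (· = ⟨x.len + y.len, Rope.join x.tree y.tree⟩) :=
  fun _ hm => ⟨rfl, hm⟩

theorem reads_better (x y : Entry N) :
    Reads c (better x y) (· = if y.len < x.len then y else x) :=
  fun _ hm => ⟨rfl, hm⟩

/-- `P` passes to the result because that is one of the candidates or `Entry.inf`; each `U i` passes
because it survives decreasing the length. Soundness is used as `P` and upper bounds as `U`, so one
traversal proves both. -/
theorem reads_minimum {l : List ι} {f : ι → Prog N (Entry N)} {P : Entry N → Prop}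
    {U : ι → ℝ≥0∞ → Prop} (hU : ∀ i b b', b' ≤ b → U i b → U i b') (hinf : P (Entry.inf N))
    (h : ∀ i ∈ l, Reads c (f i) fun e => P e ∧ U i e.len) :
    Reads c (minimum l f) fun e => P e ∧ ∀ i ∈ l, U i e.len := by
  induction l with
  | nil => exact reads_pure ⟨hinf, by simp⟩
  | cons i l ih =>
    refine reads_tick.bind fun _ _ => (h i (by simp)).bind fun x hx =>
      (ih fun j hj => h j (by simp [hj])).bind fun y hy => (reads_better x y).mono ?_
    rintro _ rfl
    simp only [List.mem_cons, forall_eq_or_imp]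
    split_ifs with hlt
    · exact ⟨hy.1, hU _ _ _ hlt.le hx.2, hy.2⟩
    · exact ⟨hx.1, hx.2, fun j hj => hU _ _ _ (not_lt.1 hlt) (hy.2 j hj)⟩

theorem reads_forEach_tick (l : List ι) :
    Reads c (forEach l fun _ => (tick : Prog N Unit)) fun _ => True := by
  induction l with
  | nil => exact reads_pure trivial
  | cons i l ih => exact reads_tick.bind fun _ _ => reads_tick.bind fun _ _ => ih

/-- The list of all submasks of the lowest `s` bits of `L`. -/
def submaskList : ℕ → ℕ → List ℕ
  | 0, _ => [0]
  | s + 1, L =>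
    if L.testBit s then submaskList s L ++ (submaskList s L).map fun M => M + 2 ^ s
    else submaskList s L

/-- The number of ones among the lowest `s` bits. -/
def onesCount : ℕ → ℕ → ℕ
  | 0, _ => 0
  | s + 1, L => if L.testBit s then onesCount s L + 1 else onesCount s L

theorem reads_submasks (s L : ℕ) : Reads c (submasks s L) (· = submaskList s L) := by
  induction s with
  | zero => exact reads_pure rfl
  | succ s ih =>
    refine reads_tick.bind fun _ _ => ih.bind ?_
    rintro _ rfl
    rw [submaskList]
    split_ifs with h
    · exact (reads_forEach_tick _).bind fun _ _ => reads_pure rfl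
    · exact reads_pure rfl

theorem reads_popcount (s L : ℕ) : Reads c (popcount s L) (· = onesCount s L) := by
  induction s with
  | zero => exact reads_pure rfl
  | succ s ih =>
    refine reads_tick.bind fun _ _ => ih.bind ?_
    rintro _ rfl
    exact reads_pure rfl

end ReadOnly

/-! ### Subsets as bit masks. -/

section Masks

theorem testBit_add_two_pow {s M : ℕ} (hM : M < 2 ^ s) (i : ℕ) :
    (M + 2 ^ s).testBit i = (M.testBit i || decide (i = s)) := by
  rw [Nat.add_comm]
  rcases lt_trichotomy i s with h | rfl | h
  · rw [Nat.testBit_two_pow_add_gt h]; simp [h.ne]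
  · rw [Nat.testBit_two_pow_add_eq, Nat.testBit_lt_two_pow hM]; simp
  · rw [Nat.testBit_lt_two_pow, Nat.testBit_lt_two_pow]
    · simp [h.ne']
    · exact hM.trans (Nat.pow_lt_pow_right (by norm_num) h)
    · have : 2 ^ (s + 1) ≤ 2 ^ i := Nat.pow_le_pow_right (by norm_num) h
      rw [pow_succ] at this
      omega

theorem mem_submaskList {s L M : ℕ} :
    M ∈ submaskList s L ↔ M < 2 ^ s ∧ Submask M L := by
  induction s generalizing M with
  | zero =>
    simp only [submaskList, List.mem_singleton, pow_zero, Nat.lt_one_iff]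
    exact ⟨fun h => ⟨h, by subst h; intro i; simp⟩, fun h => h.1⟩
  | succ s ih =>
    rw [submaskList]
    have hp : 2 ^ (s + 1) = 2 ^ s + 2 ^ s := by ring
    split_ifs with h
    · rw [List.mem_append, List.mem_map]
      constructor
      · rintro (hM | ⟨M', hM', rfl⟩)
        · have := ih.1 hM
          exact ⟨by omega, this.2⟩
        · have hM := ih.1 hM'
          refine ⟨by omega, fun i hi => ?_⟩
          rw [testBit_add_two_pow hM.1] at hi
          simp only [Bool.or_eq_true, decide_eq_true_eq] at hi
          rcases hi with hi | rfl
          exacts [hM.2 i hi, h]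
      · rintro ⟨hM, hML⟩
        by_cases hlt : M < 2 ^ s
        · exact Or.inl (ih.2 ⟨hlt, hML⟩)
        · refine Or.inr ⟨M - 2 ^ s, ih.2 ⟨by omega, fun i hi => ?_⟩, by omega⟩
          refine hML i ?_
          rw [show M = M - 2 ^ s + 2 ^ s by omega, testBit_add_two_pow (by omega), hi]
          rfl
    · rw [ih]
      refine and_congr_left fun hML => ⟨fun hM => by omega, fun hM => ?_⟩
      by_contra hlt
      refine h (hML s ?_)
      rw [show M = M - 2 ^ s + 2 ^ s by omega, testBit_add_two_pow (by omega)]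
      simp

theorem onesCount_xor {s L M : ℕ} (h : Submask M L) :
    onesCount s M + onesCount s (L ^^^ M) = onesCount s L := by
  induction s with
  | zero => rfl
  | succ s ih =>
    have := h s
    simp only [onesCount, Nat.testBit_xor]
    cases hM : M.testBit s <;> cases hL : L.testBit s <;> simp_all <;> omega

theorem onesCount_pos {s L : ℕ} (hL : L < 2 ^ s) (h0 : L ≠ 0) : 0 < onesCount s L := by
  induction s with
  | zero => simp at hL; omega
  | succ s ih =>
    rw [onesCount]
    split_ifs with h
    · omega
    · refine ih ?_
      by_contra hlt
      refine h ?_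
      have hp : 2 ^ (s + 1) = 2 ^ s + 2 ^ s := by ring
      rw [show L = L - 2 ^ s + 2 ^ s by omega, testBit_add_two_pow (by omega)]
      simp

theorem onesCount_two_pow {s i : ℕ} (hi : i < s) : onesCount s (2 ^ i) = 1 := by
  have key : ∀ s, onesCount s (2 ^ i) = if i < s then 1 else 0 := by
    intro s
    induction s with
    | zero => rfl
    | succ s ih =>
      rw [onesCount, Nat.testBit_two_pow, ih]
      by_cases h : i = s
      · simp [h]
      · have : i < s + 1 ↔ i < s := by omega
        simp [h, this]
  rw [key, if_pos hi]

theorem onesCount_zero (s : ℕ) : onesCount s 0 = 0 := by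
  induction s with
  | zero => rfl
  | succ s ih => simp [onesCount, ih]

theorem Submask.lt {s L M : ℕ} (h : Submask M L) (hL : L < 2 ^ s) : M < 2 ^ s := by
  refine Nat.lt_pow_two_of_testBit M fun i hi => ?_
  by_contra hne
  have h1 := h i (by simpa using hne)
  have := Nat.ge_two_pow_of_testBit h1
  have : 2 ^ s ≤ 2 ^ i := Nat.pow_le_pow_right (by norm_num) hi
  omega

theorem Submask.xor {L M : ℕ} (h : Submask M L) : Submask (L ^^^ M) L := by
  intro i hi
  rw [Nat.testBit_xor] at hi
  have := h i
  cases hL : L.testBit i <;> cases hM : M.testBit i <;> simp_all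

theorem exists_two_pow_of_onesCount {s L : ℕ} (hL : L < 2 ^ s) (h : onesCount s L = 1) :
    ∃ i < s, L = 2 ^ i := by
  obtain ⟨i, hi⟩ : ∃ i, L.testBit i = true := by
    by_contra hne
    push Not at hne
    have : L = 0 := Nat.eq_of_testBit_eq (by simpa using hne)
    rw [this, onesCount_zero] at h
    omega
  have his : i < s := by
    by_contra hlt
    have := Nat.ge_two_pow_of_testBit hi
    have : 2 ^ s ≤ 2 ^ i := Nat.pow_le_pow_right (by norm_num) (not_lt.1 hlt)
    omega
  have h1 := onesCount_xor (s := s) (submask_two_pow hi)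
  rw [onesCount_two_pow his, h] at h1
  refine ⟨i, his, ?_⟩
  by_contra hne
  have := onesCount_pos ((submask_two_pow hi).xor.lt hL) (s := s) (fun h => hne (by
    rwa [Nat.xor_eq_zero_iff] at h))
  omega

end Masks

/-! ### Soundness and size of the stored solutions. -/

section Ropes

variable {N : ℕ}

/-- The edges of a pointer structure. -/
def Rope.edges : Rope N → Set (Sym2 (Fin N))
  | .nil => ∅
  | .edge u v => {s(u, v)}
  | .join x y => x.edges ∪ y.edges

/-- The number of nodes of a pointer structure. -/
def Rope.size : Rope N → ℕ
  | .nil => 1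
  | .edge _ _ => 1
  | .join x y => x.size + y.size + 1

theorem flatten_spec (x : Rope N) (acc : List (Sym2 (Fin N))) (m : Mem N) :
    (∀ e, e ∈ (flatten x acc m).1 ↔ e ∈ x.edges ∨ e ∈ acc) ∧
      (flatten x acc m).2.steps = m.steps + x.size := by
  induction x generalizing acc m with
  | nil => exact ⟨fun e => ⟨Or.inr, fun h => h.resolve_left id⟩, rfl⟩
  | edge u v => exact ⟨fun e => List.mem_cons, rfl⟩
  | join x y ihx ihy =>
    obtain ⟨h1, h2⟩ := ihy acc { m with steps := m.steps + 1 }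
    obtain ⟨h3, h4⟩ := ihx (flatten y acc { m with steps := m.steps + 1 }).1
      (flatten y acc { m with steps := m.steps + 1 }).2
    refine ⟨fun e => (h3 e).trans ?_, h4.trans ?_⟩
    · rw [h1, ← or_assoc]; rfl
    · rw [h2, Rope.size]; simp only; omega

/-- The entry is a connected subgraph of at most the given length that contains `P`, unless the
length is infinite; its pointer structure has at most `n` nodes. -/
def Entry.Sound (G : SimpleGraph (Fin N)) (w : Sym2 (Fin N) → ℝ≥0) (P : Set (Fin N)) (n : ℕ)
    (e : Entry N) : Prop :=
  (e.len ≠ ⊤ → ∃ T : G.Subgraph, T.Connected ∧ P ⊆ T.verts ∧ T.edgeSet = e.tree.edges ∧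
    (subgraphLength w T : ℝ≥0∞) ≤ e.len) ∧ e.tree.size ≤ n

variable {G : SimpleGraph (Fin N)} {w : Sym2 (Fin N) → ℝ≥0}

theorem Entry.Sound.mono {P Q : Set (Fin N)} {n n' : ℕ} {e : Entry N} (h : e.Sound G w P n)
    (hQ : Q ⊆ P) (hn : n ≤ n') : e.Sound G w Q n' :=
  ⟨fun he => by
    obtain ⟨T, h1, h2, h3, h4⟩ := h.1 he
    exact ⟨T, h1, hQ.trans h2, h3, h4⟩, h.2.trans hn⟩

theorem Entry.sound_inf (P : Set (Fin N)) {n : ℕ} (hn : 1 ≤ n) : (Entry.inf N).Sound G w P n :=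
  ⟨fun h => (h rfl).elim, hn⟩

theorem Entry.sound_zero (v : Fin N) {n : ℕ} (hn : 1 ≤ n) : (Entry.zero N).Sound G w {v} n := by
  classical
  refine ⟨fun _ => ⟨G.singletonSubgraph v, SimpleGraph.Subgraph.singletonSubgraph_connected,
    by simp, by simp [Entry.zero, Rope.edges], ?_⟩, hn⟩
  simp [subgraphLength]

/-- The shared vertex `v` keeps the union connected. Common edges are counted once in the subgraph
but twice in the stored length, so only an inequality survives; equality for the final entry comes
from optimality. -/
theorem Entry.Sound.plus {P Q R : Set (Fin N)} {a b n : ℕ} {x y : Entry N} (hx : x.Sound G w P a)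
    (hy : y.Sound G w Q b) {v : Fin N} (hvP : v ∈ P) (hvQ : v ∈ Q) (hn : a + b + 1 ≤ n)
    (hR : R ⊆ P ∪ Q) :
    (⟨x.len + y.len, Rope.join x.tree y.tree⟩ : Entry N).Sound G w R n := by
  refine ⟨fun he => ?_, ?_⟩
  · simp only [ne_eq, ENNReal.add_eq_top, not_or] at he
    obtain ⟨T, h1, h2, h3, h4⟩ := hx.1 he.1
    obtain ⟨T', h1', h2', h3', h4'⟩ := hy.1 he.2
    refine ⟨T ⊔ T', SimpleGraph.Subgraph.connected_sup h1.preconnected h1'.preconnected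
      ⟨v, h2 hvP, h2' hvQ⟩, ?_, ?_, ?_⟩
    · exact hR.trans (Set.union_subset_union h2 h2')
    · rw [SimpleGraph.Subgraph.edgeSet_sup, h3, h3']; rfl
    · calc (subgraphLength w (T ⊔ T') : ℝ≥0∞)
          ≤ ((subgraphLength w T + subgraphLength w T' : ℝ≥0) : ℝ≥0∞) := by
            exact_mod_cast subgraphLength_sup_le w T T'
        _ ≤ _ := by push_cast; exact add_le_add h4 h4'
  · have := hx.2
    have := hy.2
    simp only [Rope.size]
    omega

end Ropes

/-- Bound for the pointer structures in the table `tabC` for `t` terminals besides the root. -/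
def sizeC (N t : ℕ) : ℕ := 1 + (2 * ((2 * N + 8) * t) - (2 * N + 8))

/-- Bound for the pointer structures in the table `tabB`. -/
def sizeB (N t : ℕ) : ℕ := 3 + (2 * ((2 * N + 8) * t) - 2 * (2 * N + 8))

/-- Bound for the pointer structures that realize `valueA`. -/
def sizeA (N t : ℕ) : ℕ :=
  if t = 0 then 1 else 2 * N + 4 + (2 * ((2 * N + 8) * t) - 2 * (2 * N + 8))

/-- With `q = 2 * N + 8` and `t ≥ 1`, the bounds are `(2t - 1)q + 1` for `C`, `(2t - 2)q + 3` for
`B` and `(2t - 2)q + 2N + 4` for `A`. A stored shortest path has at most `2N` nodes. The bounds are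
linear in `t`, so merging solutions for disjoint sets of terminals does not accumulate. -/
theorem sizeA_of_sizeC (N : ℕ) {t t' : ℕ} (h : t' + 1 = t) : sizeC N t' + 2 * N + 1 ≤ sizeA N t := by
  subst h
  simp only [sizeC, sizeA, Nat.mul_add]
  simp
  omega

theorem sizeA_of_sizeB (N : ℕ) {t : ℕ} (h : 0 < t) : sizeB N t + 2 * N + 1 ≤ sizeA N t := by
  simp only [sizeB, sizeA, if_neg h.ne']
  omega

theorem sizeB_of_sizeC (N : ℕ) {a b t : ℕ} (ha : 0 < a) (hb : 0 < b) (h : a + b = t) :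
    sizeC N a + sizeC N b + 1 ≤ sizeB N t := by
  subst h
  have := Nat.le_mul_of_pos_right (2 * N + 8) ha
  have := Nat.le_mul_of_pos_right (2 * N + 8) hb
  have h3 := Nat.mul_add (2 * N + 8) a b
  simp only [sizeB, sizeC]
  omega

/-- The tight case has a single nonempty part: two unit trees and two joins add `4` nodes to its `2N
+ 4` extra ones. This is where the `8` in `2 * N + 8` comes from. -/
theorem sizeC_of_sizeA (N : ℕ) {a b d t : ℕ} (h : a + b + d = t) (ht : 0 < t) :
    sizeA N a + (sizeA N b + sizeA N d + 1) + 1 ≤ sizeC N t := by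
  subst h
  have h3 : (2 * N + 8) * (a + b + d) = (2 * N + 8) * a + (2 * N + 8) * b + (2 * N + 8) * d := by
    ring
  have h0 : ∀ a, a = 0 ∧ (2 * N + 8) * a = 0 ∨ a ≠ 0 ∧ 2 * N + 8 ≤ (2 * N + 8) * a := fun a => by
    rcases Nat.eq_zero_or_pos a with h | h
    exacts [Or.inl ⟨h, by rw [h, mul_zero]⟩, Or.inr ⟨h.ne', Nat.le_mul_of_pos_right _ h⟩]
  have ha := h0 a
  have hb := h0 b
  have hd := h0 d
  simp only [sizeA, sizeC, h3]
  split_ifs <;> omega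

/-! ### What the programs for single values `A`, `B`, `C` return. -/

section Spec

variable {N : ℕ} {G : SimpleGraph (Fin N)} {w : Sym2 (Fin N) → ℝ≥0} {K S : List (Fin N)}

/-- The vertices that the entries at `(v, L, I)` have to connect. -/
def entrySet (K S : List (Fin N)) (v : Fin N) (L : ℕ) (I : ℕ × ℕ) : Set (Fin N) :=
  insert v (maskSet S L ∪ ivalSet K I)

/-- All entries of the tables are partial solutions. -/
structure TablesSound (G : SimpleGraph (Fin N)) (w : Sym2 (Fin N) → ℝ≥0) (K S : List (Fin N))
    (m : Mem N) : Prop where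
  posK : ∀ u p, m.posK u = some p ↔ K[p]? = some u
  posS : ∀ u p, m.posS u = some p ↔ S[p]? = some u
  dist_len : ∀ u v, (m.dist u v).len = lengthDist G w u v
  dist : ∀ u v, (m.dist u v).Sound G w {u, v} (2 * N)
  tabB : ∀ v L I, (m.tabB v L I).Sound G w (entrySet K S v L I) (sizeB N (onesCount S.length L + I.2))
  tabC : ∀ v L I, (m.tabC v L I).Sound G w (entrySet K S v L I) (sizeC N (onesCount S.length L + I.2))

variable {c : Mem N}

theorem reads_memL (h : ∀ u p, c.posS u = some p ↔ S[p]? = some u) (u : Fin N) (L : ℕ) :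
    Reads c (memL u L) fun b => (b = true ↔ u ∈ maskSet S L) ∧
      (b = true → ∃ i, c.posS u = some i ∧ L.testBit i = true) := by
  refine (reads_readPosS u).bind ?_
  rintro _ rfl
  refine reads_pure ?_
  cases hu : c.posS u with
  | none =>
    simp only [Bool.false_eq_true, false_iff, false_implies, and_true]
    rintro ⟨i, hi, -⟩
    rw [← h, hu] at hi
    simp at hi
  | some i =>
    refine ⟨⟨fun hb => ⟨i, (h u i).1 hu, hb⟩, ?_⟩, fun hb => ⟨i, rfl, hb⟩⟩
    rintro ⟨j, hj, hb⟩
    rw [← h, hu] at hj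
    rw [Option.some.inj hj]; exact hb

theorem reads_memI (h : ∀ u p, c.posK u = some p ↔ K[p]? = some u) (u : Fin N) {I : ℕ × ℕ}
    (hI : ValidIval K.length I) :
    Reads c (memI K.length u I) fun b => (b = true ↔ u ∈ ivalSet K I) := by
  refine (reads_readPosK u).bind ?_
  rintro _ rfl
  refine reads_pure ?_
  cases hu : c.posK u with
  | none =>
    simp only [Bool.false_eq_true, false_iff]
    rintro ⟨i, -, hi⟩
    rw [← h, hu] at hi
    simp at hi
  | some p =>
    have hp := (h u p).1 hu
    obtain ⟨hpk, -⟩ := List.getElem?_eq_some_iff.1 hp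
    obtain ⟨h1, h2, h3⟩ := hI
    have h4 : I.1 < K.length := by omega
    simp only [decide_eq_true_eq]
    have hval : (p + K.length - I.1) % K.length =
        if I.1 ≤ p then p - I.1 else p + K.length - I.1 := by
      split_ifs with hle
      · rw [show p + K.length - I.1 = p - I.1 + K.length by omega, Nat.add_mod_right,
          Nat.mod_eq_of_lt (by omega)]
      · exact Nat.mod_eq_of_lt (by omega)
    rw [hval]
    constructor
    · intro hlt
      refine ⟨_, hlt, ?_⟩
      rw [← hp]
      congr 1
      split_ifs with hle
      · rw [show I.1 + (p - I.1) = p by omega, Nat.mod_eq_of_lt hpk]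
      · rw [show I.1 + (p + K.length - I.1) = p + K.length by omega, Nat.add_mod_right,
          Nat.mod_eq_of_lt hpk]
    · rintro ⟨i, hi, hip⟩
      rw [← h, hu] at hip
      have hip := Option.some.inj hip
      have : (I.1 + i) % K.length = if I.1 + i < K.length then I.1 + i
          else I.1 + i - K.length := by
        split_ifs with hlt
        · exact Nat.mod_eq_of_lt hlt
        · rw [Nat.mod_eq_sub_mod (by omega), Nat.mod_eq_of_lt (by omega)]
      rw [this] at hip
      split_ifs at hip ⊢ <;> omega

/-- The contribution of the vertex `u` to `valueA`, as a bound. -/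
def BoundA (G : SimpleGraph (Fin N)) (w : Sym2 (Fin N) → ℝ≥0) (K S : List (Fin N)) (c : Mem N)
    (v : Fin N) (L : ℕ) (I : ℕ × ℕ) (u : Fin N) (b : ℝ≥0∞) : Prop :=
  (u ∉ maskSet S L → u ∉ ivalSet K I → b ≤ (c.tabB u L I).len + lengthDist G w u v) ∧
  (∀ i, S[i]? = some u → L.testBit i = true →
    b ≤ (c.tabC u (L ^^^ 2 ^ i) I).len + lengthDist G w u v) ∧
  (∀ p, K[I.1]? = some p → u ∈ ivalSet K I →
    b ≤ (c.tabC p L (ival K.length (I.1 + 1) (I.2 - 1))).len + lengthDist G w u v)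

theorem ivalSet_of_snd_eq_zero {I : ℕ × ℕ} (h : I.2 = 0) : ivalSet K I = ∅ := by
  have := ivalSet_zero K I.1
  rwa [← h] at this

theorem maskSet_zero : maskSet S 0 = ∅ := by
  ext v; simp [maskSet]

/-- Exactly one of the three look-ups applies to each `u`. The other clauses of `BoundA` are
vacuous, because `K` and `S` are disjoint. -/
theorem reads_valueA (hc : TablesSound G w K S c) (hnd : (K ++ S).Nodup) (v : Fin N) {L : ℕ}
    (hL : L < 2 ^ S.length) {I : ℕ × ℕ} (hI : ValidIval K.length I) :
    Reads c (valueA K v L I) fun e =>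
      e.Sound G w (entrySet K S v L I) (sizeA N (onesCount S.length L + I.2)) ∧
      (L = 0 ∧ I.2 = 0 → e.len = 0) ∧
      (¬ (L = 0 ∧ I.2 = 0) → ∀ u, BoundA G w K S c v L I u e.len) := by
  refine reads_tick.bind fun _ _ => ?_
  split_ifs with h0
  · refine reads_pure ⟨?_, fun _ => rfl, fun h => (h h0).elim⟩
    obtain ⟨rfl, h2⟩ := h0
    refine (Entry.sound_zero v ?_).mono ?_ le_rfl
    · unfold sizeA; split_ifs <;> omega
    · simp [entrySet, maskSet_zero, ivalSet_of_snd_eq_zero h2]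
  have ht : 0 < onesCount S.length L + I.2 := by
    by_cases h : L = 0
    · have : I.2 ≠ 0 := fun h2 => h0 ⟨h, h2⟩
      omega
    · have := onesCount_pos hL h
      omega
  refine (reads_minimum (P := fun e => e.Sound G w (entrySet K S v L I)
    (sizeA N (onesCount S.length L + I.2))) (U := BoundA G w K S c v L I) ?_
    (Entry.sound_inf _ (by unfold sizeA; split_ifs <;> omega)) ?_).mono ?_
  · rintro u b b' hb ⟨h1, h2, h3⟩
    exact ⟨fun a a' => hb.trans (h1 a a'), fun i a a' => hb.trans (h2 i a a'),
      fun p a a' => hb.trans (h3 p a a')⟩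
  · intro u _
    have hdisj : u ∈ maskSet S L → u ∈ ivalSet K I → False := fun h1 h2 =>
      (List.nodup_append.1 hnd).2.2 u (ivalSet_subset K I h2) u (maskSet_subset S L h1) rfl
    refine (reads_readDist u v).bind ?_
    rintro _ rfl
    have hd := hc.dist u v
    refine (reads_memL hc.posS u L).bind fun b hb => ?_
    split_ifs with hbt
    · obtain ⟨i, hi, hLi⟩ := hb.2 hbt
      have hSi := (hc.posS u i).1 hi
      have his : i < S.length := (List.getElem?_eq_some_iff.1 hSi).1
      refine (reads_readPosS u).bind ?_
      rintro _ rfl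
      rw [hi]
      refine (reads_readC u (L ^^^ 2 ^ i) I).bind ?_
      rintro _ rfl
      refine (reads_plus _ _).mono ?_
      rintro _ rfl
      refine ⟨(hc.tabC u (L ^^^ 2 ^ i) I).plus hd (v := u) (Set.mem_insert _ _)
        (Set.mem_insert _ _) ?_ ?_, ?_, ?_, ?_⟩
      · refine sizeA_of_sizeC N ?_
        have := onesCount_xor (s := S.length) (submask_two_pow hLi)
        rw [onesCount_two_pow his] at this
        omega
      · have huL : maskSet S (2 ^ i) ⊆ {u} := by
          rintro z ⟨j, hj, hji⟩
          rw [Nat.testBit_two_pow] at hji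
          simp only [decide_eq_true_eq] at hji
          subst hji
          rw [hSi] at hj
          exact (Option.some.inj hj).symm
        intro z hz
        rcases hz with rfl | hz | hz
        · exact Or.inr (Or.inr rfl)
        · rw [maskSet_xor S (submask_two_pow hLi)] at hz
          rcases hz with hz | hz
          · exact Or.inl (Or.inl (huL hz))
          · exact Or.inl (Or.inr (Or.inl hz))
        · exact Or.inl (Or.inr (Or.inr hz))
      · intro hu; exact (hu (hb.1.1 hbt)).elim
      · intro j hj _
        rw [← hc.posS, hi] at hj
        rw [← Option.some.inj hj, hc.dist_len]
      · intro p _ hu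
        exact (hdisj (hb.1.1 hbt) hu).elim
    · have huL : u ∉ maskSet S L := fun h => hbt (hb.1.2 h)
      refine (reads_memI hc.posK u hI).bind fun b' hb' => ?_
      split_ifs with hbt'
      · have huI := hb'.1 hbt'
        have hpos : 0 < I.2 := by obtain ⟨i, hi, -⟩ := huI; omega
        have hp : K[I.1]? = some (K[I.1]'(hI.fst_lt hpos)) :=
          List.getElem?_eq_getElem (hI.fst_lt hpos)
        rw [List.getD_eq_getElem _ _ (hI.fst_lt hpos)]
        set p := K[I.1]'(hI.fst_lt hpos)
        refine (reads_readC p L _).bind ?_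
        rintro _ rfl
        refine (reads_plus _ _).mono ?_
        rintro _ rfl
        have hins := hI.ivalSet_eq_insert hpos hp
        refine ⟨(hc.tabC p L _).plus hd (v := u) ?_ (Set.mem_insert _ _) ?_ ?_, ?_, ?_, ?_⟩
        · rw [hins] at huI
          rcases huI with h | h
          exacts [Or.inl h, Or.inr (Or.inr h)]
        · refine sizeA_of_sizeC N ?_
          rw [ival_snd]; omega
        · intro z hz
          rcases hz with rfl | hz | hz
          · exact Or.inr (Or.inr rfl)
          · exact Or.inl (Or.inr (Or.inl hz))
          · rw [hins] at hz
            rcases hz with h | h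
            exacts [Or.inl (Or.inl h), Or.inl (Or.inr (Or.inr h))]
        · intro _ hu; exact (hu huI).elim
        · intro i hi hLi
          exact (huL ⟨i, hi, hLi⟩).elim
        · intro q hq _
          rw [hp] at hq
          rw [← Option.some.inj hq, hc.dist_len]
      · have huI : u ∉ ivalSet K I := fun h => hbt' (hb'.2 h)
        refine (reads_readB u L I).bind ?_
        rintro _ rfl
        refine (reads_plus _ _).mono ?_
        rintro _ rfl
        refine ⟨(hc.tabB u L I).plus hd (v := u) (Set.mem_insert _ _) (Set.mem_insert _ _)
          (sizeA_of_sizeB N ht) ?_, ?_, ?_, ?_⟩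
        · intro z hz
          rcases hz with rfl | hz
          · exact Or.inr (Or.inr rfl)
          · exact Or.inl (Or.inr hz)
        · intro _ _; rw [hc.dist_len]
        · intro i hi hLi
          exact (huL ⟨i, hi, hLi⟩).elim
        · intro _ _ hu; exact (huI hu).elim
  · rintro e ⟨h1, h2⟩
    exact ⟨h1, fun h => (h0 h).elim, fun _ u => h2 u (List.mem_finRange u)⟩

theorem reads_valueB (hc : TablesSound G w K S c) (v : Fin N) {L : ℕ}
    (hL : L < 2 ^ S.length) {I : ℕ × ℕ} (hI : ValidIval K.length I) :
    Reads c (valueB K.length S.length v L I) fun e =>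
      e.Sound G w (entrySet K S v L I) (sizeB N (onesCount S.length L + I.2)) ∧
      ∀ o ∈ origins K.length I, ∀ M ∈ submaskList S.length L, ∀ x ∈ List.range (I.2 + 1),
        ¬ ((M = 0 ∧ x = 0) ∨ (M = L ∧ x = I.2)) → e.len ≤
          (c.tabC v M (ival K.length o x)).len +
            (c.tabC v (L ^^^ M) (ival K.length (o + x) (I.2 - x))).len := by
  have hinf : (Entry.inf N).Sound G w (entrySet K S v L I)
      (sizeB N (onesCount S.length L + I.2)) := Entry.sound_inf _ (by unfold sizeB; omega)
  refine (reads_submasks S.length L).bind ?_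
  rintro _ rfl
  refine reads_minimum (U := fun o b => ∀ M ∈ submaskList S.length L,
    ∀ x ∈ List.range (I.2 + 1), ¬ ((M = 0 ∧ x = 0) ∨ (M = L ∧ x = I.2)) → b ≤
      (c.tabC v M (ival K.length o x)).len +
        (c.tabC v (L ^^^ M) (ival K.length (o + x) (I.2 - x))).len)
    (fun o b b' hb h M hM x hx hn => hb.trans (h M hM x hx hn)) hinf fun o ho => ?_
  refine reads_minimum (U := fun M b => 
    ∀ x ∈ List.range (I.2 + 1), ¬ ((M = 0 ∧ x = 0) ∨ (M = L ∧ x = I.2)) → b ≤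
      (c.tabC v M (ival K.length o x)).len +
        (c.tabC v (L ^^^ M) (ival K.length (o + x) (I.2 - x))).len)
    (fun M b b' hb h x hx hn => hb.trans (h x hx hn)) hinf fun M hM => ?_
  refine reads_minimum (U := fun x b => 
    ¬ ((M = 0 ∧ x = 0) ∨ (M = L ∧ x = I.2)) → b ≤
      (c.tabC v M (ival K.length o x)).len +
        (c.tabC v (L ^^^ M) (ival K.length (o + x) (I.2 - x))).len)
    (fun x b b' hb h hn => hb.trans (h hn)) hinf fun x hx => ?_
  rw [mem_submaskList] at hM
  rw [List.mem_range] at hx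
  refine reads_tick.bind fun _ _ => ?_
  split_ifs with hn
  · exact reads_pure ⟨hinf, fun h => (h hn).elim⟩
  refine (reads_readC _ _ _).bind ?_
  rintro _ rfl
  refine (reads_readC _ _ _).bind ?_
  rintro _ rfl
  refine (reads_plus _ _).mono ?_
  rintro _ rfl
  refine ⟨(hc.tabC v M _).plus (hc.tabC v (L ^^^ M) _) (v := v) (Set.mem_insert _ _)
    (Set.mem_insert _ _) ?_ ?_, fun _ => le_rfl⟩
  -- The excluded choices are exactly those with an empty part. Both counts are therefore positive,
  -- as the size bound requires.
  · rw [ival_snd, ival_snd]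
    have h1 := onesCount_xor (s := S.length) hM.2
    refine sizeB_of_sizeC N ?_ ?_ (by omega)
    · by_cases h : M = 0
      · have : x ≠ 0 := fun h' => hn (Or.inl ⟨h, h'⟩)
        omega
      · have := onesCount_pos hM.1 h
        omega
    · by_cases h : M = L
      · have : x ≠ I.2 := fun h' => hn (Or.inr ⟨h, h'⟩)
        omega
      · have := onesCount_pos (hM.2.xor.lt hL) (s := S.length)
          (fun h' => h (Nat.xor_eq_zero_iff.1 h').symm)
        omega
  · have hk := hI.1
    unfold entrySet
    rw [ivalSet_ival K (by omega), ivalSet_ival K (by omega), maskSet_xor S hM.2,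
      ← ivalSet_origin K ho]
    conv_lhs => rw [show I.2 = x + (I.2 - x) by omega, ivalSet_add]
    intro z hz
    simp only [Set.mem_insert_iff, Set.mem_union] at hz ⊢
    tauto

theorem origin_ival {k : ℕ} {I : ℕ × ℕ} (hI : ValidIval k I) {o : ℕ} (ho : o ∈ origins k I) :
    ival k o I.2 = I := by
  unfold origins at ho
  split_ifs at ho with h
  · unfold ival
    rw [if_pos (Or.inr h.2), ← hI.2.1 (Or.inr h.2)]
  · rw [List.mem_singleton] at ho
    rw [ho, hI.ival_eq]

theorem exists_origin (k : ℕ) (I : ℕ × ℕ) : ∃ o, o ∈ origins k I := by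
  unfold origins
  split_ifs with h
  · exact ⟨0, List.mem_range.2 (by omega)⟩
  · exact ⟨I.1, by simp⟩

/-- Soundness is checked for all partitions, but the upper bound needs only the one with all
terminals in the first part: the other two values `A` are then zero. More summands are not needed,
as the entries combined in `B` may themselves branch at `v`. -/
theorem reads_valueC (hc : TablesSound G w K S c) (hnd : (K ++ S).Nodup) (v : Fin N) {L : ℕ}
    (hL : L < 2 ^ S.length) {I : ℕ × ℕ} (hI : ValidIval K.length I)
    (hne : ¬ (L = 0 ∧ I.2 = 0)) :
    Reads c (valueC K S.length v L I) fun e =>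
      e.Sound G w (entrySet K S v L I) (sizeC N (onesCount S.length L + I.2)) ∧
      ∀ u, BoundA G w K S c v L I u e.len := by
  have ht : 0 < onesCount S.length L + I.2 := by
    by_cases h : L = 0
    · have : I.2 ≠ 0 := fun h2 => hne ⟨h, h2⟩
      omega
    · have := onesCount_pos hL h
      omega
  have hinf : (Entry.inf N).Sound G w (entrySet K S v L I)
      (sizeC N (onesCount S.length L + I.2)) := Entry.sound_inf _ (by unfold sizeC; omega)
  have hmono : ∀ b b' : ℝ≥0∞, b' ≤ b → (∀ u, BoundA G w K S c v L I u b) →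
      ∀ u, BoundA G w K S c v L I u b' := by
    intro b b' hb h u
    obtain ⟨h1, h2, h3⟩ := h u
    exact ⟨fun a a' => hb.trans (h1 a a'), fun i a a' => hb.trans (h2 i a a'),
      fun p a a' => hb.trans (h3 p a a')⟩
  refine (reads_submasks S.length L).bind ?_
  rintro _ rfl
  refine (reads_minimum (U := fun o b => ∀ u, BoundA G w K S c v L I u b)
    (P := fun e => e.Sound G w (entrySet K S v L I) (sizeC N (onesCount S.length L + I.2)))
    (fun o => hmono) hinf fun o ho => ?_).mono ?_
  swap
  · rintro e ⟨h1, h2⟩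
    obtain ⟨o, ho⟩ := exists_origin K.length I
    exact ⟨h1, h2 o ho⟩
  have hLL : L ∈ submaskList S.length L := mem_submaskList.2 ⟨hL, fun i h => h⟩
  -- From here on, the bound is asked only of the choice `L₁ = L`, `L₂ = 0`, with the whole interval
  -- in the first piece.
  refine (reads_minimum (U := fun M b => M = L → ∀ u, BoundA G w K S c v L I u b)
    (fun M b b' hb h hM => hmono b b' hb (h hM)) hinf fun M hM => ?_).mono
    fun e he => ⟨he.1, he.2 L hLL rfl⟩
  have hM' := mem_submaskList.1 hM
  refine (reads_submasks S.length (L ^^^ M)).bind ?_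
  rintro _ rfl
  refine (reads_minimum (U := fun M' b => M = L → M' = 0 → ∀ u, BoundA G w K S c v L I u b)
    (fun M' b b' hb h hM hM' => hmono b b' hb (h hM hM')) hinf fun M₂ hM₂ => ?_).mono
    fun e he => ⟨he.1, fun hML => he.2 0 (mem_submaskList.2
      ⟨by positivity, fun i => by simp⟩) hML rfl⟩
  have hM₂' := mem_submaskList.1 hM₂
  refine (reads_minimum (U := fun x b => M = L → M₂ = 0 → x = I.2 →
      ∀ u, BoundA G w K S c v L I u b)
    (fun x b b' hb h hM hM' hx => hmono b b' hb (h hM hM' hx)) hinf fun x hx => ?_).mono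
    fun e he => ⟨he.1, fun hML hM0 => he.2 I.2 (by simp) hML hM0 rfl⟩
  refine (reads_minimum (U := fun y b => M = L → M₂ = 0 → x = I.2 → y = 0 →
      ∀ u, BoundA G w K S c v L I u b)
    (fun y b b' hb h hM hM' hx hy => hmono b b' hb (h hM hM' hx hy)) hinf fun y hy => ?_).mono
    fun e he => ⟨he.1, fun hML hM0 hx => he.2 0 (by simp) hML hM0 hx rfl⟩
  rw [List.mem_range] at hx hy
  have hk := hI.1
  have hv1 := validIval_ival (k := K.length) (a := o) (l := x) (by omega)
  have hv2 := validIval_ival (k := K.length) (a := o + x) (l := y) (by omega)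
  have hv3 := validIval_ival (k := K.length) (a := o + x + y) (l := I.2 - x - y) (by omega)
  have hL3 : (L ^^^ M) ^^^ M₂ < 2 ^ S.length := hM₂'.2.xor.lt (hM'.2.xor.lt hL)
  refine (reads_valueA hc hnd v hM'.1 hv1).bind fun e₁ h₁ => ?_
  refine (reads_valueA hc hnd v hM₂'.1 hv2).bind fun e₂ h₂ => ?_
  refine (reads_valueA hc hnd v hL3 hv3).bind fun e₃ h₃ => ?_
  refine (reads_plus e₂ e₃).bind ?_
  rintro _ rfl
  refine (reads_plus e₁ _).mono ?_
  rintro _ rfl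
  constructor
  · have o1 := onesCount_xor (s := S.length) hM'.2
    have o2 := onesCount_xor (s := S.length) hM₂'.2
    obtain ⟨s₁, -⟩ := h₁
    obtain ⟨s₂, -⟩ := h₂
    obtain ⟨s₃, -⟩ := h₃
    have hsize := sizeC_of_sizeA N (t := onesCount S.length L + I.2)
      (a := onesCount S.length M + (ival K.length o x).2)
      (b := onesCount S.length M₂ + (ival K.length (o + x) y).2)
      (d := onesCount S.length ((L ^^^ M) ^^^ M₂) + (ival K.length (o + x + y) (I.2 - x - y)).2)
      (by rw [ival_snd, ival_snd, ival_snd]; omega) ht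
    generalize sizeC N (onesCount S.length L + I.2) = n at hsize ⊢
    generalize sizeA N (onesCount S.length M + (ival K.length o x).2) = n₁ at hsize s₁
    generalize sizeA N (onesCount S.length M₂ + (ival K.length (o + x) y).2) = n₂ at hsize s₂
    generalize sizeA N (onesCount S.length ((L ^^^ M) ^^^ M₂) +
      (ival K.length (o + x + y) (I.2 - x - y)).2) = n₃ at hsize s₃
    refine s₁.plus (s₂.plus s₃ (Set.mem_insert v _) (Set.mem_insert v _) le_rfl subset_rfl)
      (Set.mem_insert v _) (Or.inl (Set.mem_insert v _)) hsize ?_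
    · unfold entrySet
      rw [ivalSet_ival K (by omega), ivalSet_ival K (by omega), ivalSet_ival K (by omega),
        maskSet_xor S hM'.2, maskSet_xor S hM₂'.2, ← ivalSet_origin K ho]
      conv_lhs => rw [show I.2 = x + (y + (I.2 - x - y)) by omega, ivalSet_add, ivalSet_add]
      intro z hz
      simp only [Set.mem_insert_iff, Set.mem_union] at hz ⊢
      tauto
  · rintro rfl rfl rfl rfl u
    rw [h₂.2.1 ⟨rfl, ival_snd _ _ _⟩, h₃.2.1 ⟨by simp, by rw [ival_snd]; omega⟩]
    simp only [add_zero]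
    have := h₁.2.2
    rw [origin_ival hI ho] at this
    exact this hne u

end Spec

/-! ### Programs that fill the tables -/

/-- A loop invariant indexed by the part of the list already done. It has to ignore the step counter
(`hins`), because the loop itself ticks before each round. -/
theorem forEach_induct {N : ℕ} {ι : Type} {f : ι → Prog N Unit} (inv : List ι → Mem N → Prop)
    (hins : ∀ l m c, SameTables m c → inv l c → inv l m) {l : List ι}
    (h : ∀ l₁ i l₂, l = l₁ ++ i :: l₂ → ∀ m, inv l₁ m → inv (l₁ ++ [i]) (f i m).2)
    {m : Mem N} (h0 : inv [] m) : inv l (forEach l f m).2 := by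
  have key : ∀ l₂ l₁, l = l₁ ++ l₂ → ∀ m, inv l₁ m → inv l (forEach l₂ f m).2 := by
    intro l₂
    induction l₂ with
    | nil =>
      intro l₁ hl m hm
      rw [List.append_nil] at hl
      exact hl ▸ hm
    | cons i l₂ ih =>
      intro l₁ hl m hm
      exact ih (l₁ ++ [i]) (by simp [hl]) _
        (h l₁ i l₂ hl { m with steps := m.steps + 1 } (hins _ _ m ⟨rfl, rfl, rfl, rfl, rfl⟩ hm))
  exact key l [] rfl m h0

/-- When a loop over a range reaches `i`, all smaller values have been treated. This turns the order
of the loops into induction hypotheses. -/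
theorem range_eq_append {n i : ℕ} {l₁ l₂ : List ℕ} (h : List.range n = l₁ ++ i :: l₂) :
    i < n ∧ ∀ j < i, j ∈ l₁ := by
  have hlen := congrArg List.length h
  simp only [List.length_range, List.length_append, List.length_cons] at hlen
  have hi : l₁.length = i := by
    have h1 : (List.range n)[l₁.length]? = some i := by rw [h]; simp
    rw [List.getElem?_range (by omega)] at h1
    exact Option.some.inj h1
  refine ⟨by omega, fun j hj => ?_⟩
  have h1 : (l₁ ++ i :: l₂)[j]? = some j := by
    rw [← h, List.getElem?_range (by omega)]
  rw [List.getElem?_append_left (by omega)] at h1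
  exact List.mem_of_getElem? h1

theorem Reads.bind_induct {N : ℕ} {α : Type} {m : Mem N} {x : Prog N α} {f : α → Prog N Unit}
    {R : α → Prop} {Q : Mem N → Prop} (hx : Reads m x R)
    (hf : ∀ a m', R a → SameTables m' m → Q (f a m').2) : Q ((x >>= f) m).2 :=
  hf _ _ (hx m (.refl m)).1 (hx m (.refl m)).2

/-! ### Induction over the order of computation. -/

section Grow

variable {N : ℕ} (G : SimpleGraph (Fin N)) (w : Sym2 (Fin N) → ℝ≥0) (K S : List (Fin N))

/-- The table entry is good enough. -/
def EntryOpt (m : Mem N) (v : Fin N) (L : ℕ) (I : ℕ × ℕ) : Prop :=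
  (m.tabC v L I).len ≤ treeDist G w K S v L I

/-- Executed on `m`, the program keeps all good entries, and those in `A` become good. -/
def Grows (m : Mem N) (x : Prog N Unit) (A : Fin N → ℕ → ℕ × ℕ → Prop) : Prop :=
  TablesSound G w K S (x m).2 ∧
    (∀ v L I, EntryOpt G w K S m v L I → EntryOpt G w K S (x m).2 v L I) ∧
    ∀ v L I, A v L I → EntryOpt G w K S (x m).2 v L I

variable {G w K S} {ι α : Type}

theorem TablesSound.of_same {m c : Mem N} (h : SameTables m c) (hc : TablesSound G w K S c) :
    TablesSound G w K S m := by
  obtain ⟨h1, h2, h3, h4, h5⟩ := h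
  exact ⟨h1 ▸ hc.posK, h2 ▸ hc.posS, h3 ▸ hc.dist_len, h3 ▸ hc.dist, h4 ▸ hc.tabB, h5 ▸ hc.tabC⟩

theorem EntryOpt.of_same {m c : Mem N} (h : SameTables m c) {v : Fin N} {L : ℕ} {I : ℕ × ℕ}
    (hc : EntryOpt G w K S c v L I) : EntryOpt G w K S m v L I := by
  unfold EntryOpt
  rw [h.2.2.2.2]; exact hc

theorem Grows.mono {m : Mem N} {x : Prog N Unit} {A A' : Fin N → ℕ → ℕ × ℕ → Prop}
    (h : Grows G w K S m x A) (hA : ∀ v L I, A' v L I → A v L I) : Grows G w K S m x A' :=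
  ⟨h.1, h.2.1, fun v L I ha => h.2.2 v L I (hA v L I ha)⟩

theorem grows_return {m : Mem N} (hm : TablesSound G w K S m) :
    Grows G w K S m (pure ()) fun _ _ _ => False :=
  ⟨hm, fun _ _ _ h => h, fun _ _ _ h => h.elim⟩

theorem Reads.bind_grows {m : Mem N} {x : Prog N α} {f : α → Prog N Unit} {R : α → Prop}
    {A : Fin N → ℕ → ℕ × ℕ → Prop} (hx : Reads m x R) 
    (hf : ∀ a m', R a → SameTables m' m → Grows G w K S m' (f a) A) :
    Grows G w K S m (x >>= f) A := by
  obtain ⟨h1, h2⟩ := hx m (.refl m)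
  obtain ⟨h3, h4, h5⟩ := hf _ _ h1 h2
  exact ⟨h3, fun v L I h => h4 v L I (h.of_same h2), h5⟩

theorem Grows.bind {m : Mem N} {x y : Prog N Unit} 
    {A A' : Fin N → ℕ → ℕ × ℕ → Prop} (hx : Grows G w K S m x A) 
    (hy : ∀ m', TablesSound G w K S m' → Grows G w K S m' y A') :
    Grows G w K S m (x >>= fun _ => y) fun v L I => A v L I ∨ A' v L I := by
  obtain ⟨h3, h4, h5⟩ := hy _ hx.1
  refine ⟨h3, fun v L I h => h4 v L I (hx.2.1 v L I h), ?_⟩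
  rintro v L I (h | h)
  exacts [h4 v L I (hx.2.2 v L I h), h5 v L I h]

/-- Good entries stay good, so each round may rely on the entries good at the start and on those
that earlier rounds produced. -/
theorem Grows.forEach {l : List ι} {f : ι → Prog N Unit} {m₀ : Mem N}
    {A : ι → Fin N → ℕ → ℕ × ℕ → Prop} (hm₀ : TablesSound G w K S m₀)
    (h : ∀ l₁ i l₂, l = l₁ ++ i :: l₂ → ∀ m, TablesSound G w K S m →
      (∀ v L I, EntryOpt G w K S m₀ v L I → EntryOpt G w K S m v L I) →
      (∀ j ∈ l₁, ∀ v L I, A j v L I → EntryOpt G w K S m v L I) → Grows G w K S m (f i) (A i)) :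
    Grows G w K S m₀ (forEach l f) fun v L I => ∃ i ∈ l, A i v L I := by
  have key := forEach_induct (f := f) (l := l) (m := m₀)
    (fun l₁ m => TablesSound G w K S m ∧
      (∀ v L I, EntryOpt G w K S m₀ v L I → EntryOpt G w K S m v L I) ∧
      (∀ j ∈ l₁, ∀ v L I, A j v L I → EntryOpt G w K S m v L I)) ?_ ?_ ?_
  · refine ⟨key.1, key.2.1, ?_⟩
    rintro v L I ⟨i, hi, hA⟩
    exact key.2.2 i hi v L I hA
  · rintro l₁ m c hs ⟨h1, h2, h3⟩
    exact ⟨h1.of_same hs, fun v L I hh => (h2 v L I hh).of_same hs,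
      fun j hj v L I hh => (h3 j hj v L I hh).of_same hs⟩
  · rintro l₁ i l₂ hl m ⟨h1, h2, h3⟩
    obtain ⟨h4, h5, h6⟩ := h l₁ i l₂ hl m h1 h2 h3
    refine ⟨h4, fun v L I hh => h5 v L I (h2 v L I hh), fun j hj v L I hh => ?_⟩
    rcases List.mem_append.1 hj with hj | hj
    · exact h5 v L I (h3 j hj v L I hh)
    · rw [List.mem_singleton] at hj
      subst hj
      exact h6 v L I hh
  · exact ⟨hm₀, fun _ _ _ h => h, by simp⟩

theorem grows_writeC {m : Mem N} (hm : TablesSound G w K S m) {v : Fin N} {L : ℕ} {I : ℕ × ℕ}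
    {x : Entry N}
    (hx : x.Sound G w (entrySet K S v L I) (sizeC N (onesCount S.length L + I.2)))
    (hopt : x.len ≤ treeDist G w K S v L I) :
    Grows G w K S m (writeC v L I x) fun v' L' I' => v' = v ∧ L' = L ∧ I' = I := by
  have hC : ∀ v' L' I', (writeC v L I x m).2.tabC v' L' I' =
      if v' = v ∧ L' = L ∧ I' = I then x else m.tabC v' L' I' := fun _ _ _ => rfl
  refine ⟨⟨hm.posK, hm.posS, hm.dist_len, hm.dist, hm.tabB, fun v' L' I' => ?_⟩, ?_, ?_⟩
  · rw [hC]
    split_ifs with h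
    · obtain ⟨rfl, rfl, rfl⟩ := h
      exact hx
    · exact hm.tabC v' L' I'
  · intro v' L' I' h'
    unfold EntryOpt
    rw [hC]
    split_ifs with h
    · obtain ⟨rfl, rfl, rfl⟩ := h
      exact hopt
    · exact h'
  · rintro _ _ _ ⟨rfl, rfl, rfl⟩
    unfold EntryOpt
    rw [hC, if_pos ⟨rfl, rfl, rfl⟩]
    exact hopt

/-- The bound for `valueB` in terms of optimal trees. -/
def BoundB (G : SimpleGraph (Fin N)) (w : Sym2 (Fin N) → ℝ≥0) (K S : List (Fin N)) (L : ℕ)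
    (I : ℕ × ℕ) (v : Fin N) (b : ℝ≥0∞) : Prop :=
  ∀ o ∈ origins K.length I, ∀ M, Submask M L → ∀ x ≤ I.2,
    ¬ ((M = 0 ∧ x = 0) ∨ (M = L ∧ x = I.2)) →
    b ≤ treeDist G w K S v M (ival K.length o x) +
      treeDist G w K S v (L ^^^ M) (ival K.length (o + x) (I.2 - x))

/-- `hdep` is the order of computation: fewer inner terminals, or the same mask and a shorter
interval. The first loop leaves `tabC` alone and bounds `B` by good old entries; the second loop
combines these `B` with good old `C` through `le_treeDist_of_recurrence`. Entries are good only at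
vertices outside their own set, so this is checked for every entry used. -/
theorem grows_fillEntries (hK : Noncrossing G K) (hnd : (K ++ S).Nodup) {m₀ : Mem N}
    (hm₀ : TablesSound G w K S m₀) {L : ℕ} (hL : L < 2 ^ S.length) {I : ℕ × ℕ}
    (hI : ValidIval K.length I) (hne : (maskSet S L ∪ ivalSet K I).Nonempty)
    (hdep : ∀ L' I', L' < 2 ^ S.length → ValidIval K.length I' →
      (onesCount S.length L' < onesCount S.length L ∨ L' = L ∧ I'.2 < I.2) →
      ∀ v, v ∉ maskSet S L' → v ∉ ivalSet K I' → EntryOpt G w K S m₀ v L' I') :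
    Grows G w K S m₀ (fillEntries K S.length L I) fun v L' I' =>
      L' = L ∧ I' = I ∧ v ∉ maskSet S L ∧ v ∉ ivalSet K I := by
  have hndK : K.Nodup := (List.nodup_append.1 hnd).1
  have hne' : ¬ (L = 0 ∧ I.2 = 0) := by
    rintro ⟨rfl, h2⟩
    rw [maskSet_zero, ivalSet_of_snd_eq_zero h2] at hne
    simp at hne
  have hlt : ∀ M, Submask M L → M ≠ L → onesCount S.length M < onesCount S.length L := by
    intro M hM hML
    have h1 := onesCount_xor (s := S.length) hM
    have := onesCount_pos (hM.xor.lt hL) (s := S.length)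
      (fun h' => hML (Nat.xor_eq_zero_iff.1 h').symm)
    omega
  have hBE : ∀ m, TablesSound G w K S m → m.tabC = m₀.tabC → ∀ v, v ∉ maskSet S L →
      v ∉ ivalSet K I → Reads m (valueB K.length S.length v L I) fun e =>
        e.Sound G w (entrySet K S v L I) (sizeB N (onesCount S.length L + I.2)) ∧
        BoundB G w K S L I v e.len := by
    intro m hm hC v hvL hvI
    refine (reads_valueB hm v hL hI).mono fun e he => ⟨he.1, fun o ho M hM x hx hn => ?_⟩
    refine (he.2 o ho M (mem_submaskList.2 ⟨hM.lt hL, hM⟩) x (by simp; omega) hn).trans ?_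
    have hk := hI.1
    have hvI' := hvI
    rw [← ivalSet_origin K ho, show I.2 = x + (I.2 - x) by omega, ivalSet_add] at hvI'
    have hvL' := hvL
    rw [maskSet_xor S hM] at hvL'
    simp only [Set.mem_union, not_or] at hvI' hvL'
    rw [hC]
    refine add_le_add ?_ ?_
    · refine hdep M _ (hM.lt hL) (validIval_ival (by omega)) ?_ v hvL'.1 ?_
      · rw [ival_snd]
        by_cases h : M = L
        · exact Or.inr ⟨h, lt_of_le_of_ne hx fun h' => hn (Or.inr ⟨h, h'⟩)⟩
        · exact Or.inl (hlt M hM h)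
      · rw [ivalSet_ival K (by omega)]; exact hvI'.1
    · refine hdep (L ^^^ M) _ (hM.xor.lt hL) (validIval_ival (by omega)) ?_ v hvL'.2 ?_
      · rw [ival_snd]
        -- If the second part has the whole mask, then `M = 0`. The first part is not empty, so `x >
        -- 0` and the remaining interval is shorter.
        by_cases h : L ^^^ M = L
        · have hM0 : M = 0 := by simpa using h
          have : x ≠ 0 := fun h' => hn (Or.inl ⟨hM0, h'⟩)
          exact Or.inr ⟨h, by omega⟩
        · exact Or.inl (hlt _ hM.xor h)
      · rw [ivalSet_ival K (by omega)]; exact hvI'.2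
  unfold fillEntries
  set loop₁ : Prog N Unit := forEach (List.finRange N) fun v => do
    if (← memL v L) || (← memI K.length v I) then
      return ()
    else
      let x ← valueB K.length S.length v L I
      writeB v L I x with hloop₁
  have h₁ : TablesSound G w K S (loop₁ m₀).2 ∧ (loop₁ m₀).2.tabC = m₀.tabC ∧
      ∀ v ∈ List.finRange N, v ∉ maskSet S L → v ∉ ivalSet K I →
        BoundB G w K S L I v ((loop₁ m₀).2.tabB v L I).len := by
    let inv : List (Fin N) → Mem N → Prop := fun l₁ m => TablesSound G w K S m ∧
      m.tabC = m₀.tabC ∧ ∀ v ∈ l₁, v ∉ maskSet S L → v ∉ ivalSet K I →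
        BoundB G w K S L I v (m.tabB v L I).len
    refine forEach_induct inv ?_ ?_ ⟨hm₀, rfl, by simp⟩
    · rintro l₁ m c hs ⟨h1, h2, h3⟩
      exact ⟨h1.of_same hs, hs.2.2.2.2.trans h2, by rw [hs.2.2.2.1]; exact h3⟩
    · rintro l₁ v l₂ - m ⟨h1, h2, h3⟩
      refine (reads_memL h1.posS v L).bind_induct (Q := inv (l₁ ++ [v])) fun b m₁ hb hs₁ => ?_
      replace h1 := h1.of_same hs₁
      rw [← hs₁.2.2.2.1] at h3
      rw [← hs₁.2.2.2.2] at h2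
      refine (reads_memI h1.posK v hI).bind_induct (Q := inv (l₁ ++ [v])) fun b' m₂ hb' hs₂ => ?_
      replace h1 := h1.of_same hs₂
      rw [← hs₂.2.2.2.1] at h3
      rw [← hs₂.2.2.2.2] at h2
      have hor : (b || b') = true ↔ v ∈ maskSet S L ∨ v ∈ ivalSet K I := by
        rw [Bool.or_eq_true, hb.1, hb']
      split_ifs with hbb
      · refine ⟨h1, h2, fun v' hv' hvL hvI => ?_⟩
        rcases List.mem_append.1 hv' with hv' | hv'
        · exact h3 v' hv' hvL hvI
        · rw [List.mem_singleton] at hv'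
          subst hv'
          exact ((hor.1 hbb).elim hvL hvI).elim
      · rw [hor, not_or] at hbb
        refine (hBE m₂ h1 h2 v hbb.1 hbb.2).bind_induct (Q := inv (l₁ ++ [v])) fun x m₃ hx hs₃ => ?_
        replace h1 := h1.of_same hs₃
        rw [← hs₃.2.2.2.1] at h3
        rw [← hs₃.2.2.2.2] at h2
        have hB : ∀ v' L' I', (writeB v L I x m₃).2.tabB v' L' I' =
          if v' = v ∧ L' = L ∧ I' = I then x else m₃.tabB v' L' I' := fun _ _ _ => rfl
        refine ⟨⟨h1.posK, h1.posS, h1.dist_len, h1.dist, fun v' L' I' => ?_, h1.tabC⟩, h2, ?_⟩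
        · rw [hB]
          split_ifs with h
          · obtain ⟨rfl, rfl, rfl⟩ := h
            exact hx.1
          · exact h1.tabB v' L' I'
        · intro v' hv' hvL hvI
          rw [hB]
          split_ifs with h
          · obtain ⟨rfl, -, -⟩ := h
            exact hx.2
          · refine h3 v' ((List.mem_append.1 hv').resolve_right fun h' => ?_) hvL hvI
            exact h ⟨List.mem_singleton.1 h', rfl, rfl⟩
  obtain ⟨hs₁, hC₁, hB₁⟩ := h₁
  set m₁ := (loop₁ m₀).2
  have hdep₁ : ∀ v L' I', EntryOpt G w K S m₀ v L' I' → EntryOpt G w K S m₁ v L' I' := by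
    intro v L' I' h
    unfold EntryOpt
    rw [hC₁]; exact h
  set loop₂ : Prog N Unit := forEach (List.finRange N) fun v => do
    if (← memL v L) || (← memI K.length v I) then
      return ()
    else
      let x ← valueC K S.length v L I
      writeC v L I x with hloop₂
  have h₂ : TablesSound G w K S (loop₂ m₁).2 ∧
      (∀ v L' I', EntryOpt G w K S m₁ v L' I' → EntryOpt G w K S (loop₂ m₁).2 v L' I') ∧
      (loop₂ m₁).2.tabB = m₁.tabB ∧
      ∀ v ∈ List.finRange N, v ∉ maskSet S L → v ∉ ivalSet K I →
        EntryOpt G w K S (loop₂ m₁).2 v L I := by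
    let inv : List (Fin N) → Mem N → Prop := fun l₁ m => TablesSound G w K S m ∧
      (∀ v L' I', EntryOpt G w K S m₁ v L' I' → EntryOpt G w K S m v L' I') ∧
      m.tabB = m₁.tabB ∧
      ∀ v ∈ l₁, v ∉ maskSet S L → v ∉ ivalSet K I → EntryOpt G w K S m v L I
    refine forEach_induct inv ?_ ?_ ⟨hs₁, fun _ _ _ h => h, rfl, by simp⟩
    · rintro l₁ m c hs ⟨h1, h2, h3, h4⟩
      exact ⟨h1.of_same hs, fun v L' I' h => (h2 v L' I' h).of_same hs,
        hs.2.2.2.1.trans h3, fun v hv hvL hvI => (h4 v hv hvL hvI).of_same hs⟩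
    · rintro l₁ v l₂ - m ⟨h1, h2, h3, h4⟩
      refine (reads_memL h1.posS v L).bind_induct (Q := inv (l₁ ++ [v])) fun b m₂ hb hs₂ => ?_
      refine (reads_memI (h1.of_same hs₂).posK v hI).bind_induct (Q := inv (l₁ ++ [v])) fun b' m₃ hb' hs₃ => ?_
      have hs := hs₃.trans hs₂
      have hor : (b || b') = true ↔ v ∈ maskSet S L ∨ v ∈ ivalSet K I := by
        rw [Bool.or_eq_true, hb.1, hb']
      split_ifs with hbb
      · refine ⟨h1.of_same hs, fun v L' I' h => (h2 v L' I' h).of_same hs,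
          hs.2.2.2.1.trans h3, fun v' hv' hvL hvI => ?_⟩
        rcases List.mem_append.1 hv' with hv' | hv'
        · exact (h4 v' hv' hvL hvI).of_same hs
        · rw [List.mem_singleton] at hv'
          subst hv'
          exact ((hor.1 hbb).elim hvL hvI).elim
      · rw [hor, not_or] at hbb
        refine (reads_valueC (h1.of_same hs) hnd v hL hI hne').bind_induct (Q := inv (l₁ ++ [v]))
          fun x m₄ hx hs₄ => ?_
        have hopt : x.len ≤ treeDist G w K S v L I := by
          refine le_treeDist_of_recurrence hK hndK hI hne (valB := fun u => (m₁.tabB u L I).len)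
            (fun u huL huI => hB₁ u (List.mem_finRange u) huL huI) ?_ ?_ ?_
          · intro u huL huI
            have := (hx.2 u).1 huL huI
            rwa [hs.2.2.2.1, h3] at this
          · intro i u hi hLi
            refine ((hx.2 u).2.1 i hi hLi).trans ?_
            gcongr
            have his : i < S.length := (List.getElem?_eq_some_iff.1 hi).1
            have hsub := submask_two_pow hLi
            -- Once `u` is removed from the mask, it lies outside the set of the entry that is read.
            refine (h2 u _ I (hdep₁ u _ I (hdep (L ^^^ 2 ^ i) I (hsub.xor.lt hL) hI
              (Or.inl (hlt _ hsub.xor ?_)) u ?_ ?_))).of_same hs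
            · intro h
              simp at h
            · rintro ⟨j, hj, hji⟩
              have hij : j = i := by
                have hjs : j < S.length := (List.getElem?_eq_some_iff.1 hj).1
                rw [List.getElem?_eq_getElem hjs] at hj
                rw [List.getElem?_eq_getElem his, ← hj] at hi
                exact ((List.nodup_append.1 hnd).2.1.getElem_inj_iff.1
                  (Option.some.inj hi)).symm
              subst hij
              simp [Nat.testBit_xor, hLi] at hji
            · intro huI
              exact (List.nodup_append.1 hnd).2.2 u (ivalSet_subset K I huI) u
                (List.mem_of_getElem? hi) rfl
          · intro hpos p hp u hu
            refine ((hx.2 u).2.2 p hp hu).trans ?_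
            gcongr
            have hk := hI.1
            refine (h2 p _ _ (hdep₁ p _ _ (hdep L _ hL (validIval_ival (by omega))
              (Or.inr ⟨rfl, by rw [ival_snd]; omega⟩) p ?_ (hI.notMem_tail hndK hpos hp)))).of_same
              hs
            intro hpL
            exact (List.nodup_append.1 hnd).2.2 p (List.mem_of_getElem? hp) p
              (maskSet_subset S L hpL) rfl
        have hs' := hs₄.trans hs
        obtain ⟨g1, g2, g3⟩ := grows_writeC (h1.of_same hs') hx.1 hopt
        refine ⟨g1, fun v' L' I' h => g2 _ _ _ ((h2 v' L' I' h).of_same hs'),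
          hs'.2.2.2.1.trans h3, fun v' hv' hvL hvI => ?_⟩
        rcases List.mem_append.1 hv' with hv' | hv'
        · exact g2 _ _ _ ((h4 v' hv' hvL hvI).of_same hs')
        · rw [List.mem_singleton] at hv'
          exact g3 v' L I ⟨hv', rfl, rfl⟩
  obtain ⟨k1, k2, -, k3⟩ := h₂
  refine ⟨k1, fun v L' I' h => k2 v L' I' (hdep₁ v L' I' h), ?_⟩
  rintro v _ _ ⟨rfl, rfl, hvL, hvI⟩
  exact k3 v (List.mem_finRange v) hvL hvI

theorem exists_start (k a : ℕ) {l : ℕ} (hl : l ≤ k) : ∃ a' ∈ starts k l, ival k a' l = ival k a l := by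
  unfold starts ival
  split_ifs with h
  · exact ⟨0, by simp, rfl⟩
  · exact ⟨a % k, List.mem_range.2 (Nat.mod_lt _ (by omega)), by rw [Nat.mod_mod]⟩

theorem nonempty_terminals {L : ℕ} (hL : L < 2 ^ S.length) {I : ℕ × ℕ} (hI : ValidIval K.length I)
    (h : 0 < onesCount S.length L + I.2) : (maskSet S L ∪ ivalSet K I).Nonempty := by
  rcases Nat.eq_zero_or_pos I.2 with h0 | hpos
  · obtain ⟨i, hi⟩ : ∃ i, L.testBit i = true := by
      by_contra hne
      push Not at hne
      have : L = 0 := Nat.eq_of_testBit_eq (by simpa using hne)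
      rw [this, onesCount_zero] at h
      omega
    have his : i < S.length := by
      by_contra hlt
      have := Nat.ge_two_pow_of_testBit hi
      have : 2 ^ S.length ≤ 2 ^ i := Nat.pow_le_pow_right (by norm_num) (not_lt.1 hlt)
      omega
    exact ⟨S[i], Or.inl ⟨i, List.getElem?_eq_getElem his, hi⟩⟩
  · have hp : K[I.1]? = some (K[I.1]'(hI.fst_lt hpos)) := List.getElem?_eq_getElem (hI.fst_lt hpos)
    exact ⟨_, Or.inr (by rw [hI.ivalSet_eq_insert hpos hp]; exact Set.mem_insert _ _)⟩

/-- One nested `Grows.forEach` for each of the loops over size, mask, interval length and start.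
`starts` meets every normalized interval of a given length, so nothing is skipped. -/
theorem grows_fillTables (hK : Noncrossing G K) (hnd : (K ++ S).Nodup) {m₀ : Mem N}
    (hm₀ : TablesSound G w K S m₀)
    (hbase : ∀ v L I, L < 2 ^ S.length → ValidIval K.length I →
      onesCount S.length L + I.2 ≤ 1 → EntryOpt G w K S m₀ v L I) :
    Grows G w K S m₀ (fillTables K S.length) fun v L I => L < 2 ^ S.length ∧
      onesCount S.length L ≤ S.length ∧
      ValidIval K.length I ∧ 2 ≤ onesCount S.length L + I.2 ∧ v ∉ maskSet S L ∧
      v ∉ ivalSet K I := by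
  refine (Grows.forEach (A := fun i v L I => L < 2 ^ S.length ∧ onesCount S.length L = i ∧
    ValidIval K.length I ∧ 2 ≤ i + I.2 ∧ v ∉ maskSet S L ∧ v ∉ ivalSet K I) hm₀
    fun l₁ i l₂ hl₁ m₁ hm₁ hext₁ hdone₁ => ?_).mono ?_
  swap
  · rintro v L I ⟨h1, h2, h3, h4, h5, h6⟩
    exact ⟨onesCount S.length L, by simp; omega, h1, rfl, h3, h4, h5, h6⟩
  refine (Grows.forEach (A := fun L v L' I => L' = L ∧ onesCount S.length L = i ∧
    ValidIval K.length I ∧ 2 ≤ i + I.2 ∧ v ∉ maskSet S L ∧ v ∉ ivalSet K I) hm₁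
    fun l₃ L l₄ hl₃ m₂ hm₂ hext₂ _ => ?_).mono ?_
  swap
  · rintro v L I ⟨h1, h2⟩
    exact ⟨L, List.mem_range.2 h1, rfl, h2⟩
  have hL := (range_eq_append hl₃).1
  refine (reads_popcount S.length L).bind_grows ?_
  rintro _ m₃ rfl hs₃
  have hm₃ := hm₂.of_same hs₃
  have hext₃ : ∀ v L I, EntryOpt G w K S m₁ v L I → EntryOpt G w K S m₃ v L I :=
    fun v L I h => (hext₂ v L I h).of_same hs₃
  by_cases hLi : onesCount S.length L = i
  swap
  · rw [if_neg hLi]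
    exact (grows_return hm₃).mono fun v L' I h => hLi h.2.1
  rw [if_pos hLi]
  refine (Grows.forEach (A := fun j v L' I => L' = L ∧ I.2 = j ∧
    ValidIval K.length I ∧ 2 ≤ i + I.2 ∧ v ∉ maskSet S L ∧ v ∉ ivalSet K I) hm₃
    fun l₅ j l₆ hl₅ m₄ hm₄ hext₄ hdone₄ => ?_).mono ?_
  swap
  · rintro v L' I ⟨rfl, h1, h2, h3⟩
    exact ⟨I.2, List.mem_range.2 (by have := h2.1; omega), rfl, rfl, h2, h3⟩
  have hj := (range_eq_append hl₅).1
  by_cases hij : 2 ≤ i + j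
  swap
  · rw [if_neg hij]
    refine (grows_return hm₄).mono fun v L' I h => hij ?_
    have h1 := h.2.1
    have h2 := h.2.2.2.1
    omega
  rw [if_pos hij]
  refine (Grows.forEach (A := fun a v L' I => L' = L ∧ I = ival K.length a j ∧
    v ∉ maskSet S L ∧ v ∉ ivalSet K I) hm₄
    fun l₇ a l₈ hl₇ m₅ hm₅ hext₅ _ => ?_).mono ?_
  swap
  · rintro v L' I ⟨rfl, rfl, h2, h3, h4, h5⟩
    obtain ⟨a, ha, haI⟩ := exists_start K.length I.1 h2.1
    exact ⟨a, ha, rfl, by rw [haI, h2.ival_eq], h4, h5⟩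
  have hIv : ValidIval K.length (ival K.length a j) := validIval_ival (by omega)
  refine (grows_fillEntries hK hnd hm₅ hL hIv (nonempty_terminals hL hIv (by
    rw [ival_snd]; omega)) ?_).mono ?_
  · intro L' I' hL' hI' hlt v hvL hvI
    rw [ival_snd] at hlt
    -- Entries with at least two terminals come from an earlier mask size, or from a shorter
    -- interval for the same mask; the smaller ones are base cases.
    by_cases h2 : 2 ≤ onesCount S.length L' + I'.2
    · rcases hlt with hlt | ⟨rfl, hlt⟩
      · exact hext₅ _ _ _ <| hext₄ _ _ _ <| hext₃ _ _ _ <|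
          hdone₁ (onesCount S.length L') ((range_eq_append hl₁).2 _ (by omega)) v L' I'
            ⟨hL', rfl, hI', h2, hvL, hvI⟩
      · exact hext₅ _ _ _ <| hdone₄ I'.2 ((range_eq_append hl₅).2 _ hlt) v L' I'
          ⟨rfl, rfl, hI', by omega, hvL, hvI⟩
    · exact hext₅ _ _ _ <| hext₄ _ _ _ <| hext₃ _ _ _ <| hext₁ _ _ _ <|
        hbase v L' I' hL' hI' (by omega)
  · rintro v L' I ⟨h1, rfl, h3, h4⟩
    exact ⟨h1, rfl, h3, h4⟩

end Grow

end SteinerDP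

/-! ### All shortest paths -/

theorem SimpleGraph.Walk.IsPath.append_of_disjoint {V : Type} {G : SimpleGraph V} {u x v : V}
    {p : G.Walk u x} {q : G.Walk x v} (hp : p.IsPath) (hq : q.IsPath)
    (h : ∀ y ∈ p.support, y ∈ q.support → y = x) : (p.append q).IsPath := by
  refine SimpleGraph.Walk.IsPath.mk' ?_
  have hq' := hq.support_nodup
  rw [SimpleGraph.Walk.support_append]
  rw [← q.cons_tail_support, List.nodup_cons] at hq'
  refine List.nodup_append.2 ⟨hp.support_nodup, hq'.2, ?_⟩
  rintro y hy _ hy' rfl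
  have := h y hy (List.mem_of_mem_tail hy')
  exact hq'.1 (this ▸ hy')

theorem walkLength_bypass_le {V : Type} [DecidableEq V] {G : SimpleGraph V} (w : Sym2 V → ℝ≥0)
    {u v : V} (p : G.Walk u v) : walkLength w p.bypass ≤ walkLength w p :=
  (p.edges_bypass_sublist_edges.map w).sum_le_sum (by simp)

theorem subgraphLength_toSubgraph_le {V : Type} [Fintype V] {G : SimpleGraph V}
    (w : Sym2 V → ℝ≥0) {u v : V} (p : G.Walk u v) (hp : p.IsPath) :
    subgraphLength w p.toSubgraph ≤ walkLength w p := by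
  classical
  unfold subgraphLength walkLength
  rw [← List.sum_toFinset w hp.isTrail.edges_nodup]
  refine le_of_eq (Finset.sum_congr ?_ fun _ _ => rfl)
  ext e
  simp

namespace SteinerDP

section FloydWarshall

variable {N : ℕ} {G : SimpleGraph (Fin N)} {w : Sym2 (Fin N) → ℝ≥0}

/-- The inner vertices of the walk are smaller than `x`. -/
def InnerLT (x : ℕ) {u v : Fin N} (p : G.Walk u v) : Prop :=
  ∀ y ∈ p.support, y = u ∨ y = v ∨ y.val < x

/-- The entry is a shortest path among those with inner vertices smaller than `x`. -/
def ShortestLT (G : SimpleGraph (Fin N)) (w : Sym2 (Fin N) → ℝ≥0) (x : ℕ) (u v : Fin N)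
    (e : Entry N) : Prop :=
  (∀ p : G.Walk u v, InnerLT x p → e.len ≤ walkLength w p) ∧
  (e.len = ⊤ ∧ e.tree.size = 1 ∨ ∃ p : G.Walk u v, p.IsPath ∧ InnerLT x p ∧
    e.len = walkLength w p ∧ e.tree.edges = {e | e ∈ p.edges} ∧
    e.tree.size + 1 ≤ 2 * max p.length 1)

/-- An endpoint does not count as an inner vertex, so allowing `x` changes nothing for pairs that
involve `x`. Updating the distance table in place is therefore harmless: it makes no difference
whether row or column `x` is read before or after its own update. -/
theorem ShortestLT.of_succ_left {x u : Fin N} {e : Entry N}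
    (h : ShortestLT G w (x + 1) x u e) : ShortestLT G w x x u e := by
  refine ⟨fun p hp => h.1 p fun y hy => ?_, h.2.imp id ?_⟩
  · rcases hp y hy with h | h | h
    exacts [Or.inl h, Or.inr (Or.inl h), Or.inr (Or.inr (by omega))]
  · rintro ⟨p, h1, h2, h3⟩
    refine ⟨p, h1, fun y hy => ?_, h3⟩
    rcases h2 y hy with h | h | h
    · exact Or.inl h
    · exact Or.inr (Or.inl h)
    · by_cases hyx : y = x
      · exact Or.inl hyx
      · exact Or.inr (Or.inr (by have := Fin.val_ne_of_ne hyx; omega))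

theorem ShortestLT.of_succ_right {x u : Fin N} {e : Entry N}
    (h : ShortestLT G w (x + 1) u x e) : ShortestLT G w x u x e := by
  refine ⟨fun p hp => h.1 p fun y hy => ?_, h.2.imp id ?_⟩
  · rcases hp y hy with h | h | h
    exacts [Or.inl h, Or.inr (Or.inl h), Or.inr (Or.inr (by omega))]
  · rintro ⟨p, h1, h2, h3⟩
    refine ⟨p, h1, fun y hy => ?_, h3⟩
    rcases h2 y hy with h | h | h
    · exact Or.inl h
    · exact Or.inr (Or.inl h)
    · by_cases hyx : y = x
      · exact Or.inr (Or.inl hyx)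
      · exact Or.inr (Or.inr (by have := Fin.val_ne_of_ne hyx; omega))

/-- Replacing an entry by a strictly shorter connection through `x`. -/
theorem ShortestLT.step {x u v : Fin N} {e e₁ e₂ : Entry N} (h : ShortestLT G w x u v e)
    (h₁ : ShortestLT G w x u x e₁) (h₂ : ShortestLT G w x x v e₂) :
    ShortestLT G w (x + 1) u v
      (if (⟨e₁.len + e₂.len, Rope.join e₁.tree e₂.tree⟩ : Entry N).len < e.len then
        ⟨e₁.len + e₂.len, Rope.join e₁.tree e₂.tree⟩ else e) := by
  set new : Entry N := ⟨e₁.len + e₂.len, Rope.join e₁.tree e₂.tree⟩ with hnew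
  have hlen : (if new.len < e.len then new else e).len ≤ e.len ∧
      (if new.len < e.len then new else e).len ≤ e₁.len + e₂.len := by
    split_ifs with hlt
    · exact ⟨hlt.le, le_rfl⟩
    · exact ⟨le_rfl, not_lt.1 hlt⟩
  constructor
  · intro p hp
    -- A simple path visits `x` at most once, so cutting it there gives two halves whose inner
    -- vertices are smaller than `x`.
    have hq := p.bypass_isPath
    have hqs : InnerLT (x + 1) p.bypass := fun y hy => hp y (p.support_bypass_subset_support hy)
    have hle : (walkLength w p.bypass : ℝ≥0∞) ≤ walkLength w p := by
      exact_mod_cast walkLength_bypass_le w p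
    refine le_trans ?_ hle
    generalize p.bypass = q at hq hqs
    by_cases hin : InnerLT x q
    · exact hlen.1.trans (h.1 q hin)
    have hx : x ∈ q.support ∧ u ≠ x ∧ v ≠ x := by
      unfold InnerLT at hin
      push Not at hin
      obtain ⟨y, hy, hyu, hyv, hyx⟩ := hin
      have hyx' : y = x := by
        rcases hqs y hy with h | h | h
        exacts [(hyu h).elim, (hyv h).elim, Fin.ext (by omega)]
      subst hyx'
      exact ⟨hy, fun h => hyu h.symm, fun h => hyv h.symm⟩
    obtain ⟨hxq, hux, hvx⟩ := hx
    obtain ⟨q₁, q₂, hq₁, hq₂, rfl⟩ := hq.mem_support_iff_exists_append.1 hxq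
    have i₁ : InnerLT x q₁ := by
      intro y hy
      by_cases hyx : y = x
      · exact Or.inr (Or.inl hyx)
      rcases hqs y (by simp [hy]) with h | h | h
      · exact Or.inl h
      · subst h
        exact (hq.ne_of_mem_support_of_append hvx hy q₂.end_mem_support rfl).elim
      · exact Or.inr (Or.inr (by have := Fin.val_ne_of_ne hyx; omega))
    have i₂ : InnerLT x q₂ := by
      intro y hy
      by_cases hyx : y = x
      · exact Or.inl hyx
      rcases hqs y (by simp [hy]) with h | h | h
      · subst h
        exact (hq.ne_of_mem_support_of_append hux q₁.start_mem_support hy rfl).elim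
      · exact Or.inr (Or.inl h)
      · exact Or.inr (Or.inr (by have := Fin.val_ne_of_ne hyx; omega))
    refine hlen.2.trans ?_
    rw [walkLength_append]
    push_cast
    exact add_le_add (h₁.1 q₁ i₁) (h₂.1 q₂ i₂)
  · split_ifs with hlt
    swap
    · refine h.2.imp id ?_
      rintro ⟨p, h1, h2, h3⟩
      refine ⟨p, h1, fun y hy => ?_, h3⟩
      rcases h2 y hy with h | h | h
      exacts [Or.inl h, Or.inr (Or.inl h), Or.inr (Or.inr (by omega))]
    right
    have hne : e₁.len ≠ ⊤ ∧ e₂.len ≠ ⊤ := by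
      have := (lt_of_lt_of_le hlt le_top).ne
      simpa [hnew] using this
    obtain ⟨p₁, hp₁, i₁, l₁, ed₁, s₁⟩ := h₁.2.resolve_left fun h => hne.1 h.1
    obtain ⟨p₂, hp₂, i₂, l₂, ed₂, s₂⟩ := h₂.2.resolve_left fun h => hne.2 h.1
    have hlt' : (walkLength w p₁ + walkLength w p₂ : ℝ≥0∞) < e.len := by
      rw [← l₁, ← l₂]; exact hlt
    have hux : u ≠ x := by
      rintro rfl
      refine (hlt'.trans_le ((h.1 p₂ i₂).trans le_add_self)).false
    have hvx : v ≠ x := by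
      rintro rfl
      refine (hlt'.trans_le ((h.1 p₁ i₁).trans le_self_add)).false
    -- Here the strict comparison matters. Were `y ≠ x` on both halves, a shortcut at `y` would
    -- avoid `x` and be no longer than the detour, so the detour could not beat the old entry. Hence
    -- the stored connection is again a simple path.
    have hdisj : ∀ y ∈ p₁.support, y ∈ p₂.support → y = x := by
      intro y hy₁ hy₂
      by_contra hyx
      obtain ⟨q₁, r₁, hq₁, hr₁, rfl⟩ := hp₁.mem_support_iff_exists_append.1 hy₁
      obtain ⟨r₂, q₂, hr₂, hq₂, rfl⟩ := hp₂.mem_support_iff_exists_append.1 hy₂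
      have hin : InnerLT x (q₁.append q₂) := by
        intro z hz
        rcases (SimpleGraph.Walk.mem_support_append_iff _ _).1 hz with hz | hz
        · rcases i₁ z (by simp [hz]) with h | h | h
          · exact Or.inl h
          · subst h
            exact (hp₁.ne_of_mem_support_of_append (Ne.symm hyx) hz r₁.end_mem_support rfl).elim
          · exact Or.inr (Or.inr h)
        · rcases i₂ z (by simp [hz]) with h | h | h
          · subst h
            exact (hp₂.ne_of_mem_support_of_append (Ne.symm hyx) r₂.start_mem_support hz rfl).elim
          · exact Or.inr (Or.inl h)
          · exact Or.inr (Or.inr h)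
      refine (hlt'.trans_le ((h.1 _ hin).trans ?_)).false
      rw [walkLength_append, walkLength_append, walkLength_append]
      push_cast
      exact add_le_add le_self_add le_add_self
    have hlen₁ : 1 ≤ p₁.length := by
      by_contra h0
      exact hux (SimpleGraph.Walk.eq_of_length_eq_zero (p := p₁) (by omega))
    have hlen₂ : 1 ≤ p₂.length := by
      by_contra h0
      exact hvx (SimpleGraph.Walk.eq_of_length_eq_zero (p := p₂) (by omega)).symm
    refine ⟨p₁.append p₂, hp₁.append_of_disjoint hp₂ hdisj, ?_, ?_, ?_, ?_⟩
    · intro z hz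
      rcases (SimpleGraph.Walk.mem_support_append_iff _ _).1 hz with hz | hz
      · rcases i₁ z hz with h | h | h
        · exact Or.inl h
        · exact Or.inr (Or.inr (by rw [h]; omega))
        · exact Or.inr (Or.inr (by omega))
      · rcases i₂ z hz with h | h | h
        · exact Or.inr (Or.inr (by rw [h]; omega))
        · exact Or.inr (Or.inl h)
        · exact Or.inr (Or.inr (by omega))
    · rw [walkLength_append]
      push_cast
      rw [← l₁, ← l₂]
    · ext z
      simp [hnew, Rope.edges, ed₁, ed₂]
    · rw [SimpleGraph.Walk.length_append]
      simp only [hnew, Rope.size]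
      -- A path with `a ≥ 1` edges has at most `2a - 1` nodes; joining two such structures adds one
      -- node and keeps this form.
      rw [max_eq_left hlen₁] at s₁
      rw [max_eq_left hlen₂] at s₂
      omega

/-- The entry for a pair of vertices before any inner vertex is allowed. -/
noncomputable def initialEntry (G : SimpleGraph (Fin N)) [DecidableRel G.Adj]
    (w : Sym2 (Fin N) → ℝ≥0) (u v : Fin N) : Entry N :=
  if u = v then Entry.zero N
  else if G.Adj u v then ⟨(w s(u, v) : ℝ≥0∞), Rope.edge u v⟩
  else Entry.inf N

theorem shortestLT_initialEntry [DecidableRel G.Adj] (u v : Fin N) :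
    ShortestLT G w 0 u v (initialEntry G w u v) := by
  unfold initialEntry
  split_ifs with h1 h2
  · subst h1
    exact ⟨fun p _ => by simp [Entry.zero], Or.inr ⟨.nil, by simp, fun y hy => by
      left; simpa using hy, by simp [Entry.zero], by simp [Entry.zero, Rope.edges],
      by simp [Entry.zero, Rope.size]⟩⟩
  · refine ⟨fun p hp => ?_, Or.inr ⟨.cons h2 .nil, by simp [h1], ?_, by simp,
      by simp [Rope.edges], by simp [Rope.size]⟩⟩
    · cases p with
      | nil => exact (h1 rfl).elim
      | @cons _ z _ h q =>
        rcases hp z (by simp) with h' | h' | h'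
        · exact (h.ne h'.symm).elim
        · subst h'
          rw [walkLength_cons]
          push_cast
          exact le_self_add
        · omega
    · intro y hy
      simp at hy
      tauto
  · refine ⟨fun p hp => ?_, Or.inl ⟨rfl, rfl⟩⟩
    cases p with
    | nil => exact (h1 rfl).elim
    | @cons _ z _ h q =>
      rcases hp z (by simp) with h' | h' | h'
      · exact (h.ne h'.symm).elim
      · exact (h2 (h' ▸ h)).elim
      · omega

/-- Once all inner vertices are allowed, every walk competes, and connectedness makes the length
finite. The stored path is simple, so it has fewer than `N` edges, which gives the size bound `2 *
N`. -/
theorem ShortestLT.len_eq (hG : G.Connected) {u v : Fin N} {e : Entry N}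
    (h : ShortestLT G w N u v e) : e.len = lengthDist G w u v ∧ e.Sound G w {u, v} (2 * N) := by
  have hin : ∀ p : G.Walk u v, InnerLT N p := fun p y _ => Or.inr (Or.inr y.isLt)
  have hle : e.len ≤ lengthDist G w u v := le_iInf fun p => h.1 p (hin p)
  have hfin : e.len ≠ ⊤ := by
    obtain ⟨p⟩ := hG.preconnected u v
    exact ((h.1 p (hin p)).trans_lt ENNReal.coe_lt_top).ne
  obtain ⟨p, hp, -, hl, hed, hs⟩ := h.2.resolve_left fun h => hfin h.1
  have hN := hp.length_lt
  rw [Fintype.card_fin] at hN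
  refine ⟨le_antisymm hle (hl ▸ lengthDist_le w p), fun _ => ⟨p.toSubgraph,
    p.toSubgraph_connected, ?_, ?_, ?_⟩, ?_⟩
  · rintro z (rfl | rfl)
    · exact p.start_mem_verts_toSubgraph
    · exact p.end_mem_verts_toSubgraph
  · rw [hed]
    ext z
    exact p.mem_edges_toSubgraph
  · rw [hl]
    exact_mod_cast subgraphLength_toSubgraph_le w p hp
  · have : max p.length 1 ≤ N := by omega
    omega

/-- The memories agree except for the step counter and the distances. -/
def SameButDist (m c : Mem N) : Prop :=
  m.posK = c.posK ∧ m.posS = c.posS ∧ m.tabB = c.tabB ∧ m.tabC = c.tabC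

theorem SameButDist.of_same {m c e : Mem N} (h : SameTables m c) (h' : SameButDist c e) :
    SameButDist m e :=
  ⟨h.1.trans h'.1, h.2.1.trans h'.2.1, h.2.2.2.1.trans h'.2.2.1, h.2.2.2.2.trans h'.2.2.2⟩

theorem finRange_eq_append {x : Fin N} {l₁ l₂ : List (Fin N)}
    (h : List.finRange N = l₁ ++ x :: l₂) : l₁.length = x ∧ x ∉ l₁ := by
  constructor
  · have hlen := congrArg List.length h
    simp only [List.length_finRange, List.length_append, List.length_cons] at hlen
    have h1 : (List.finRange N)[l₁.length]? = some x := by rw [h]; simp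
    rw [List.getElem?_eq_getElem (by simp; omega), List.getElem_finRange] at h1
    have := Option.some.inj h1
    rw [← this]; rfl
  · have := List.nodup_finRange N
    rw [h, List.nodup_append] at this
    exact fun hx => this.2.2 x hx x (by simp) rfl

/-- During round `x`, the pairs already treated satisfy the claim for `x + 1` and the others that
for `x`. For the two entries that involve `x`, these claims coincide. -/
theorem allPairs_spec [DecidableRel G.Adj] (m₀ : Mem N) :
    SameButDist (allPairs G w m₀).2 m₀ ∧
      ∀ u v, ShortestLT G w N u v ((allPairs G w m₀).2.dist u v) := by
  unfold allPairs
  set phase₁ : Prog N Unit := forEach (List.finRange N) fun u =>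
    forEach (List.finRange N) fun v =>
      writeDist u v
        (if u = v then Entry.zero N
         else if G.Adj u v then ⟨(w s(u, v) : ℝ≥0∞), Rope.edge u v⟩
         else Entry.inf N)
  have h₁ : SameButDist (phase₁ m₀).2 m₀ ∧ ∀ u ∈ List.finRange N, ∀ v,
      ShortestLT G w 0 u v ((phase₁ m₀).2.dist u v) := by
    let inv : List (Fin N) → Mem N → Prop := fun l m => SameButDist m m₀ ∧ ∀ u ∈ l, ∀ v,
      ShortestLT G w 0 u v (m.dist u v)
    refine forEach_induct inv ?_ ?_ ⟨⟨rfl, rfl, rfl, rfl⟩, by simp⟩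
    · rintro l m c hs ⟨h1, h2⟩
      exact ⟨h1.of_same hs, by rw [hs.2.2.1]; exact h2⟩
    · rintro l₁ u l₂ - m ⟨h1, h2⟩
      let inv' : List (Fin N) → Mem N → Prop := fun l m => SameButDist m m₀ ∧
        (∀ u ∈ l₁, ∀ v, ShortestLT G w 0 u v (m.dist u v)) ∧
        ∀ v ∈ l, ShortestLT G w 0 u v (m.dist u v)
      have key : inv' (List.finRange N) (forEach (List.finRange N) (fun v =>
          writeDist u v (initialEntry G w u v)) m).2 := by
        refine forEach_induct inv' ?_ ?_ ⟨h1, h2, by simp⟩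
        · rintro l m c hs ⟨h1, h2, h3⟩
          exact ⟨h1.of_same hs, by rw [hs.2.2.1]; exact h2, by rw [hs.2.2.1]; exact h3⟩
        · rintro l₃ v l₄ - m ⟨h1, h2, h3⟩
          have hd : ∀ u' v', (writeDist u v (initialEntry G w u v) m).2.dist u' v' =
            if u' = u ∧ v' = v then initialEntry G w u v else m.dist u' v' := fun _ _ => rfl
          refine ⟨h1, fun u' hu' v' => ?_, fun v' hv' => ?_⟩
          · rw [hd]
            split_ifs with h
            · rw [h.1, h.2]; exact shortestLT_initialEntry u v
            · exact h2 u' hu' v'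
          · rw [hd]
            split_ifs with h
            · rw [h.2]; exact shortestLT_initialEntry u v
            · refine h3 v' ((List.mem_append.1 hv').resolve_right fun h' => ?_)
              exact h ⟨rfl, List.mem_singleton.1 h'⟩
      refine ⟨key.1, fun u' hu' v => ?_⟩
      rcases List.mem_append.1 hu' with hu' | hu'
      · exact key.2.1 u' hu' v
      · rw [List.mem_singleton.1 hu']
        exact key.2.2 v (List.mem_finRange v)
  set m₁ := (phase₁ m₀).2
  set phase₂ : Prog N Unit := forEach (List.finRange N) fun x =>
    forEach (List.finRange N) fun u =>
      forEach (List.finRange N) fun v => do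
        let new ← plus (← readDist u x) (← readDist x v)
        let best ← better (← readDist u v) new
        writeDist u v best
  let inv : List (Fin N) → Mem N → Prop := fun l m => SameButDist m m₀ ∧ ∀ u v,
    ShortestLT G w l.length u v (m.dist u v)
  have h₂ : inv (List.finRange N) (phase₂ m₁).2 := by
    refine forEach_induct inv ?_ ?_ ⟨h₁.1, fun u v => h₁.2 u (List.mem_finRange u) v⟩
    · rintro l m c hs ⟨h1, h2⟩
      exact ⟨h1.of_same hs, by rw [hs.2.2.1]; exact h2⟩
    rintro l₁ x l₂ hl m ⟨h1, h2⟩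
    obtain ⟨hx, -⟩ := finRange_eq_append hl
    rw [hx] at h2
    let inv₂ : List (Fin N) → Mem N → Prop := fun l m => SameButDist m m₀ ∧
      ∀ u v, if u ∈ l then ShortestLT G w (x + 1) u v (m.dist u v)
        else ShortestLT G w x u v (m.dist u v)
    have key : inv₂ (List.finRange N) (forEach (List.finRange N) (fun u =>
        forEach (List.finRange N) fun v => do
          let new ← plus (← readDist u x) (← readDist x v)
          let best ← better (← readDist u v) new
          writeDist u v best) m).2 := by
      refine forEach_induct inv₂ ?_ ?_ ⟨h1, by simpa using h2⟩
      · rintro l m c hs ⟨h1, h2⟩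
        exact ⟨h1.of_same hs, by rw [hs.2.2.1]; exact h2⟩
      rintro l₃ u l₄ hl₃ m ⟨h1, h2⟩
      obtain ⟨-, hu⟩ := finRange_eq_append hl₃
      let inv₃ : List (Fin N) → Mem N → Prop := fun l m => SameButDist m m₀ ∧
        ∀ u' v', if u' ∈ l₃ ∨ u' = u ∧ v' ∈ l then ShortestLT G w (x + 1) u' v' (m.dist u' v')
          else ShortestLT G w x u' v' (m.dist u' v')
      have key : inv₃ (List.finRange N) (forEach (List.finRange N) (fun v => do
          let new ← plus (← readDist u x) (← readDist x v)
          let best ← better (← readDist u v) new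
          writeDist u v best) m).2 := by
        refine forEach_induct inv₃ ?_ ?_ ⟨h1, by simpa using h2⟩
        · rintro l m c hs ⟨h1, h2⟩
          exact ⟨h1.of_same hs, by rw [hs.2.2.1]; exact h2⟩
        rintro l₅ v l₆ hl₅ m ⟨h1, h2⟩
        obtain ⟨-, hv⟩ := finRange_eq_append hl₅
        refine (reads_readDist u x).bind_induct (Q := inv₃ (l₅ ++ [v])) fun e₁ m₁ he₁ hs₁ => ?_
        refine (reads_readDist x v).bind_induct (Q := inv₃ (l₅ ++ [v])) fun e₂ m₂ he₂ hs₂ => ?_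
        refine (reads_plus e₁ e₂).bind_induct (Q := inv₃ (l₅ ++ [v])) fun new m₃ hnew hs₃ => ?_
        refine (reads_readDist u v).bind_induct (Q := inv₃ (l₅ ++ [v])) fun e m₄ he hs₄ => ?_
        refine (reads_better e new).bind_induct (Q := inv₃ (l₅ ++ [v])) fun b m₅ hb hs₅ => ?_
        have hs := hs₅.trans (hs₄.trans (hs₃.trans (hs₂.trans hs₁)))
        have hd₁ : e₁ = m.dist u x := he₁
        have hd₂ : e₂ = m.dist x v := by rw [he₂, hs₁.2.2.1]
        have hd : e = m.dist u v := by rw [he, (hs₃.trans (hs₂.trans hs₁)).2.2.1]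
        have g₁ : ShortestLT G w x u x e₁ := by
          have := h2 u x
          rw [hd₁]
          split_ifs at this
          exacts [this.of_succ_right, this]
        have g₂ : ShortestLT G w x x v e₂ := by
          have := h2 x v
          rw [hd₂]
          split_ifs at this
          exacts [this.of_succ_left, this]
        have g : ShortestLT G w x u v e := by
          have := h2 u v
          rwa [if_neg (by tauto), ← hd] at this
        have gb : ShortestLT G w (x + 1) u v b := by
          rw [hb, hnew]
          exact g.step g₁ g₂
        have hw : ∀ u' v', (writeDist u v b m₅).2.dist u' v' =
          if u' = u ∧ v' = v then b else m.dist u' v' := by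
          intro u' v'
          rw [← hs.2.2.1]; rfl
        have hb₅ : SameButDist m₅ m₀ := .of_same hs h1
        refine ⟨hb₅, fun u' v' => ?_⟩
        rw [hw]
        by_cases h : u' = u ∧ v' = v
        · obtain ⟨rfl, rfl⟩ := h
          rw [if_pos (by simp), if_pos ⟨rfl, rfl⟩]
          exact gb
        · rw [if_neg h]
          have := h2 u' v'
          have hiff : (u' ∈ l₃ ∨ u' = u ∧ v' ∈ l₅ ++ [v]) ↔ (u' ∈ l₃ ∨ u' = u ∧ v' ∈ l₅) := by
            simp only [List.mem_append, List.mem_singleton]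
            tauto
          rwa [if_congr hiff rfl rfl]
      refine ⟨key.1, fun u' v' => ?_⟩
      have := key.2 u' v'
      have hiff : (u' ∈ l₃ ∨ u' = u ∧ v' ∈ List.finRange N) ↔ u' ∈ l₃ ++ [u] := by simp
      rwa [if_congr hiff rfl rfl] at this
    refine ⟨key.1, fun u v => ?_⟩
    have := key.2 u v
    rw [if_pos (List.mem_finRange u), ← hx] at this
    simpa using this
  refine ⟨h₂.1, fun u v => ?_⟩
  have := h₂.2 u v
  rwa [List.length_finRange] at this

end FloydWarshall

/-! ### Correctness of the algorithm -/

section Correctness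

variable {N : ℕ} {G : SimpleGraph (Fin N)} {w : Sym2 (Fin N) → ℝ≥0} {K S : List (Fin N)}

theorem forEach_writePosK (hK : K.Nodup) (m₀ : Mem N) (h0 : ∀ u, m₀.posK u = none) :
    let m := (forEach K.zipIdx (fun p => writePosK p.1 p.2) m₀).2
    (∀ u p, m.posK u = some p ↔ K[p]? = some u) ∧ m.posS = m₀.posS ∧ m.dist = m₀.dist ∧
      m.tabB = m₀.tabB ∧ m.tabC = m₀.tabC := by
  let inv : List (Fin N × ℕ) → Mem N → Prop := fun l m =>
    (∀ u p, m.posK u = some p ↔ (u, p) ∈ l) ∧ m.posS = m₀.posS ∧ m.dist = m₀.dist ∧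
      m.tabB = m₀.tabB ∧ m.tabC = m₀.tabC
  have key : inv K.zipIdx (forEach K.zipIdx (fun p => writePosK p.1 p.2) m₀).2 := by
    refine forEach_induct inv ?_ ?_ ⟨by simp [h0], rfl, rfl, rfl, rfl⟩
    · rintro l m c ⟨h1, h2, h3, h4, h5⟩ ⟨g1, g2⟩
      exact ⟨by rw [h1]; exact g1, by rw [h2, h3, h4, h5]; exact g2⟩
    · rintro l₁ ⟨u, i⟩ l₂ hl m ⟨h1, h2⟩
      have hw : ∀ u', (writePosK u i m).2.posK u' = if u' = u then some i else m.posK u' :=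
        fun _ => rfl
      refine ⟨fun u' p => ?_, h2⟩
      rw [hw]
      have hu : (u, i) ∈ K.zipIdx := by rw [hl]; simp
      rw [List.mem_zipIdx_iff_getElem?] at hu
      split_ifs with h
      · subst h
        constructor
        · rintro h
          rw [← Option.some.inj h]; simp
        · intro hp
          have hp' : (u', p) ∈ K.zipIdx := by
            rw [hl]
            rcases List.mem_append.1 hp with hp | hp
            · simp [hp]
            · rw [List.mem_singleton.1 hp]; simp
          rw [List.mem_zipIdx_iff_getElem?] at hp'
          obtain ⟨a1, a2⟩ := List.getElem?_eq_some_iff.1 hu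
          obtain ⟨b1, b2⟩ := List.getElem?_eq_some_iff.1 hp'
          rw [← b2] at a2
          exact congrArg some (hK.getElem_inj_iff.1 a2)
      · rw [h1, List.mem_append, List.mem_singleton]
        simp [h]
  refine ⟨fun u p => ?_, key.2⟩
  rw [key.1, List.mem_zipIdx_iff_getElem?]

theorem forEach_writePosS (hS : S.Nodup) (m₀ : Mem N) (h0 : ∀ u, m₀.posS u = none) :
    let m := (forEach S.zipIdx (fun p => writePosS p.1 p.2) m₀).2
    (∀ u p, m.posS u = some p ↔ S[p]? = some u) ∧ m.posK = m₀.posK ∧ m.dist = m₀.dist ∧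
      m.tabB = m₀.tabB ∧ m.tabC = m₀.tabC := by
  let inv : List (Fin N × ℕ) → Mem N → Prop := fun l m =>
    (∀ u p, m.posS u = some p ↔ (u, p) ∈ l) ∧ m.posK = m₀.posK ∧ m.dist = m₀.dist ∧
      m.tabB = m₀.tabB ∧ m.tabC = m₀.tabC
  have key : inv S.zipIdx (forEach S.zipIdx (fun p => writePosS p.1 p.2) m₀).2 := by
    refine forEach_induct inv ?_ ?_ ⟨by simp [h0], rfl, rfl, rfl, rfl⟩
    · rintro l m c ⟨h1, h2, h3, h4, h5⟩ ⟨g1, g2⟩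
      exact ⟨by rw [h2]; exact g1, by rw [h1, h3, h4, h5]; exact g2⟩
    · rintro l₁ ⟨u, i⟩ l₂ hl m ⟨h1, h2⟩
      have hw : ∀ u', (writePosS u i m).2.posS u' = if u' = u then some i else m.posS u' :=
        fun _ => rfl
      refine ⟨fun u' p => ?_, h2⟩
      rw [hw]
      have hu : (u, i) ∈ S.zipIdx := by rw [hl]; simp
      rw [List.mem_zipIdx_iff_getElem?] at hu
      split_ifs with h
      · subst h
        constructor
        · rintro h
          rw [← Option.some.inj h]; simp
        · intro hp
          have hp' : (u', p) ∈ S.zipIdx := by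
            rw [hl]
            rcases List.mem_append.1 hp with hp | hp
            · simp [hp]
            · rw [List.mem_singleton.1 hp]; simp
          rw [List.mem_zipIdx_iff_getElem?] at hp'
          obtain ⟨a1, a2⟩ := List.getElem?_eq_some_iff.1 hu
          obtain ⟨b1, b2⟩ := List.getElem?_eq_some_iff.1 hp'
          rw [← b2] at a2
          exact congrArg some (hS.getElem_inj_iff.1 a2)
      · rw [h1, List.mem_append, List.mem_singleton]
        simp [h]
  refine ⟨fun u p => ?_, key.2⟩
  rw [key.1, List.mem_zipIdx_iff_getElem?]

theorem ivalSet_one {p : ℕ} {v : Fin N} (h : K[p]? = some v) :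
    ivalSet K (ival K.length p 1) = {v} := by
  have hp := (List.getElem?_eq_some_iff.1 h).1
  rw [ivalSet_ival K (by omega)]
  ext z
  simp only [ivalSet, Nat.lt_one_iff, Set.mem_ofPred_eq, exists_eq_left, Nat.add_zero,
    Nat.mod_eq_of_lt hp, h, Option.some.injEq, Set.mem_singleton_iff]
  exact eq_comm

theorem maskSet_two_pow {i : ℕ} {v : Fin N} (h : S[i]? = some v) : maskSet S (2 ^ i) = {v} := by
  ext z
  simp only [maskSet, Nat.testBit_two_pow, decide_eq_true_eq, Set.mem_ofPred_eq,
    exists_eq_right', h, Option.some.injEq, Set.mem_singleton_iff]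
  exact eq_comm

theorem grows_writeC_dist {m : Mem N} (hm : TablesSound G w K S m) {u v : Fin N} {L : ℕ}
    {I : ℕ × ℕ} (hset : maskSet S L ∪ ivalSet K I = {v})
    (hone : onesCount S.length L + I.2 = 1) :
    Grows G w K S m (writeC u L I (m.dist u v)) fun v' L' I' => v' = u ∧ L' = L ∧ I' = I := by
  refine grows_writeC hm ?_ ?_
  · unfold entrySet
    rw [hset, hone]
    exact (hm.dist u v).mono subset_rfl (by unfold sizeC; omega)
  · rw [hm.dist_len]
    exact lengthDist_le_treeDist (by rw [hset]; rfl)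

theorem baseCases_spec (hnd : (K ++ S).Nodup) (m₀ : Mem N) (hposK : ∀ u, m₀.posK u = none)
    (hposS : ∀ u, m₀.posS u = none) (hB : ∀ v L I, m₀.tabB v L I = Entry.inf N)
    (hC : ∀ v L I, m₀.tabC v L I = Entry.inf N)
    (hdist : ∀ u v, (m₀.dist u v).len = lengthDist G w u v ∧
      (m₀.dist u v).Sound G w {u, v} (2 * N)) :
    TablesSound G w K S (baseCases K S m₀).2 ∧ ∀ v L I, L < 2 ^ S.length →
      ValidIval K.length I → onesCount S.length L + I.2 ≤ 1 →
      EntryOpt G w K S (baseCases K S m₀).2 v L I := by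
  obtain ⟨hndK, hndS, -⟩ := List.nodup_append.1 hnd
  obtain ⟨a1, a2, a3, a4, a5⟩ := forEach_writePosK hndK m₀ hposK
  unfold baseCases
  set m₁ := (forEach K.zipIdx (fun p => writePosK p.1 p.2) m₀).2
  obtain ⟨b1, b2, b3, b4, b5⟩ := forEach_writePosS hndS m₁ (by rw [a2]; exact hposS)
  set m₂ := (forEach S.zipIdx (fun p => writePosS p.1 p.2) m₁).2
  have hm₂ : TablesSound G w K S m₂ := by
    refine ⟨by rw [b2]; exact a1, b1, ?_, ?_, ?_, ?_⟩
    · rw [b3, a3]; exact fun u v => (hdist u v).1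
    · rw [b3, a3]; exact fun u v => (hdist u v).2
    · intro v L I
      rw [b4, a4, hB]
      exact Entry.sound_inf _ (by unfold sizeB; omega)
    · intro v L I
      rw [b5, a5, hC]
      exact Entry.sound_inf _ (by unfold sizeC; omega)
  set loop : Prog N Unit := forEach (List.finRange N) fun u => do
    writeC u 0 (0, 0) (Entry.zero N)
    forEach K.zipIdx fun p => do
      let d ← readDist u p.1
      writeC u 0 (ival K.length p.2 1) d
    forEach S.zipIdx fun p => do
      let d ← readDist u p.1
      writeC u (2 ^ p.2) (0, 0) d
  have hgrow : Grows G w K S m₂ loop fun v L I => ∃ u ∈ List.finRange N,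
      ((v = u ∧ L = 0 ∧ I = (0, 0)) ∨
        (∃ p ∈ K.zipIdx, v = u ∧ L = 0 ∧ I = ival K.length p.2 1) ∨
        ∃ p ∈ S.zipIdx, v = u ∧ L = 2 ^ p.2 ∧ I = (0, 0)) := by
    refine Grows.forEach (A := fun u v L I => (v = u ∧ L = 0 ∧ I = (0, 0)) ∨
        (∃ p ∈ K.zipIdx, v = u ∧ L = 0 ∧ I = ival K.length p.2 1) ∨
        ∃ p ∈ S.zipIdx, v = u ∧ L = 2 ^ p.2 ∧ I = (0, 0)) hm₂ fun l₁ u l₂ _ m hm _ _ => ?_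
    refine (grows_writeC hm ?_ (by simp [Entry.zero])).bind fun m hm => ?_
    · refine (Entry.sound_zero u (by unfold sizeC; omega)).mono ?_ le_rfl
      simp [entrySet, maskSet_zero, ivalSet_zero]
    refine (Grows.forEach hm fun l₁ p l₂ hl m hm _ _ => ?_).bind fun m hm =>
      Grows.forEach hm fun l₁ p l₂ hl m hm _ _ => ?_
    · refine (reads_readDist u p.1).bind_grows ?_
      rintro _ m' rfl hs
      rw [← hs.2.2.1]
      have hp : (p.1, p.2) ∈ K.zipIdx := by rw [hl]; simp
      rw [List.mem_zipIdx_iff_getElem?] at hp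
      refine grows_writeC_dist (hm.of_same hs) ?_ ?_
      · rw [maskSet_zero, Set.empty_union, ivalSet_one hp]
      · rw [onesCount_zero, ival_snd]
    · refine (reads_readDist u p.1).bind_grows ?_
      rintro _ m' rfl hs
      rw [← hs.2.2.1]
      have hp : (p.1, p.2) ∈ S.zipIdx := by rw [hl]; simp
      rw [List.mem_zipIdx_iff_getElem?] at hp
      refine grows_writeC_dist (hm.of_same hs) ?_ ?_
      · rw [maskSet_two_pow hp, ivalSet_zero, Set.union_empty]
      · rw [onesCount_two_pow (List.getElem?_eq_some_iff.1 hp).1, Nat.add_zero]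
  refine ⟨hgrow.1, fun v L I hL hI hle => hgrow.2.2 v L I ⟨v, List.mem_finRange v, ?_⟩⟩
  have hI0 : I.2 = 0 → I = (0, 0) := fun h => by
    ext
    exacts [hI.2.1 (Or.inl h), h]
  by_cases hL0 : L = 0
  · rcases Nat.eq_zero_or_pos I.2 with h | h
    · exact Or.inl ⟨rfl, hL0, hI0 h⟩
    · right; left
      have h1 : I.2 = 1 := by omega
      have hlt := hI.fst_lt h
      refine ⟨(K[I.1], I.1), ?_, rfl, hL0, ?_⟩
      · rw [List.mem_zipIdx_iff_getElem?]
        exact List.getElem?_eq_getElem hlt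
      · rw [← h1, hI.ival_eq]
  · right; right
    have := onesCount_pos hL hL0
    obtain ⟨i, hi, rfl⟩ := exists_two_pow_of_onesCount hL (by omega)
    refine ⟨(S[i], i), ?_, rfl, rfl, hI0 (by omega)⟩
    rw [List.mem_zipIdx_iff_getElem?]
    exact List.getElem?_eq_getElem hi

theorem onesCount_le (s L : ℕ) : onesCount s L ≤ s := by
  induction s with
  | zero => exact le_rfl
  | succ s ih => rw [onesCount]; split_ifs <;> omega

theorem sizeC_mono (N : ℕ) {a b : ℕ} (h : a ≤ b) : sizeC N a ≤ sizeC N b := by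
  have := Nat.mul_le_mul_left (2 * N + 8) h
  unfold sizeC
  omega

/-- The memory before the result is looked up. -/
noncomputable def finalMem (G : SimpleGraph (Fin N)) [DecidableRel G.Adj]
    (w : Sym2 (Fin N) → ℝ≥0) (K R : List (Fin N)) : Mem N :=
  (fillTables K R.tail.length (baseCases K R.tail (allPairs G w (Mem.init N)).2).2).2

theorem finalMem_spec [DecidableRel G.Adj] (hG : G.Connected) (hK : Noncrossing G K)
    {R : List (Fin N)} (hnd : (K ++ R.tail).Nodup) :
    TablesSound G w K R.tail (finalMem G w K R) ∧ ∀ v L I, L < 2 ^ R.tail.length →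
      ValidIval K.length I → v ∉ maskSet R.tail L → v ∉ ivalSet K I →
      EntryOpt G w K R.tail (finalMem G w K R) v L I := by
  obtain ⟨⟨h1, h2, h3, h4⟩, h5⟩ := allPairs_spec (G := G) (w := w) (Mem.init N)
  obtain ⟨g1, g2⟩ := baseCases_spec hnd (allPairs G w (Mem.init N)).2 (by rw [h1]; exact fun _ => rfl)
    (by rw [h2]; exact fun _ => rfl) (by rw [h3]; exact fun _ _ _ => rfl)
    (by rw [h4]; exact fun _ _ _ => rfl) (fun u v => (h5 u v).len_eq hG)
  obtain ⟨f1, f2, f3⟩ := grows_fillTables hK hnd g1 g2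
  refine ⟨f1, fun v L I hL hI hvL hvI => ?_⟩
  by_cases h : 2 ≤ onesCount R.tail.length L + I.2
  · exact f3 v L I ⟨hL, onesCount_le _ _, hI, h, hvL, hvI⟩
  · exact f2 v L I (g2 v L I hL hI (by omega))

theorem finalEntry_spec [DecidableRel G.Adj] (hG : G.Connected) (hK : Noncrossing G K)
    {R : List (Fin N)} (hnd : (K ++ R).Nodup) (hne : 1 ≤ (K ++ R).length) :
    let e := (finalEntry K R (finalMem G w K R)).1
    e.Sound G w {v | v ∈ K ++ R} (sizeC N (K ++ R).length) ∧
      ∀ X c, SpansTree G w X c → (∀ v ∈ K ++ R, v ∈ X) → e.len ≤ c := by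
  have hnd' : (K ++ R.tail).Nodup :=
    hnd.sublist (List.Sublist.append_left (List.tail_sublist R) K)
  obtain ⟨hs, hopt⟩ := finalMem_spec (w := w) hG hK hnd'
  set m := finalMem G w K R
  -- an entry from which the result can be read
  have key : ∀ v L I, L < 2 ^ R.tail.length → ValidIval K.length I → v ∉ maskSet R.tail L →
      v ∉ ivalSet K I → {v | v ∈ K ++ R} = entrySet K R.tail v L I →
      ((∀ t ∈ K, t ∈ ivalSet K I) ∨ v ∈ K) →
      onesCount R.tail.length L + I.2 ≤ (K ++ R).length →
      (m.tabC v L I).Sound G w {v | v ∈ K ++ R} (sizeC N (K ++ R).length) ∧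
      ∀ X c, SpansTree G w X c → (∀ v ∈ K ++ R, v ∈ X) → (m.tabC v L I).len ≤ c := by
    intro v L I hL hI hvL hvI hset hanch hsize
    refine ⟨?_, fun X c hX hsub => ?_⟩
    · rw [hset]
      exact (hs.tabC v L I).mono subset_rfl (sizeC_mono N hsize)
    · have hsub' : entrySet K R.tail v L I ⊆ X := by
        rw [← hset]; exact fun z hz => hsub z hz
      refine (hopt v L I hL hI hvL hvI).trans ((treeDist_le hX (hsub' (Set.mem_insert _ _))
        (fun z hz => hsub' (Or.inr (Or.inl hz))) (fun z hz => hsub' (Or.inr (Or.inr hz))) ?_).trans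
        (by rw [lengthDist_self, add_zero]))
      -- An inner root is anchored because the interval is all of `K`. An outer root is itself a
      -- terminal outside the interval, so `{v}` anchors it.
      rcases hanch with h | h
      · exact Or.inr (Or.inl h)
      · exact Or.inr (Or.inr ⟨{v}, v, .singleton v, rfl, fun y hy _ => hy, rfl, h, hvI⟩)
  cases R with
  | cons v S =>
    have hmask : maskSet S (2 ^ S.length - 1) = {z | z ∈ S} := by
      ext z
      simp only [maskSet, Nat.testBit_two_pow_sub_one, decide_eq_true_eq, Set.mem_ofPred_eq]
      rw [List.mem_iff_getElem?]
      refine exists_congr fun i => and_iff_left_of_imp fun h => ?_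
      exact (List.getElem?_eq_some_iff.1 h).1
    have hival : ivalSet K (ival K.length 0 K.length) = {z | z ∈ K} := by
      rw [ivalSet_ival K le_rfl, ivalSet_length]
    have hnd'' := hnd
    rw [List.nodup_append, List.nodup_cons] at hnd''
    refine key v (2 ^ S.length - 1) (ival K.length 0 K.length) ?_ (validIval_ival le_rfl) ?_ ?_ ?_
      (Or.inl fun t ht => by rw [hival]; exact ht) ?_
    · have : 0 < 2 ^ S.length := by positivity
      simp only [List.tail_cons]; omega
    · simp only [List.tail_cons, hmask]; exact hnd''.2.1.1
    · rw [hival]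
      intro h
      exact hnd''.2.2 v h v (by simp) rfl
    · simp only [entrySet, List.tail_cons, hmask, hival]
      ext z
      simp only [Set.mem_ofPred_eq, List.mem_append, List.mem_cons, Set.mem_insert_iff,
        Set.mem_union]
      tauto
    · rw [ival_snd]
      have := onesCount_le (List.tail (v :: S)).length (2 ^ S.length - 1)
      simp only [List.tail_cons, List.length_append, List.length_cons] at this ⊢
      omega
  | nil =>
    cases K with
    | nil => simp at hne
    | cons v K' =>
      have hndK := (List.nodup_append.1 hnd).1
      have hv : ValidIval (v :: K').length (0, (v :: K').length) :=
        ⟨le_rfl, fun _ => rfl, Or.inl rfl⟩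
      have hins := hv.ivalSet_eq_insert (K := v :: K') (by simp) (p := v) rfl
      have hnot := hv.notMem_tail hndK (by simp) (p := v) rfl
      rw [ivalSet_length] at hins
      simp only [Nat.zero_add] at hins hnot
      refine key v 0 (ival (v :: K').length 1 ((v :: K').length - 1)) (by simp)
        (validIval_ival (by omega)) (by rw [maskSet_zero]; exact id) hnot ?_ (Or.inr (by simp)) ?_
      · rw [entrySet, maskSet_zero, Set.empty_union, ← hins, List.append_nil]
      · rw [ival_snd, onesCount_zero]
        simp

theorem flatten_fst (x : Rope N) (m : Mem N) (e : Sym2 (Fin N)) :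
    e ∈ (flatten x [] m).1 ↔ e ∈ x.edges := by
  rw [(flatten_spec x [] m).1]
  simp

/-- Soundness gives a subgraph `T` of at most the returned length, and optimality bounds this length
by every competitor. As `T` is itself a competitor, equality holds. -/
theorem exists_steinerMinimalTree [DecidableRel G.Adj] (hG : G.Connected) (hK : Noncrossing G K)
    {R : List (Fin N)} (hnd : (K ++ R).Nodup) (hne : 1 ≤ (K ++ R).length) :
    ∃ T : G.Subgraph, IsSteinerMinimalTree G w {v | v ∈ K ++ R} T ∧
      T.edgeSet = {e | e ∈ (output G w K R).2} ∧
      (output G w K R).1 = (subgraphLength w T : ℝ≥0∞) := by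
  obtain ⟨⟨hsound, -⟩, hopt⟩ := finalEntry_spec (w := w) hG hK hnd hne
  have hout : (output G w K R).1 = (finalEntry K R (finalMem G w K R)).1.len ∧
      ∀ e, e ∈ (output G w K R).2 ↔ e ∈ (finalEntry K R (finalMem G w K R)).1.tree.edges :=
    ⟨rfl, fun e => flatten_fst _ _ e⟩
  set e := (finalEntry K R (finalMem G w K R)).1
  have hle : ∀ T' : G.Subgraph, T'.Connected → {v | v ∈ K ++ R} ⊆ T'.verts →
      e.len ≤ subgraphLength w T' := by
    intro T' hT' hsub
    obtain ⟨X, c, hX, hTX, hc⟩ := exists_spansTree w T' hT'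
    exact (hopt X c hX fun v hv => hTX (hsub hv)).trans (by exact_mod_cast hc)
  -- The whole graph is a competitor of finite length.
  have hfin : e.len ≠ ⊤ := by
    have hne := hG.nonempty
    have := hle ⊤ ⟨SimpleGraph.Subgraph.topIso.connected_iff.2 hG⟩ (by simp)
    exact (this.trans_lt ENNReal.coe_lt_top).ne
  obtain ⟨T, h1, h2, h3, h4⟩ := hsound hfin
  refine ⟨T, ⟨h1, h2, fun T' hT' hsub => ?_⟩, ?_, ?_⟩
  · exact_mod_cast h4.trans (hle T' hT' hsub)
  · rw [h3]
    ext z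
    exact (hout.2 z).symm
  · rw [hout.1]
    exact le_antisymm (hle T h1 h2) h4

end Correctness

/-! ### Counting steps. -/

section Cost

variable {N : ℕ} {α β ι : Type}

/-- From every memory, `x` takes at most `T` steps and returns a value that satisfies `Q`. -/
def Cost (x : Prog N α) (T : ℕ) (Q : α → Prop) : Prop :=
  ∀ m, Q (x m).1 ∧ (x m).2.steps ≤ m.steps + T

theorem Cost.le {x : Prog N α} {T T' : ℕ} {Q : α → Prop} (h : Cost x T Q) (hT : T ≤ T') :
    Cost x T' Q := fun m => ⟨(h m).1, (h m).2.trans (by omega)⟩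

theorem Cost.bind {x : Prog N α} {f : α → Prog N β} {T T' : ℕ} {Q : α → Prop} {Q' : β → Prop}
    (hx : Cost x T Q) (hf : ∀ a, Q a → Cost (f a) T' Q') : Cost (x >>= f) (T + T') Q' := by
  intro m
  obtain ⟨h1, h2⟩ := hx m
  obtain ⟨h3, h4⟩ := hf _ h1 (x m).2
  exact ⟨h3, h4.trans (by omega)⟩

theorem cost_pure {a : α} {T : ℕ} {Q : α → Prop} (h : Q a) : Cost (pure a : Prog N α) T Q :=
  fun _ => ⟨h, Nat.le_add_right _ _⟩

theorem cost_tick : Cost (N := N) tick 1 fun _ => True := fun _ => ⟨trivial, le_rfl⟩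

theorem cost_readPosK (u : Fin N) : Cost (readPosK u) 1 fun _ => True := fun _ => ⟨trivial, le_rfl⟩

theorem cost_readPosS (u : Fin N) : Cost (readPosS u) 1 fun _ => True := fun _ => ⟨trivial, le_rfl⟩

theorem cost_readDist (u v : Fin N) : Cost (readDist u v) 1 fun _ => True :=
  fun _ => ⟨trivial, le_rfl⟩

theorem cost_readB (v : Fin N) (L : ℕ) (I : ℕ × ℕ) : Cost (readB v L I) 1 fun _ => True :=
  fun _ => ⟨trivial, le_rfl⟩

theorem cost_readC (v : Fin N) (L : ℕ) (I : ℕ × ℕ) : Cost (readC v L I) 1 fun _ => True :=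
  fun _ => ⟨trivial, le_rfl⟩

theorem cost_writePosK (u : Fin N) (i : ℕ) : Cost (writePosK u i) 1 fun _ => True :=
  fun _ => ⟨trivial, le_rfl⟩

theorem cost_writePosS (u : Fin N) (i : ℕ) : Cost (writePosS u i) 1 fun _ => True :=
  fun _ => ⟨trivial, le_rfl⟩

theorem cost_writeDist (u v : Fin N) (x : Entry N) : Cost (writeDist u v x) 1 fun _ => True :=
  fun _ => ⟨trivial, le_rfl⟩

theorem cost_writeB (v : Fin N) (L : ℕ) (I : ℕ × ℕ) (x : Entry N) :
    Cost (writeB v L I x) 1 fun _ => True := fun _ => ⟨trivial, le_rfl⟩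

theorem cost_writeC (v : Fin N) (L : ℕ) (I : ℕ × ℕ) (x : Entry N) :
    Cost (writeC v L I x) 1 fun _ => True := fun _ => ⟨trivial, le_rfl⟩

theorem cost_plus (x y : Entry N) : Cost (plus x y) 1 fun _ => True := fun _ => ⟨trivial, le_rfl⟩

theorem cost_better (x y : Entry N) : Cost (better x y) 1 fun _ => True :=
  fun _ => ⟨trivial, le_rfl⟩

theorem cost_forEach {l : List ι} {f : ι → Prog N Unit} {T : ι → ℕ}
    (h : ∀ i ∈ l, Cost (f i) (T i) fun _ => True) :
    Cost (forEach l f) (l.map fun i => T i + 1).sum fun _ => True := by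
  induction l with
  | nil => exact cost_pure trivial
  | cons i l ih =>
    refine Cost.le (cost_tick.bind fun _ _ => (h i (by simp)).bind fun _ _ =>
      ih fun j hj => h j (by simp [hj])) ?_
    rw [List.map_cons, List.sum_cons]
    omega

theorem cost_forEach_const {l : List ι} {f : ι → Prog N Unit} {n T : ℕ} (hl : l.length = n)
    (h : ∀ i ∈ l, Cost (f i) T fun _ => True) :
    Cost (forEach l f) (n * (T + 1)) fun _ => True :=
  (cost_forEach h).le (by simp [hl])

theorem cost_minimum {l : List ι} {f : ι → Prog N (Entry N)} {T : ι → ℕ}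
    (h : ∀ i ∈ l, Cost (f i) (T i) fun _ => True) :
    Cost (minimum l f) (l.map fun i => T i + 2).sum fun _ => True := by
  induction l with
  | nil => exact cost_pure trivial
  | cons i l ih =>
    refine Cost.le (cost_tick.bind fun _ _ => (h i (by simp)).bind fun _ _ =>
      (ih fun j hj => h j (by simp [hj])).bind fun _ _ => cost_better _ _) ?_
    rw [List.map_cons, List.sum_cons]
    omega

theorem cost_minimum_const {l : List ι} {f : ι → Prog N (Entry N)} {n T : ℕ} (hl : l.length = n)
    (h : ∀ i ∈ l, Cost (f i) T fun _ => True) :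
    Cost (minimum l f) (n * (T + 2)) fun _ => True :=
  (cost_minimum h).le (by simp [hl])

/-! #### Sums over subsets -/

theorem onesCount_congr {s L L' : ℕ} (h : ∀ i < s, L.testBit i = L'.testBit i) :
    onesCount s L = onesCount s L' := by
  induction s with
  | zero => rfl
  | succ s ih => rw [onesCount, onesCount, h s (by omega), ih fun i hi => h i (by omega)]

/-- Binomial theorem: an element of `L` contributes `1` if it is in `M` and `x` if it is not. For `x
= 2` this counts the partitions into three sets. -/
theorem sum_pow_submaskList (x s L : ℕ) :
    ((submaskList s L).map fun M => x ^ onesCount s (L ^^^ M)).sum = (x + 1) ^ onesCount s L := by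
  induction s with
  | zero => simp [submaskList, onesCount]
  | succ s ih =>
    have hbit : ∀ M ∈ submaskList s L, M.testBit s = false := fun M hM =>
      Nat.testBit_eq_false_of_lt (mem_submaskList.1 hM).1
    have h1 : ∀ M ∈ submaskList s L, x ^ onesCount (s + 1) (L ^^^ M) =
        (if L.testBit s then x else 1) * x ^ onesCount s (L ^^^ M) := by
      intro M hM
      rw [onesCount, Nat.testBit_xor, hbit M hM, Bool.xor_false]
      split_ifs
      · rw [pow_succ, mul_comm]
      · rw [one_mul]
    have h2 : L.testBit s → ∀ M ∈ submaskList s L, x ^ onesCount (s + 1) (L ^^^ (M + 2 ^ s)) =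
        x ^ onesCount s (L ^^^ M) := by
      intro h M hM
      have hM' := (mem_submaskList.1 hM).1
      rw [onesCount, Nat.testBit_xor, h, testBit_add_two_pow hM', if_neg (by simp)]
      congr 1
      refine onesCount_congr fun i hi => ?_
      rw [Nat.testBit_xor, Nat.testBit_xor, testBit_add_two_pow hM']
      simp [hi.ne]
    rw [submaskList]
    split_ifs with h
    · rw [List.map_append, List.sum_append, List.map_map, List.map_congr_left h1,
        List.map_congr_left (f := (fun M => x ^ onesCount (s + 1) (L ^^^ M)) ∘ fun M => M + 2 ^ s)
          (h2 h), List.sum_map_mul_left, ih, onesCount, if_pos h, if_pos h]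
      ring
    · rw [List.map_congr_left h1, List.sum_map_mul_left, ih, onesCount, if_neg h, if_neg h, one_mul]

theorem length_submaskList (s L : ℕ) : (submaskList s L).length = 2 ^ onesCount s L := by
  induction s with
  | zero => rfl
  | succ s ih =>
    rw [submaskList, onesCount]
    split_ifs
    · rw [List.length_append, List.length_map, ih, pow_succ]; omega
    · exact ih

/-- The same count over all masks; for `x = 3` it turns the cost `3 ^ |L|` of each mask into `4 ^
s`. -/
theorem sum_pow_onesCount (x s : ℕ) :
    ∑ L ∈ Finset.range (2 ^ s), x ^ onesCount s L = (x + 1) ^ s := by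
  induction s with
  | zero => simp [onesCount]
  | succ s ih =>
    have h1 : ∀ L ∈ Finset.range (2 ^ s), x ^ onesCount (s + 1) L = x ^ onesCount s L := by
      intro L hL
      rw [onesCount, Nat.testBit_eq_false_of_lt (Finset.mem_range.1 hL)]
      rfl
    have h2 : ∀ L ∈ Finset.range (2 ^ s),
        x ^ onesCount (s + 1) (2 ^ s + L) = x * x ^ onesCount s L := by
      intro L hL
      have hL' := Finset.mem_range.1 hL
      rw [Nat.add_comm (2 ^ s) L, onesCount, testBit_add_two_pow hL', if_pos (by simp), pow_succ, mul_comm]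
      congr 2
      refine onesCount_congr fun i hi => ?_
      rw [testBit_add_two_pow hL']
      simp [hi.ne]
    rw [pow_succ, Nat.mul_two, Finset.sum_range_add, Finset.sum_congr rfl h1,
      Finset.sum_congr rfl h2, ← Finset.mul_sum, ih]
    ring

/-! #### The parts of the algorithm -/

/-- The list doubles at each set bit, so copying costs a geometric sum. -/
theorem cost_submasks (s L : ℕ) :
    Cost (N := N) (submasks s L) (s + 2 * 2 ^ onesCount s L) (· = submaskList s L) := by
  induction s with
  | zero => exact cost_pure rfl
  | succ s ih =>
    rw [submasks, onesCount, submaskList]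
    refine Cost.le (cost_tick.bind fun _ _ => ih.bind ?_) (T := 1 + (s + 2 * 2 ^ onesCount s L +
      if L.testBit s then 2 ^ onesCount s L * (1 + 1) else 0)) ?_
    · rintro _ rfl
      split_ifs with h
      · exact ((cost_forEach_const (length_submaskList s L) fun _ _ => cost_tick).bind (T' := 0)
          fun _ _ => cost_pure rfl).le le_rfl
      · exact cost_pure rfl
    · split_ifs
      · rw [pow_succ]; omega
      · omega

theorem cost_popcount (s L : ℕ) : Cost (N := N) (popcount s L) s (· = onesCount s L) := by
  induction s with
  | zero => exact cost_pure rfl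
  | succ s ih =>
    refine (cost_tick.bind fun _ _ => ih.bind (T' := 0) ?_).le (by omega)
    rintro _ rfl
    exact cost_pure rfl

theorem cost_memL (u : Fin N) (L : ℕ) : Cost (memL u L) 1 fun _ => True :=
  (cost_readPosS u).bind (T' := 0) fun _ _ => cost_pure trivial

theorem cost_memI (k : ℕ) (u : Fin N) (I : ℕ × ℕ) : Cost (memI k u I) 1 fun _ => True :=
  (cost_readPosK u).bind (T' := 0) fun _ _ => cost_pure trivial

theorem cost_valueA (K : List (Fin N)) (v : Fin N) (L : ℕ) (I : ℕ × ℕ) :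
    Cost (valueA K v L I) (9 * N) fun _ => True := by
  have hN : 1 ≤ N := v.pos
  refine (cost_tick.bind (T' := N * (6 + 2)) fun _ _ => ?_).le (by omega)
  split_ifs
  · exact cost_pure trivial
  · refine cost_minimum_const (List.length_finRange) fun u _ => ?_
    refine Cost.le ((cost_readDist u v).bind (T' := 5) fun d _ =>
      ((cost_memL u L).bind (T' := 4)) fun b _ => ?_) le_rfl
    split_ifs
    · exact Cost.le ((cost_readPosS u).bind fun _ _ => (cost_readC _ _ _).bind fun _ _ =>
        cost_plus _ _) (by omega)
    · refine Cost.le ((cost_memI _ u I).bind (T' := 2) fun b _ => ?_) (by omega)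
      split_ifs
      · exact (cost_readC _ _ _).bind fun _ _ => cost_plus _ _
      · exact (cost_readB _ _ _).bind fun _ _ => cost_plus _ _

theorem cost_valueB {k s : ℕ} (hk : 1 ≤ k) (v : Fin N) (L : ℕ) {I : ℕ × ℕ} (hI : I.2 ≤ k) :
    Cost (valueB k s v L I) (s + 2 * 2 ^ onesCount s L + (origins k I).length *
      (16 * (k * 2 ^ onesCount s L))) fun _ => True := by
  refine (cost_submasks s L).bind ?_
  rintro _ rfl
  have h2 : 1 ≤ 2 ^ onesCount s L := Nat.one_le_two_pow
  have hk2 : 1 ≤ k * 2 ^ onesCount s L := Nat.mul_pos hk h2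
  refine (cost_minimum_const rfl (T := 2 ^ onesCount s L * (12 * k + 2)) fun a _ => ?_).le
    (Nat.mul_le_mul_left _ (by nlinarith))
  refine cost_minimum_const (length_submaskList _ _) fun L' _ =>
    (cost_minimum_const List.length_range (T := 4) fun x _ => ?_).le (by omega)
  refine Cost.le (cost_tick.bind (T' := 3) fun _ _ => ?_) (by omega)
  split_ifs
  · exact cost_pure trivial
  · exact Cost.le ((cost_readC _ _ _).bind fun _ _ => (cost_readC _ _ _).bind fun _ _ =>
      cost_plus _ _) (by omega)

/-- Three values `A` and two unions take at most `29 * N` steps. The two loops over cuts contribute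
`K.length ^ 2`, and summing `2 ^ |L \ L₁|` over all `L₁` gives `3 ^ |L|`. -/
theorem cost_valueC {K : List (Fin N)} {s : ℕ} (hk : 1 ≤ K.length) (v : Fin N) (L : ℕ) {I : ℕ × ℕ}
    (hI : I.2 ≤ K.length) :
    Cost (valueC K s v L I) (s + 2 * 2 ^ onesCount s L + (origins K.length I).length *
      ((s + 2) * 2 ^ onesCount s L + 132 * (K.length ^ 2 * N) * 3 ^ onesCount s L + 2))
      fun _ => True := by
  have hN : 1 ≤ N := v.pos
  set k := K.length
  refine (cost_submasks s L).bind ?_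
  rintro _ rfl
  refine cost_minimum_const rfl fun a _ => ?_
  refine Cost.le (cost_minimum (T := fun M => s + 132 * (k ^ 2 * N) * 2 ^ onesCount s (L ^^^ M))
    fun L₁ _ => ?_) (le_of_eq ?_)
  · have hkN : 1 ≤ k ^ 2 * N := Nat.mul_pos (Nat.pow_pos hk) hN
    have h2 : 1 ≤ 2 ^ onesCount s (L ^^^ L₁) := Nat.one_le_two_pow
    refine Cost.le ((cost_submasks s (L ^^^ L₁)).bind
      (T' := 2 ^ onesCount s (L ^^^ L₁) * (128 * (k ^ 2 * N) + 2)) ?_) (by nlinarith)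
    rintro _ rfl
    refine cost_minimum_const (length_submaskList _ _) fun L₂ _ => ?_
    refine (cost_minimum_const List.length_range (T := 62 * (k * N)) fun c hc => ?_).le ?_
    · refine (cost_minimum_const List.length_range (T := 29 * N) fun d _ => ?_).le ?_
      · exact Cost.le ((cost_valueA _ _ _ _).bind fun _ _ => (cost_valueA _ _ _ _).bind fun _ _ =>
          (cost_valueA _ _ _ _).bind fun _ _ => (cost_plus _ _).bind fun _ _ => cost_plus _ _)
          (by omega)
      · calc (I.2 - c + 1) * (29 * N + 2) ≤ (2 * k) * (31 * N) :=
              Nat.mul_le_mul (by omega) (by omega)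
          _ = 62 * (k * N) := by ring
    · have : 1 ≤ k * N := Nat.mul_pos hk hN
      calc (I.2 + 1) * (62 * (k * N) + 2) ≤ (2 * k) * (64 * (k * N)) :=
            Nat.mul_le_mul (by omega) (by omega)
        _ = 128 * (k ^ 2 * N) := by ring
  · rw [show (fun M => s + 132 * (k ^ 2 * N) * 2 ^ onesCount s (L ^^^ M) + 2) = fun M =>
      (s + 2) + 132 * (k ^ 2 * N) * 2 ^ onesCount s (L ^^^ M) from funext fun M => by omega,
      List.sum_map_add, List.sum_map_mul_left, sum_pow_submaskList]
    simp [length_submaskList, mul_comm]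

theorem length_origins_pos {k : ℕ} (hk : 1 ≤ k) (I : ℕ × ℕ) : 1 ≤ (origins k I).length := by
  unfold origins
  split_ifs
  · simpa
  · simp

/-- Either there are up to `k` intervals with one listing each, or a single interval, all of `K`,
with `k` listings. -/
theorem length_starts_mul_le {k j : ℕ} (hk : 1 ≤ k) (a : ℕ) :
    (starts k j).length * (origins k (ival k a j)).length ≤ k := by
  unfold origins
  rw [ival_snd]
  unfold starts
  split_ifs with h1 h2 h3
  · simp
  · simpa
  · omega
  · simp

theorem cost_fillEntries {K : List (Fin N)} {s : ℕ} (hk : 1 ≤ K.length) (hN : 1 ≤ N) (hs : s ≤ N)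
    (L : ℕ) {I : ℕ × ℕ} (hI : I.2 ≤ K.length) :
    Cost (fillEntries K s L I) (167 * (N * ((origins K.length I).length *
      (K.length ^ 2 * N * 3 ^ onesCount s L)))) fun _ => True := by
  set k := K.length
  set o := onesCount s L
  set q := (origins k I).length with hq
  set Y := k ^ 2 * N * 3 ^ o with hY
  have hq1 : 1 ≤ q := length_origins_pos hk I
  have h23 : 2 ^ o ≤ 3 ^ o := Nat.pow_le_pow_left (by omega) o
  have hkk : k ≤ k ^ 2 := Nat.le_self_pow (by omega) k
  have hkN : k ≤ k ^ 2 * N := hkk.trans (Nat.le_mul_of_pos_right _ hN)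
  have hNN : N ≤ k ^ 2 * N := Nat.le_mul_of_pos_left _ (Nat.pow_pos hk)
  have hkY : k * 2 ^ o ≤ Y := Nat.mul_le_mul hkN h23
  have hNY : N * 2 ^ o ≤ Y := Nat.mul_le_mul hNN h23
  have hpo : 1 ≤ 2 ^ o := Nat.one_le_two_pow
  have hN' : N ≤ N * 2 ^ o := Nat.le_mul_of_pos_right _ hpo
  have ho' : 2 ^ o ≤ N * 2 ^ o := Nat.le_mul_of_pos_left _ hN
  -- Producing the submasks costs up to `s` steps per mask; as `s ≤ N`, this disappears in the cost
  -- of the values `A`.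
  have hs2 : (s + 2) * 2 ^ o ≤ 3 * Y :=
    (Nat.mul_le_mul_right _ (by omega : s + 2 ≤ 3 * N)).trans (by rw [Nat.mul_assoc]; omega)
  have hW : Y ≤ q * Y := Nat.le_mul_of_pos_left _ hq1
  have hB : s + 2 * 2 ^ o + q * (16 * (k * 2 ^ o)) ≤ 19 * (q * Y) := by
    have : q * (16 * (k * 2 ^ o)) ≤ 16 * (q * Y) := by
      rw [Nat.mul_left_comm]
      exact Nat.mul_le_mul_left _ (Nat.mul_le_mul_left _ hkY)
    omega
  have hC : s + 2 * 2 ^ o + q * ((s + 2) * 2 ^ o + 132 * (k ^ 2 * N) * 3 ^ o + 2) ≤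
      140 * (q * Y) := by
    have : q * ((s + 2) * 2 ^ o + 132 * (k ^ 2 * N) * 3 ^ o + 2) ≤ 137 * (q * Y) := by
      refine (Nat.mul_le_mul_left _ ?_).trans (Nat.mul_left_comm q 137 Y).le
      rw [Nat.mul_assoc, ← hY]
      omega
    omega
  have hrest : ∀ (v : Fin N) {T : ℕ} {x : Prog N (Entry N)} {f : Entry N → Prog N Unit},
      (Cost x T fun _ => True) → (∀ e, Cost (f e) 1 fun _ => True) →
      Cost (do
        if (← memL v L) || (← memI k v I) then
          return ()
        else
          let e ← x
          f e) (T + 3) fun _ => True := by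
    intro v T x f hx hf
    refine Cost.le ((cost_memL v L).bind fun _ _ => (cost_memI k v I).bind (T' := T + 1)
      fun _ _ => ?_) (by omega)
    split_ifs
    · exact cost_pure trivial
    · exact hx.bind fun e _ => hf e
  refine Cost.le (Cost.bind (Q := fun _ => True) (cost_forEach_const List.length_finRange fun v _ =>
    hrest v ((cost_valueB hk v L hI).le hB) fun e => cost_writeB _ _ _ _) fun _ _ =>
    cost_forEach_const List.length_finRange fun v _ =>
    hrest v ((cost_valueC hk v L hI).le hC) fun e => cost_writeC _ _ _ _) ?_
  -- `167 = (19 + 3 + 1) + (140 + 3 + 1)`: for each of the two loops, the value, then two tests and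
  -- a write, then the loop step.
  rw [← Nat.mul_add, Nat.mul_left_comm 167]
  exact Nat.mul_le_mul_left _ (by omega)

/-- For a mask `L`, the intervals and their listings contribute `O(k ^ 2)` and the cuts another `k ^
2`, for each of `N` roots and `N` vertices in `A`, with `3 ^ |L|` partitions. Summing over `L` gives
`4 ^ s`. -/
theorem cost_fillTables {K : List (Fin N)} {s : ℕ} (hk : 1 ≤ K.length) (hN : 1 ≤ N) (hs : s ≤ N) :
    Cost (fillTables K s) (400 * (N ^ 2 * K.length ^ 4 * 4 ^ s)) fun _ => True := by
  set k := K.length with hkdef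
  set Y := N ^ 2 * k ^ 4 with hY
  have hY1 : 1 ≤ Y := Nat.mul_pos (Nat.pow_pos hN) (Nat.pow_pos hk)
  have hset : ∀ L, Cost (forEach (List.range (k + 1)) fun j =>
      if 2 ≤ onesCount s L + j then
        forEach (starts k j) fun a => fillEntries K s L (ival k a j)
      else
        return ()) (338 * (Y * 3 ^ onesCount s L)) fun _ => True := by
    intro L
    set Z := k ^ 2 * N * 3 ^ onesCount s L with hZ
    have hZ1 : 1 ≤ N * Z := Nat.mul_pos hN (Nat.mul_pos (Nat.mul_pos (Nat.pow_pos hk) hN)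
      (Nat.pow_pos (by omega)))
    have hkZ : k ≤ k * (N * Z) := Nat.le_mul_of_pos_right _ hZ1
    refine (cost_forEach_const List.length_range (T := 168 * (k * (N * Z))) fun j hj => ?_).le ?_
    · have hj := List.mem_range.1 hj
      split_ifs
      · set q := (origins k (ival k 0 j)).length
        have hq : ∀ a, (origins k (ival k a j)).length = q := by
          intro a
          simp only [q, origins, ival_snd]
          split_ifs <;> rfl
        have hle : (starts k j).length * q ≤ k := length_starts_mul_le hk 0
        refine (cost_forEach_const rfl fun a _ => (cost_fillEntries hk hN hs L
          (by rw [ival_snd]; omega)).le (by rw [hq])).le ?_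
        have hst : (starts k j).length ≤ k :=
          (Nat.le_mul_of_pos_right _ (length_origins_pos hk _)).trans hle
        calc (starts k j).length * (167 * (N * (q * Z)) + 1)
            = 167 * ((starts k j).length * q * (N * Z)) + (starts k j).length := by ring
          _ ≤ 167 * (k * (N * Z)) + k :=
            Nat.add_le_add (Nat.mul_le_mul_left _ (Nat.mul_le_mul_right _ hle)) hst
          _ ≤ 168 * (k * (N * Z)) := by omega
      · exact cost_pure trivial
    · calc (k + 1) * (168 * (k * (N * Z)) + 1) ≤ (2 * k) * (169 * (k * (N * Z))) :=
            Nat.mul_le_mul (by omega) (by omega)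
        _ = 338 * (Y * 3 ^ onesCount s L) := by rw [hZ, hY]; ring
  refine (cost_forEach (T := fun i => ((List.range (2 ^ s)).map fun L =>
    (s + if onesCount s L = i then 338 * (Y * 3 ^ onesCount s L) else 0) + 1).sum)
    fun i _ => cost_forEach fun L _ => (cost_popcount s L).bind ?_).le ?_
  · rintro _ rfl
    beta_reduce
    split_ifs with h
    · rw [← h]
      exact hset L
    · exact cost_pure trivial
  · have hsum : ∀ (n : ℕ) (f : ℕ → ℕ), ((List.range n).map f).sum = ∑ i ∈ Finset.range n, f i :=
      fun n f => rfl
    simp only [hsum]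
    rw [Finset.sum_add_distrib, Finset.sum_comm]
    simp only [Finset.sum_add_distrib, Finset.sum_const, Finset.card_range, smul_eq_mul, mul_one]
    -- Every mask is inspected in all rounds but filled in only one, that of its own size.
    have hcol : ∑ L ∈ Finset.range (2 ^ s), ∑ i ∈ Finset.range (s + 1),
        (if onesCount s L = i then 338 * (Y * 3 ^ onesCount s L) else 0) =
        338 * (Y * 4 ^ s) := by
      rw [← sum_pow_onesCount 3 s, Finset.mul_sum, Finset.mul_sum]
      refine Finset.sum_congr rfl fun L _ => ?_
      rw [Finset.sum_ite_eq, if_pos (Finset.mem_range.2 (Nat.lt_succ_of_le (onesCount_le s L)))]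
    rw [hcol]
    have h24 : 2 ^ s ≤ 4 ^ s := Nat.pow_le_pow_left (by omega) s
    have hNY : N ^ 2 ≤ Y := Nat.le_mul_of_pos_right _ (Nat.pow_pos hk)
    -- Counting the ones of every mask again in each round costs `2 ^ s * (s + 1) * s`, which is
    -- absorbed because `s ≤ N`.
    have h1 : 2 ^ s * ((s + 1) * s) ≤ 2 * (Y * 4 ^ s) := by
      calc 2 ^ s * ((s + 1) * s) ≤ 4 ^ s * ((2 * N) * N) :=
            Nat.mul_le_mul h24 (Nat.mul_le_mul (by omega) hs)
        _ = 2 * (N ^ 2 * 4 ^ s) := by ring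
        _ ≤ _ := Nat.mul_le_mul_left _ (Nat.mul_le_mul_right _ hNY)
    have h2 : 2 ^ s * (s + 1) ≤ 2 * (Y * 4 ^ s) := by
      calc 2 ^ s * (s + 1) ≤ 4 ^ s * (2 * N ^ 2) :=
            Nat.mul_le_mul h24 (by nlinarith)
        _ = 2 * (N ^ 2 * 4 ^ s) := by ring
        _ ≤ _ := Nat.mul_le_mul_left _ (Nat.mul_le_mul_right _ hNY)
    have h3 : s + 1 ≤ 2 * (Y * 4 ^ s) :=
      (Nat.le_mul_of_pos_left _ (Nat.two_pow_pos s)).trans h2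
    have h4 : 2 ^ s * s + 2 ^ s = 2 ^ s * (s + 1) := by ring
    omega

theorem cost_allPairs (G : SimpleGraph (Fin N)) [DecidableRel G.Adj] (w : Sym2 (Fin N) → ℝ≥0) :
    Cost (allPairs G w) (N * (N * 2 + 1) + N * (N * (N * 7 + 1) + 1)) fun _ => True := by
  refine Cost.bind (Q := fun _ => True) ?_ fun _ _ => ?_
  · exact cost_forEach_const List.length_finRange fun u _ =>
      cost_forEach_const List.length_finRange fun v _ => cost_writeDist _ _ _
  · exact cost_forEach_const List.length_finRange fun x _ =>
      cost_forEach_const List.length_finRange fun u _ =>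
      cost_forEach_const List.length_finRange fun v _ => Cost.le
        ((cost_readDist _ _).bind fun _ _ => (cost_readDist _ _).bind fun _ _ =>
        (cost_plus _ _).bind fun _ _ => (cost_readDist _ _).bind fun _ _ =>
        (cost_better _ _).bind fun _ _ => cost_writeDist _ _ _) (by omega)

theorem cost_baseCases (K S : List (Fin N)) :
    Cost (baseCases K S) (K.length * 2 + (S.length * 2 +
      N * (1 + (K.length * 3 + S.length * 3) + 1))) fun _ => True :=
  (cost_forEach_const List.length_zipIdx fun _ _ => cost_writePosK _ _).bind fun _ _ =>
    (cost_forEach_const List.length_zipIdx fun _ _ => cost_writePosS _ _).bind fun _ _ =>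
    cost_forEach_const List.length_finRange fun _ _ => (cost_writeC _ _ _ _).bind fun _ _ =>
    (cost_forEach_const List.length_zipIdx fun _ _ =>
      (cost_readDist _ _).bind fun _ _ => cost_writeC _ _ _ _).bind fun _ _ =>
    cost_forEach_const List.length_zipIdx fun _ _ =>
      (cost_readDist _ _).bind fun _ _ => cost_writeC _ _ _ _

theorem cost_finalEntry (K R : List (Fin N)) : Cost (finalEntry K R) 1 fun _ => True := by
  unfold finalEntry
  split
  · exact cost_readC _ _ _
  · exact cost_readC _ _ _
  · exact cost_pure trivial

end Cost

/-- The output is written in time proportional to the size of its pointer structure, at most `21 * N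
^ 2` by soundness. The time for the values `B` is dominated by that for the values `C`, so no
separate term for it is kept. -/
theorem runningTime_le {N : ℕ} {G : SimpleGraph (Fin N)} [DecidableRel G.Adj]
    {w : Sym2 (Fin N) → ℝ≥0} {K R : List (Fin N)} (hG : G.Connected) (hK : Noncrossing G K)
    (hnd : (K ++ R).Nodup) (hk : 1 ≤ K.length) :
    runningTime G w K R ≤ 500 * (N ^ 2 * K.length ^ 4 * 4 ^ R.length + N ^ 3) := by
  have hcard : (K ++ R).length ≤ N := by simpa using hnd.length_le_card
  have hlen : (K ++ R).length = K.length + R.length := List.length_append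
  have hN : 1 ≤ N := by omega
  have htail : R.tail.length ≤ R.length := by rw [List.length_tail]; omega
  obtain ⟨⟨-, hsize⟩, -⟩ := finalEntry_spec (w := w) hG hK hnd (by omega)
  have h1 := (cost_allPairs G w (Mem.init N)).2
  have h2 := (cost_baseCases K R.tail (allPairs G w (Mem.init N)).2).2
  have h3 := (cost_fillTables hk hN (s := R.tail.length) (by omega)
    (baseCases K R.tail (allPairs G w (Mem.init N)).2).2).2
  have h4 := (cost_finalEntry K R (finalMem G w K R)).2
  have h5 : runningTime G w K R = (finalEntry K R (finalMem G w K R)).2.steps +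
      (finalEntry K R (finalMem G w K R)).1.tree.size :=
    (flatten_spec (finalEntry K R (finalMem G w K R)).1.tree [] _).2
  have h6 : (Mem.init N).steps = 0 := rfl
  have h7 : N ^ 2 * K.length ^ 4 * 4 ^ R.tail.length ≤ N ^ 2 * K.length ^ 4 * 4 ^ R.length :=
    Nat.mul_le_mul_left _ (Nat.pow_le_pow_right (by omega) htail)
  have hNN : N ≤ N * N := Nat.le_mul_of_pos_left _ hN
  have h8 : sizeC N (K ++ R).length ≤ 21 * (N * N) := by
    have : (2 * N + 8) * (K ++ R).length ≤ (10 * N) * N := Nat.mul_le_mul (by omega) hcard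
    rw [Nat.mul_assoc] at this
    unfold sizeC
    omega
  have h9 : N * N ≤ N ^ 3 := by
    rw [← pow_two]
    exact Nat.pow_le_pow_right hN (by omega)
  have h10 : N * (N * 2 + 1) + N * (N * (N * 7 + 1) + 1) = 7 * N ^ 3 + 3 * (N * N) + 2 * N := by
    ring
  have h11 : N * (1 + (K.length * 3 + R.tail.length * 3) + 1) ≤ N * (5 * N) :=
    Nat.mul_le_mul_left _ (by omega)
  rw [Nat.mul_left_comm] at h11
  unfold finalMem at h4 h5 hsize
  omega

end SteinerDP

theorem mainTheorem6 :
    ∃ c : ℕ, ∀ (N : ℕ) (G : SimpleGraph (Fin N)) [DecidableRel G.Adj]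
      (w : Sym2 (Fin N) → ℝ≥0) (E : PlaneEmbedding G) (W K R : List (Fin N)) (n k : ℕ),
      G.Connected → E.IsOuterWalk W →
      K.Sublist W → (∀ v ∈ R, v ∉ W) → (K ++ R).Nodup →
      (K ++ R).length = n → K.length = k → 1 ≤ n →
      (∃ T : G.Subgraph,
        IsSteinerMinimalTree G w {v | v ∈ K ++ R} T ∧
        T.edgeSet = {e | e ∈ (SteinerDP.output G w K R).2} ∧
        (SteinerDP.output G w K R).1 = (subgraphLength w T : ℝ≥0∞)) ∧
      (1 ≤ k →
        SteinerDP.runningTime G w K R ≤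
          c * (N ^ 2 * k ^ 4 * 4 ^ (n - k) + N * k ^ 3 * 3 ^ (n - k) + N ^ 3)) := by
  refine ⟨500, fun N G _ w E W K R n k hG hW hKW _ hnd hn hk h1 => ?_⟩
  subst hn hk
  have hK := SteinerDP.noncrossing_of_sublist E hG hW hKW
  refine ⟨SteinerDP.exists_steinerMinimalTree hG hK hnd h1, fun hk => ?_⟩
  have := SteinerDP.runningTime_le (w := w) hG hK hnd hk
  rw [List.length_append, Nat.add_sub_cancel_left]
  -- The bound proved is stronger: the middle term is only added.
  exact this.trans (Nat.mul_le_mul_left _ (Nat.add_le_add_right (Nat.le_add_right _ _) _))
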